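/- **Setting.** Let $m\ge 2$, $\mathcal A=\{1,\dots,2m\}$, and let $a\mapsto\bar a$ be the involution of $\mathcal A$ exchanging $i$ and $m+i$ for $1\le i\le m$. Let $D_a\subset\mathbb C$ ($a\in\mathcal A$) be open disks centred on the real line with mutually disjoint closures, and let $\gamma_a\in\mathrm{PSL}_2(\mathbb R)$, acting on $\overline{\mathbb C}=\mathbb C\cup\{\infty\}$ by Möbius transformations, satisfy $\gamma_{\bar a}=\gamma_a^{-1}$ and $\gamma_a(\overline{\mathbb C}\smallsetminus\overline{D_{\bar a}})=D_a$. These are the Schottky data of a non-elementary Schottky group $\Gamma=\langle\gamma_a\rangle$. A word $\mathbf a=a_1\cdots a_n$ in $\mathcal A$ is reduced if $a_j\ne\overline{a_{j+1}}$ for all $j$. Put $\gamma_{\mathbf a}=\gamma_{a_1}\cdots\gamma_{a_n}$, $\mathbf a'=a_1\cdots a_{n-1}$ (if $n\geq 1$) and $\overline{\mathbf a}=\bar a_n\cdots\bar a_1$. For a letter $b$ write $\mathbf a\to b$ if $\mathbf a=\emptyset$ or $a_n\ne\bar b$. For $\mathbf a\neq\emptyset$ reduced let $I_{\mathbf a}=\gamma_{\mathbf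 a'}(D_{a_n})\cap\mathbb R$, an interval of length $|I_{\mathbf a}|$, and put $|I_\emptyset|=\infty$. The limit set is $\Lambda=\bigcap_{n\ge1}\bigcup_{\mathbf a}I_{\mathbf a}\subset\mathbb R$, with $\mathbf a$ running over the reduced words of length $n$, and $\delta$ is its Hausdorff dimension. For $h>0$ let $\Omega(h)=\{z\in\mathbb C:|z-p|<h\text{ for some }p\in\Lambda\}$, and let $H^2(\Omega(h))$ be the Bergman space of holomorphic functions on $\Omega(h)$ that are square-integrable with respect to Lebesgue measure. For $\tau>0$ put $$Z(\tau)=\{\mathbf a\neq\emptyset\text{ reduced}:|I_{\mathbf a}|\le\tau<|I_{\mathbf a'}|\},\qquad Y(\tau)=\{(\overline{\mathbf a})':\mathbf a\in Z(\tau)\},$$ and for $s\in\mathbb C$ let $\mathcal L_{\tau,s}$ be the operator on $H^2(\Omega(h))$ given by $$\mathcal L_{\tau,s}f(z)=\sum_{\mathbf a\in Y(\tau),\ \mathbf a\to b}\gamma_{\mathbf a}'(z)^s f(\gamma_{\mathbf a}(z))\qquad\text{for }z\in\Omega(h)\cap D_b,\ b\in\mathcal A,$$ with the principal branch of the complex power.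 It is well defined if $Y(\tau)$ is a finite set of non-empty words, $\Omega(h)\subset\bigcup_b D_b$, $\gamma_{\mathbf a}(\Omega(h)\cap D_b)\subset\Omega(h)$ for all $b\in\mathcal A$ and $\mathbf a\in Y(\tau)$ with $\mathbf a\to b$, and the formula defines a bounded operator on $H^2(\Omega(h))$. Put $\mathcal L_{\tau_0,\tau_1,s}=\mathcal L_{\tau_0,s}\circ\mathcal L_{\tau_1,s}$, and let $\|A\|_{\mathrm{HS},h}^2=\mathrm{tr}(A^*A)$ be the squared Hilbert–Schmidt norm on $H^2(\Omega(h))$. **Proposition (main technical estimate).** Let $A\ge1$. There is $T_0>0$, depending only on the Schottky data and on $A$, such that the following holds for all $T\ge T_0$, with $h=T^{-1}$, and all $\tau_0,\tau_1>0$ satisfying $$A^{-1}T^{-1}\le\tau_0\le A\,T^{-1},\qquad A^{-1}T^{-\frac{\delta}{2\delta+2}}\le\tau_1\le A\,T^{-\frac{\delta}{2\delta+2}}.$$ 1. For every $s\in\mathbb C$ the operators $\mathcal L_{\tau_0,s}$ and $\mathcal L_{\tau_1,s}$ on $H^2(\Omega(h))$ are well defined, and $\|\mathcal L_{\tau_0,\tau_1,s}\|_{\mathrm{HS},h}<\infty$.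 2. For every $\epsilon>0$ there is a constant $C>0$, depending only on the Schottky data, $A$ and $\epsilon$ (not on $T,\tau_0,\tau_1,\sigma,s$), such that for all $\sigma\in[0,\delta]$ and all $s\in\mathbb C$ with $\mathrm{Re}(s)\ge\sigma$ and $|\mathrm{Im}(s)|\le T$, the function $t\mapsto\|\mathcal L_{\tau_0,\tau_1,s+it}\|_{\mathrm{HS},h}^2$ is integrable on $[0,T]$ and $$\frac1T\int_0^T\|\mathcal L_{\tau_0,\tau_1,s+it}\|_{\mathrm{HS},h}^2\,dt\ \le\ C\,T^{\,\delta-\frac{3\delta+2}{2\delta+2}(2\sigma-\delta)+\epsilon}.$$ -/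

import Mathlib

open MeasureTheory
open scoped ENNReal Topology

/-- Sub-mean value estimate for holomorphic functions on a disk. -/
theorem enorm_sq_le_of_differentiableOn_ball {g : ℂ → ℂ} {z : ℂ} {r : ℝ} (hr : 0 < r)
    (hg : DifferentiableOn ℂ g (Metric.ball z r)) :
    ENNReal.ofReal (r / 2) * ENNReal.ofReal (r / 2) * (ENNReal.ofReal (2 * Real.pi) * ‖g z‖ₑ ^ 2) ≤
      ∫⁻ w in Metric.ball z r, ‖g w‖ₑ ^ 2 := by
  classical
  set G : ℂ → ℂ := (Metric.ball z r).piecewise g (fun _ => 0) with hG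
  have hGm : Measurable G :=
    hg.continuousOn.measurable_piecewise continuousOn_const Metric.isOpen_ball.measurableSet
  have h1 : ∫⁻ w in Metric.ball z r, ‖g w‖ₑ ^ 2 = ∫⁻ w, ‖G (z + w)‖ₑ ^ 2 := by
    rw [lintegral_add_left_eq_self (fun w => ‖G w‖ₑ ^ 2) z,
      ← lintegral_indicator Metric.isOpen_ball.measurableSet]
    congr 1
    funext w
    by_cases hw : w ∈ Metric.ball z r
    · simp [hG, hw]
    · simp [hG, hw]
  rw [h1, ← Complex.lintegral_comp_polarCoord_symm, polarCoord_target,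
    Measure.volume_eq_prod, ← Measure.prod_restrict, lintegral_prod]
  swap
  · have hc : Continuous fun p : ℝ × ℝ => Complex.polarCoord.symm p := by
      simp_rw [Complex.polarCoord_symm_apply]; fun_prop
    have : Measurable fun p : ℝ × ℝ => ‖G (z + Complex.polarCoord.symm p)‖ₑ ^ 2 :=
      ((hGm.comp (measurable_const.add hc.measurable)).enorm).pow_const 2
    exact ((measurable_fst.ennreal_ofReal).mul this).aemeasurable
  have key : ∀ ρ ∈ Set.Ioo (r / 2) r, ENNReal.ofReal (r / 2) * (ENNReal.ofReal (2 * Real.pi) * ‖g z‖ₑ ^ 2)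
      ≤ ∫⁻ θ in Set.Ioo (-Real.pi) Real.pi,
        ENNReal.ofReal ρ • ‖G (z + Complex.polarCoord.symm (ρ, θ))‖ₑ ^ 2 := by
    intro ρ hρ
    have hρ0 : 0 < ρ := by linarith [hρ.1]
    simp_rw [smul_eq_mul]
    rw [lintegral_const_mul' _ _ ENNReal.ofReal_ne_top]
    gcongr
    · exact hρ.1.le
    have hcl : DiffContOnCl ℂ (fun w => g w ^ 2) (Metric.ball z |ρ|) := by
      apply DifferentiableOn.diffContOnCl
      rw [abs_of_pos hρ0, closure_ball _ hρ0.ne']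
      exact (hg.mono (Metric.closedBall_subset_ball hρ.2)).pow 2
    have hm := hcl.circleAverage
    rw [Real.circleAverage_def] at hm
    have hper : Function.Periodic (fun θ : ℝ => g (circleMap z ρ θ) ^ 2) (2 * Real.pi) := by
      intro θ
      simp only [periodic_circleMap z ρ θ]
    have h2 := hper.intervalIntegral_add_eq 0 (-Real.pi)
    rw [zero_add, show -Real.pi + 2 * Real.pi = Real.pi by ring] at h2
    rw [h2] at hm
    have hpi : (0 : ℝ) < 2 * Real.pi := by positivity
    have h3 : ‖(2 * Real.pi) • (g z) ^ 2‖ₑ ≤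
        ∫⁻ θ in Set.Ioc (-Real.pi) Real.pi, ‖g (circleMap z ρ θ) ^ 2‖ₑ := by
      rw [← hm, smul_smul, mul_inv_cancel₀ hpi.ne', one_smul,
        intervalIntegral.integral_of_le (by linarith [Real.pi_pos])]
      exact enorm_integral_le_lintegral_enorm _
    rw [enorm_smul, enorm_pow, Real.enorm_eq_ofReal hpi.le, setLIntegral_congr Ioo_ae_eq_Ioc.symm] at h3
    refine h3.trans (le_of_eq (lintegral_congr fun θ => ?_))
    have hmem : z + Complex.polarCoord.symm (ρ, θ) = circleMap z ρ θ := by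
      rw [Complex.polarCoord_symm_apply, circleMap, Complex.exp_mul_I]
      push_cast
      rfl
    have hb : circleMap z ρ θ ∈ Metric.ball z r := by
      simp [circleMap, abs_of_pos hρ0, hρ.2]
    rw [hmem, hG, Set.piecewise_eq_of_mem _ _ _ hb, enorm_pow]
  calc _ = ∫⁻ _ in Set.Ioo (r / 2) r,
        ENNReal.ofReal (r / 2) * (ENNReal.ofReal (2 * Real.pi) * ‖g z‖ₑ ^ 2) := by
        rw [setLIntegral_const, Real.volume_Ioo, show r - r / 2 = r / 2 by ring]; ring
    _ ≤ _ := setLIntegral_mono' measurableSet_Ioo key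
    _ ≤ _ := lintegral_mono_set (fun ρ hρ => by
        have := hρ.1; simp only [Set.mem_Ioi]; linarith)

/-- The Bergman space `H²(Ω)`: the classes in `L²(Ω)` (Lebesgue measure on `ℂ`) that contain a
function holomorphic on `Ω`, with the `L²` inner product. -/
def bergmanSpace (Ω : Set ℂ) : Submodule ℂ (Lp ℂ 2 (volume.restrict Ω)) where
  carrier := {f | ∃ g : ℂ → ℂ, DifferentiableOn ℂ g Ω ∧ f =ᵐ[volume.restrict Ω] g}
  zero_mem' := ⟨0, differentiableOn_const 0, Lp.coeFn_zero ℂ 2 _⟩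
  add_mem' := by
    rintro f₁ f₂ ⟨g₁, h₁, e₁⟩ ⟨g₂, h₂, e₂⟩
    exact ⟨g₁ + g₂, h₁.add h₂, (Lp.coeFn_add f₁ f₂).trans (e₁.add e₂)⟩
  smul_mem' := by
    rintro c f ⟨g, h, e⟩
    exact ⟨c • g, h.const_smul c, (Lp.coeFn_smul c f).trans (e.const_smul c)⟩

theorem isClosed_bergmanSpace {Ω : Set ℂ} (hΩ : IsOpen Ω) :
    IsClosed (bergmanSpace Ω : Set (Lp ℂ 2 (volume.restrict Ω))) := by
  refine isSeqClosed_iff_isClosed.mp fun f F hf hF => ?_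
  choose g hg hfg using hf
  have hL2 : ∀ n k, ∫⁻ w in Ω, ‖g n w - g k w‖ₑ ^ 2 = edist (f n) (f k) ^ 2 := by
    intro n k
    rw [Lp.edist_def, eLpNorm_eq_lintegral_rpow_enorm_toReal (by norm_num) (by norm_num)]
    simp only [ENNReal.toReal_ofNat, ENNReal.rpow_ofNat]
    rw [← ENNReal.rpow_natCast, ← ENNReal.rpow_mul]
    norm_num
    refine lintegral_congr_ae ?_
    filter_upwards [hfg n, hfg k] with w h1 h2
    simp [h1, h2]
  have hball : ∀ z₀ ∈ Ω, ∃ r > 0, Metric.ball z₀ r ⊆ Ω ∧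
      UniformCauchySeqOn g Filter.atTop (Metric.ball z₀ r) := by
    intro z₀ hz₀
    obtain ⟨r, hr, hrΩ⟩ := Metric.isOpen_iff.mp hΩ z₀ hz₀
    have hr2 : 0 < r / 2 := by linarith
    refine ⟨r / 2, hr2, (Metric.ball_subset_ball (by linarith)).trans hrΩ, ?_⟩
    set c : ℝ≥0∞ := ENNReal.ofReal (r / 2 / 2) * ENNReal.ofReal (r / 2 / 2) *
      ENNReal.ofReal (2 * Real.pi) with hc
    have hc0 : c ≠ 0 := by
      simp [hc, hr, Real.pi_pos]
    have hct : c ≠ ∞ := by simp [hc, ENNReal.mul_eq_top]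
    have hpt : ∀ n k, ∀ z ∈ Metric.ball z₀ (r / 2),
        c * edist (g n z) (g k z) ^ 2 ≤ edist (f n) (f k) ^ 2 := by
      intro n k z hz
      have hsub : Metric.ball z (r / 2) ⊆ Ω := by
        refine (Metric.ball_subset_ball' ?_).trans hrΩ
        rw [Metric.mem_ball] at hz; linarith
      have := enorm_sq_le_of_differentiableOn_ball hr2
        (((hg n).sub (hg k)).mono hsub : DifferentiableOn ℂ (g n - g k) _)
      rw [← hL2, edist_eq_enorm_sub, hc, mul_assoc]
      exact this.trans (lintegral_mono_set hsub)
    have hc' : 0 < c.toReal := ENNReal.toReal_pos hc0 hct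
    have hpt' : ∀ n k, ∀ z ∈ Metric.ball z₀ (r / 2),
        c.toReal * dist (g n z) (g k z) ^ 2 ≤ dist (f n) (f k) ^ 2 := by
      intro n k z hz
      have h := ENNReal.toReal_mono (by simp [edist_ne_top]) (hpt n k z hz)
      simpa [ENNReal.toReal_mul, ← dist_edist] using h
    rw [Metric.uniformCauchySeqOn_iff]
    intro ε hε
    have hcau := Metric.cauchySeq_iff.mp hF.cauchySeq (Real.sqrt c.toReal * ε) (by positivity)
    obtain ⟨N, hN⟩ := hcau
    refine ⟨N, fun n hn k hk z hz => ?_⟩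
    have h1 := hN n hn k hk
    have h2 : dist (f n) (f k) ^ 2 < c.toReal * ε ^ 2 := by
      have := pow_lt_pow_left₀ h1 dist_nonneg two_ne_zero
      rwa [mul_pow, Real.sq_sqrt hc'.le] at this
    have h3 := (hpt' n k z hz).trans_lt h2
    exact lt_of_pow_lt_pow_left₀ 2 hε.le (lt_of_mul_lt_mul_left h3 hc'.le)
  have hlim : ∀ z, ∃ y, z ∈ Ω → Filter.Tendsto (fun n => g n z) Filter.atTop (𝓝 y) := by
    intro z
    by_cases hz : z ∈ Ω
    · obtain ⟨r, hr, -, hu⟩ := hball z hz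
      obtain ⟨y, hy⟩ := cauchySeq_tendsto_of_complete
        (hu.cauchySeq (Metric.mem_ball_self hr))
      exact ⟨y, fun _ => hy⟩
    · exact ⟨0, fun h => absurd h hz⟩
  choose G hG using hlim
  have hloc : TendstoLocallyUniformlyOn g G Filter.atTop Ω := by
    intro u hu z hz
    obtain ⟨r, hr, hsub, hc⟩ := hball z hz
    exact ⟨Metric.ball z r, mem_nhdsWithin_of_mem_nhds (Metric.ball_mem_nhds z hr),
      hc.tendstoUniformlyOn_of_tendsto (fun w hw => hG w (hsub hw)) u hu⟩
  refine ⟨G, hloc.differentiableOn (Filter.Eventually.of_forall hg) hΩ, ?_⟩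
  obtain ⟨ns, hns, hae⟩ := (tendstoInMeasure_of_tendsto_Lp hF).exists_seq_tendsto_ae
  have hall : ∀ᵐ x ∂volume.restrict Ω, ∀ n, f n x = g n x := ae_all_iff.mpr hfg
  filter_upwards [hae, hall, ae_restrict_mem hΩ.measurableSet] with x h1 h2 h3
  refine tendsto_nhds_unique h1 ?_
  simp_rw [h2]
  exact (hG x h3).comp hns.tendsto_atTop

theorem completeSpace_bergmanSpace {Ω : Set ℂ} (hΩ : IsOpen Ω) :
    CompleteSpace (bergmanSpace Ω) :=
  (isClosed_bergmanSpace hΩ).completeSpace_coe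

/-- The holomorphic representative of an element of `H²(Ω)`. On an open set `Ω` its values are
uniquely determined (`bergmanSpace.rep_eqOn`); its values off `Ω` are meaningless. -/
noncomputable def bergmanSpace.rep {Ω : Set ℂ} (f : bergmanSpace Ω) : ℂ → ℂ :=
  f.2.choose

theorem bergmanSpace.differentiableOn_rep {Ω : Set ℂ} (f : bergmanSpace Ω) :
    DifferentiableOn ℂ (bergmanSpace.rep f) Ω :=
  f.2.choose_spec.1

theorem bergmanSpace.coe_ae_eq_rep {Ω : Set ℂ} (f : bergmanSpace Ω) :
    (f : Lp ℂ 2 (volume.restrict Ω)) =ᵐ[volume.restrict Ω] bergmanSpace.rep f :=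
  f.2.choose_spec.2

theorem bergmanSpace.rep_eqOn {Ω : Set ℂ} (hΩ : IsOpen Ω) (f : bergmanSpace Ω) {g : ℂ → ℂ}
    (hg : DifferentiableOn ℂ g Ω)
    (hfg : (f : Lp ℂ 2 (volume.restrict Ω)) =ᵐ[volume.restrict Ω] g) :
    Set.EqOn (bergmanSpace.rep f) g Ω :=
  Measure.eqOn_open_of_ae_eq ((bergmanSpace.coe_ae_eq_rep f).symm.trans hfg) hΩ
    (bergmanSpace.differentiableOn_rep f).continuousOn hg.continuousOn

/-- The square of the Hilbert-Schmidt norm, `‖A‖²_HS = tr (A* A) = ∑ ‖A eᵢ‖²` for an orthonormal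
basis `(eᵢ)`; it does not depend on the basis (`hsNormSq_eq`) and is `∞` if `A` is not
Hilbert-Schmidt. -/
noncomputable def hsNormSq {H : Type*} [NormedAddCommGroup H] [InnerProductSpace ℂ H]
    [CompleteSpace H] (A : H →L[ℂ] H) : ℝ≥0∞ :=
  ∑' i, ‖A ((exists_hilbertBasis ℂ H).choose_spec.choose i)‖ₑ ^ 2

theorem HilbertBasis.tsum_enorm_inner_sq {H ι : Type*} [NormedAddCommGroup H]
    [InnerProductSpace ℂ H] (b : HilbertBasis ι ℂ H) (x : H) :
    ∑' i, ‖inner ℂ (b i) x‖ₑ ^ 2 = ‖x‖ₑ ^ 2 := by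
  have h := b.hasSum_inner_mul_inner x x
  have h2 : HasSum (fun i => ‖inner ℂ (b i) x‖ ^ 2) (‖x‖ ^ 2) := by
    have h3 := Complex.hasSum_re h
    rw [inner_self_eq_norm_sq_to_K] at h3
    convert h3 using 1
    · funext i
      rw [← inner_conj_symm x (b i), Complex.conj_mul']
      norm_cast
    · norm_cast
  have h4 := ENNReal.ofReal_tsum_of_nonneg (fun i => sq_nonneg ‖inner ℂ (b i) x‖) h2.summable
  rw [h2.tsum_eq] at h4
  simp_rw [ENNReal.ofReal_pow (norm_nonneg _), ofReal_norm] at h4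
  exact h4.symm

theorem HilbertBasis.tsum_enorm_apply_sq {H ι κ : Type*} [NormedAddCommGroup H]
    [InnerProductSpace ℂ H] [CompleteSpace H] (A : H →L[ℂ] H) (b : HilbertBasis ι ℂ H)
    (c : HilbertBasis κ ℂ H) :
    ∑' j, ‖A (c j)‖ₑ ^ 2 = ∑' i, ‖ContinuousLinearMap.adjoint A (b i)‖ₑ ^ 2 := by
  have h1 : ∀ j, ‖A (c j)‖ₑ ^ 2 = ∑' i, ‖inner ℂ (b i) (A (c j))‖ₑ ^ 2 :=
    fun j => (b.tsum_enorm_inner_sq _).symm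
  have h2 : ∀ i, ‖ContinuousLinearMap.adjoint A (b i)‖ₑ ^ 2 =
      ∑' j, ‖inner ℂ (c j) (ContinuousLinearMap.adjoint A (b i))‖ₑ ^ 2 :=
    fun i => (c.tsum_enorm_inner_sq _).symm
  rw [tsum_congr h1, tsum_congr h2, ENNReal.tsum_comm]
  refine tsum_congr fun i => tsum_congr fun j => ?_
  rw [ContinuousLinearMap.adjoint_inner_right, ← inner_conj_symm, RCLike.enorm_conj]

theorem hsNormSq_eq {H ι : Type*} [NormedAddCommGroup H] [InnerProductSpace ℂ H]
    [CompleteSpace H] (A : H →L[ℂ] H) (b : HilbertBasis ι ℂ H) :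
    hsNormSq A = ∑' i, ‖A (b i)‖ₑ ^ 2 := by
  rw [hsNormSq, HilbertBasis.tsum_enorm_apply_sq A b, ← HilbertBasis.tsum_enorm_apply_sq A b]

/-- The Möbius transformation `z ↦ (a z + b) / (c z + d)` on `ℂ` (away from its pole). -/
noncomputable def moebius (g : Matrix.SpecialLinearGroup (Fin 2) ℝ) (z : ℂ) : ℂ :=
  ((g 0 0 : ℝ) * z + (g 0 1 : ℝ)) / ((g 1 0 : ℝ) * z + (g 1 1 : ℝ))

/-- Schottky data with `2 m` disks. The alphabet is `Fin m ⊕ Fin m` (the letters `1, …, m` and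
`m + 1, …, 2 m`), with the involution `Sum.swap` in the role of `a ↦ ā`. The elements of
`PSL₂(ℝ)` are given by representatives in `SL₂(ℝ)`, which act on the Riemann sphere
`OnePoint ℂ`. -/
structure SchottkyData (m : ℕ) where
  /-- The (real) centre of the disk `D_a`. -/
  center : Fin m ⊕ Fin m → ℝ
  /-- The radius of the disk `D_a`. -/
  radius : Fin m ⊕ Fin m → ℝ
  radius_pos : ∀ a, 0 < radius a
  disjoint_closedBall : Pairwise fun a b =>
    Disjoint (Metric.closedBall (center a : ℂ) (radius a))
      (Metric.closedBall (center b : ℂ) (radius b))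
  /-- The isometry `γ_a`. -/
  gen : Fin m ⊕ Fin m → Matrix.SpecialLinearGroup (Fin 2) ℝ
  gen_swap : ∀ a, gen a.swap = (gen a)⁻¹
  /-- `γ_a` maps the exterior of the disk `D_ā` in the Riemann sphere onto the disk `D_a`. -/
  gen_image : ∀ a,
    (fun w : OnePoint ℂ => Matrix.SpecialLinearGroup.mapGL ℂ (gen a) • w) ''
      ((fun z : ℂ => (z : OnePoint ℂ)) ''
        Metric.closedBall (center a.swap : ℂ) (radius a.swap))ᶜ =
      (fun z : ℂ => (z : OnePoint ℂ)) '' Metric.ball (center a : ℂ) (radius a)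

namespace SchottkyData

variable {m : ℕ} (X : SchottkyData m)

/-- A word is reduced if no letter `a` is followed by `ā`. -/
def IsReduced (w : List (Fin m ⊕ Fin m)) : Prop :=
  List.IsChain (fun a b => a ≠ b.swap) w

/-- The relation `w → b` between a word `w` and a letter `b`: the word `w` is empty or its last
letter is not `b̄`. -/
def Precedes (w : List (Fin m ⊕ Fin m)) (b : Fin m ⊕ Fin m) : Prop :=
  ∀ a ∈ w.getLast?, a ≠ b.swap

/-- The mirror word `ā_n ⋯ ā_1` of `a_1 ⋯ a_n`, so that `γ_(mirror w) = (γ_w)⁻¹`. -/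
def mirror (w : List (Fin m ⊕ Fin m)) : List (Fin m ⊕ Fin m) :=
  (w.map Sum.swap).reverse

/-- `γ_w = γ_{a_1} ⋯ γ_{a_n}` for a word `w = a_1 ⋯ a_n`. -/
def wordElement (w : List (Fin m ⊕ Fin m)) : Matrix.SpecialLinearGroup (Fin 2) ℝ :=
  (w.map X.gen).prod

/-- The action of `γ_w` on complex numbers. -/
noncomputable def wordMap (w : List (Fin m ⊕ Fin m)) : ℂ → ℂ :=
  moebius (X.wordElement w)

/-- The open disk `D_a` of a letter `a`. -/
def disk (a : Fin m ⊕ Fin m) : Set ℂ :=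
  Metric.ball (X.center a : ℂ) (X.radius a)

/-- The disk `D_w = γ_{a_1 ⋯ a_{n-1}}(D_{a_n})` of a non-empty word `w = a_1 ⋯ a_n`. -/
def wordDisk (w : List (Fin m ⊕ Fin m)) : Set ℂ :=
  {z | ∃ a ∈ w.getLast?, z ∈ X.wordMap w.dropLast '' X.disk a}

/-- The interval `I_w = D_w ∩ ℝ` of a non-empty word `w`. -/
def wordInterval (w : List (Fin m ⊕ Fin m)) : Set ℝ :=
  {x | (x : ℂ) ∈ X.wordDisk w}

/-- The limit set `Λ`, as the intersection over `n ≥ 1` of the unions of the intervals `I_w` over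
all reduced words `w` of length `n`. -/
def limitSet : Set ℝ :=
  ⋂ (n : ℕ) (_ : 1 ≤ n), ⋃ (w : List (Fin m ⊕ Fin m)) (_ : IsReduced w ∧ w.length = n),
    X.wordInterval w

/-- `δ`, the Hausdorff dimension of the limit set. -/
noncomputable def delta : ℝ :=
  (dimH X.limitSet).toReal

/-- The set `Z(τ)` of the non-empty reduced words `w` with `|I_w| ≤ τ < |I_{w'}|`, where `w'` is `w`
without its last letter and `|I_∅| = ∞`. -/
def resolutionSet (τ : ℝ) : Set (List (Fin m ⊕ Fin m)) :=
  {w | IsReduced w ∧ w ≠ [] ∧ Metric.diam (X.wordInterval w) ≤ τ ∧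
    (w.dropLast = [] ∨ τ < Metric.diam (X.wordInterval w.dropLast))}

/-- The set `Y(τ)`: the words obtained from the mirror words of the elements of `Z(τ)` by deleting
the last letter. -/
def mirrorResolutionSet (τ : ℝ) : Set (List (Fin m ⊕ Fin m)) :=
  (fun w => (mirror w).dropLast) '' X.resolutionSet τ

/-- The complex neighbourhood `Ω(h) = Λ + {|z| < h}` of the limit set. -/
def Omega (h : ℝ) : Set ℂ :=
  Metric.thickening h ((fun x : ℝ => (x : ℂ)) '' X.limitSet)

/-- The Hilbert space `H²(Ω(h))`. -/
abbrev H2 (h : ℝ) : Type :=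
  bergmanSpace (X.Omega h)

instance instCompleteSpaceH2 (h : ℝ) : CompleteSpace (X.H2 h) :=
  completeSpace_bergmanSpace Metric.isOpen_thickening

/-- `L` is the `τ`-refined transfer operator on `H²(Ω(h))` with parameter `s`:
for `z ∈ Ω_b(h) = Ω(h) ∩ D_b`,
`(L f)(z) = ∑ γ_w'(z) ^ s f(γ_w(z))`, the sum being over the words `w ∈ Y(τ)` with `w → b`.
The first four fields say that the right-hand side is meaningful: `Y(τ)` is a finite set of
non-empty words, the sets `Ω_b(h)` cover `Ω(h)`, and the points `γ_w(z)` lie in `Ω(h)`.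
The complex power is the one of the principal branch of the logarithm. -/
structure IsRefinedTransferOperator (τ h : ℝ) (s : ℂ) (L : X.H2 h →L[ℂ] X.H2 h) : Prop where
  finite : (X.mirrorResolutionSet τ).Finite
  nil_notMem : [] ∉ X.mirrorResolutionSet τ
  subset_disks : X.Omega h ⊆ ⋃ b, X.disk b
  mapsTo : ∀ b, ∀ w ∈ X.mirrorResolutionSet τ, Precedes w b →
    Set.MapsTo (X.wordMap w) (X.Omega h ∩ X.disk b) (X.Omega h)
  apply_eq : ∀ (f : X.H2 h) (b : Fin m ⊕ Fin m), ∀ z ∈ X.Omega h ∩ X.disk b,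
    bergmanSpace.rep (L f) z =
      ∑ᶠ w ∈ {w | w ∈ X.mirrorResolutionSet τ ∧ Precedes w b},
        deriv (X.wordMap w) z ^ s * bergmanSpace.rep f (X.wordMap w z)

/-- There is at most one refined transfer operator. -/
theorem IsRefinedTransferOperator.unique {X : SchottkyData m} {τ h : ℝ} {s : ℂ}
    {L L' : X.H2 h →L[ℂ] X.H2 h} (hL : X.IsRefinedTransferOperator τ h s L)
    (hL' : X.IsRefinedTransferOperator τ h s L') : L = L' := by
  have hΩ : MeasurableSet (X.Omega h) := Metric.isOpen_thickening.measurableSet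
  refine ContinuousLinearMap.ext fun f => Subtype.ext (Lp.ext ?_)
  filter_upwards [bergmanSpace.coe_ae_eq_rep (L f), bergmanSpace.coe_ae_eq_rep (L' f),
    ae_restrict_mem hΩ] with z h1 h2 h3
  obtain ⟨b, hb⟩ := Set.mem_iUnion.mp (hL.subset_disks h3)
  rw [h1, h2, hL.apply_eq f b z ⟨h3, hb⟩, hL'.apply_eq f b z ⟨h3, hb⟩]

open Classical in
/-- The `τ`-refined transfer operator `𝓛_{τ,s}` on `H²(Ω(h))`, with the value `0` for the
parameters for which it is not defined. -/
noncomputable def refinedTransferOperator (τ h : ℝ) (s : ℂ) : X.H2 h →L[ℂ] X.H2 h :=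
  if H : ∃ L, X.IsRefinedTransferOperator τ h s L then H.choose else 0

/-- The operator `𝓛_{τ₀,τ₁,s} = 𝓛_{τ₀,s} ∘ 𝓛_{τ₁,s}` on `H²(Ω(h))`. -/
noncomputable def composedTransferOperator (τ₀ τ₁ h : ℝ) (s : ℂ) : X.H2 h →L[ℂ] X.H2 h :=
  (X.refinedTransferOperator τ₀ h s).comp (X.refinedTransferOperator τ₁ h s)

/-- The resolution parameters satisfy `τ₀ ≍ T⁻¹` and `τ₁ ≍ T ^ (-δ / (2 δ + 2))` with implied
constant `A`. -/
def AdmissibleResolution (A T τ₀ τ₁ : ℝ) : Prop :=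
  τ₀ ∈ Set.Icc (A⁻¹ * T⁻¹) (A * T⁻¹) ∧
    τ₁ ∈ Set.Icc (A⁻¹ * T ^ (-(X.delta / (2 * X.delta + 2))))
      (A * T ^ (-(X.delta / (2 * X.delta + 2))))

end SchottkyData

/-!
The squared Hilbert-Schmidt norm of an operator `L` on the Bergman space is the integral over
`z ∈ Ω(h)` of the squared norm of the functional `f ↦ (L f)(z)`
(`bergmanSpace.lintegral_hsNormSq`). For the composed transfer operator this functional is a
combination, over pairs of words with concatenation `w`, of the reproducing kernels at the points
`γ_w(z)`, with coefficients `γ_w'(z) ^ s`. Expanding the square and integrating over `t ∈ [0, T]`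
leaves a sum over pairs `v, w` of such words, in which a pair enters with the inner product of two
kernels and a factor `(1 + T |φ|)⁻¹`, the phase `φ` being the difference of the logarithms of the
absolute values of the derivatives of `γ_v` and `γ_w` (`lintegral_norm_sum_exp_le`). Two effects
make this sum small.

* For `h = T⁻¹` the set `Ω(h)` is disconnected at scale `T⁻¹`, and the kernels at points of
  different clopen pieces are orthogonal (`exists_separation_Omega`,
  `bergmanSpace.inner_kernel_eq_zero`). Hence only pairs of words with a common prefix of size
  about `T⁻¹` contribute.
* The phase of such a pair, as a function of `x ∈ Λ`, varies at a speed proportional to the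
  distance of the poles of `γ_v` and `γ_w`, by a cross ratio computation
  (`log_dist_sub_log_dist`). Thus it is of order `T⁻¹` on few of the pieces of `Λ` of length
  `T⁻¹` only (`exists_phase_bound`). The distance of the poles is at least of the order of the
  size of the common prefix of the mirror words, and words with a long common prefix are rare
  (`exists_energy_bound`, `exists_pair_sum_bound`).

Up to factors `T ^ ε` the result is `(τ₀ τ₁) ^ (2 σ) * (τ₀ τ₁) ^ (-δ) * T ^ δ`
(`exists_phase_sum_bound`, `exists_mean_square_bound`), and `τ₀ τ₁` is comparable to
`T ^ (-(3 δ + 2) / (2 δ + 2))` (`rpow_resolution_le`).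

The geometry of words is controlled by the lower left entry `c` of the matrix of `γ_w`. The
relation `c_{uv} = c_u c_v (γ_v(∞) - γ_u⁻¹(∞))` shows that the size `|c|⁻²` of a word is
multiplicative up to constants (`size_append`). It is comparable to `|γ_w'|` and to the length of
`I_w`, and bounds from below the distance of two intervals whose words diverge after `w`
(`gap_wordDisk`). The vanishing of the Hausdorff measures of exponent `s > δ` gives covers of `Λ`
by intervals `I_w` with a small sum of the numbers `size w ^ s`; by multiplicativity such a cover
bounds the whole Poincaré series of exponent `s` (`exists_poincare_bound`), and with it the number
of words of a given size (`exists_card_bound`).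
-/

/-! ### Möbius transformations -/

/-- The denominator `c z + d` of the Möbius transformation `z ↦ (a z + b) / (c z + d)`. -/
noncomputable def moebiusDenom (g : Matrix.SpecialLinearGroup (Fin 2) ℝ) (z : ℂ) : ℂ :=
  (g 1 0 : ℝ) * z + (g 1 1 : ℝ)

theorem moebius_def' (g : Matrix.SpecialLinearGroup (Fin 2) ℝ) (z : ℂ) :
    moebius g z = ((g 0 0 : ℝ) * z + (g 0 1 : ℝ)) / moebiusDenom g z := rfl

theorem det_entries (g : Matrix.SpecialLinearGroup (Fin 2) ℝ) :
    g 0 0 * g 1 1 - g 0 1 * g 1 0 = 1 := by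
  have := g.det_coe
  rwa [Matrix.det_fin_two] at this

theorem det_entries_complex (g : Matrix.SpecialLinearGroup (Fin 2) ℝ) :
    ((g 0 0 : ℝ) : ℂ) * (g 1 1 : ℝ) - (g 0 1 : ℝ) * (g 1 0 : ℝ) = 1 := by
  exact_mod_cast congrArg (fun x : ℝ => (x : ℂ)) (det_entries g)

theorem moebiusDenom_mul (g h : Matrix.SpecialLinearGroup (Fin 2) ℝ) {z : ℂ}
    (hz : moebiusDenom h z ≠ 0) :
    moebiusDenom (g * h) z = moebiusDenom g (moebius h z) * moebiusDenom h z := by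
  rw [moebiusDenom, moebiusDenom, moebius_def', add_mul, mul_assoc, div_mul_cancel₀ _ hz]
  simp only [moebiusDenom, Matrix.SpecialLinearGroup.coe_mul, Matrix.mul_apply, Fin.sum_univ_two]
  push_cast
  ring

theorem moebius_mul (g h : Matrix.SpecialLinearGroup (Fin 2) ℝ) {z : ℂ}
    (hz : moebiusDenom h z ≠ 0) :
    moebius (g * h) z = moebius g (moebius h z) := by
  have e : ((g * h) 0 0 : ℝ) * z + ((g * h) 0 1 : ℝ) =
      ((g 0 0 : ℝ) * moebius h z + (g 0 1 : ℝ)) * moebiusDenom h z := by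
    rw [moebius_def', add_mul, mul_assoc, div_mul_cancel₀ _ hz]
    simp only [moebiusDenom, Matrix.SpecialLinearGroup.coe_mul, Matrix.mul_apply,
      Fin.sum_univ_two]
    push_cast
    ring
  rw [moebius_def', moebius_def' g, moebiusDenom_mul g h hz, e, mul_div_mul_right _ _ hz]

theorem moebius_one (z : ℂ) : moebius 1 z = z := by
  simp [moebius]

theorem moebius_sub_moebius (g : Matrix.SpecialLinearGroup (Fin 2) ℝ) {z w : ℂ}
    (hz : moebiusDenom g z ≠ 0) (hw : moebiusDenom g w ≠ 0) :
    moebius g z - moebius g w = (z - w) / (moebiusDenom g z * moebiusDenom g w) := by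
  rw [moebius_def', moebius_def', div_sub_div _ _ hz hw]
  congr 1
  simp only [moebiusDenom]
  linear_combination (z - w) * det_entries_complex g

theorem hasStrictDerivAt_moebius (g : Matrix.SpecialLinearGroup (Fin 2) ℝ) {z : ℂ}
    (hz : moebiusDenom g z ≠ 0) :
    HasStrictDerivAt (moebius g) (1 / moebiusDenom g z ^ 2) z := by
  have h1 : HasStrictDerivAt (fun z : ℂ => ((g 0 0 : ℝ) : ℂ) * z + (g 0 1 : ℝ)) ((g 0 0 : ℝ) : ℂ) z := by
    simpa using ((hasStrictDerivAt_id z).const_mul ((g 0 0 : ℝ) : ℂ)).add_const ((g 0 1 : ℝ) : ℂ)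
  have h2 : HasStrictDerivAt (fun z : ℂ => ((g 1 0 : ℝ) : ℂ) * z + (g 1 1 : ℝ)) ((g 1 0 : ℝ) : ℂ) z := by
    simpa using ((hasStrictDerivAt_id z).const_mul ((g 1 0 : ℝ) : ℂ)).add_const ((g 1 1 : ℝ) : ℂ)
  refine (h1.div h2 hz).congr_deriv ?_
  rw [moebiusDenom]
  congr 1
  linear_combination det_entries_complex g

theorem hasDerivAt_moebius (g : Matrix.SpecialLinearGroup (Fin 2) ℝ) {z : ℂ}
    (hz : moebiusDenom g z ≠ 0) :
    HasDerivAt (moebius g) (1 / moebiusDenom g z ^ 2) z :=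
  (hasStrictDerivAt_moebius g hz).hasDerivAt

theorem moebius_ofReal (g : Matrix.SpecialLinearGroup (Fin 2) ℝ) (x : ℝ) :
    moebius g x = (((g 0 0 * x + g 0 1) / (g 1 0 * x + g 1 1) : ℝ) : ℂ) := by
  simp [moebius]

namespace SchottkyData

variable {m : ℕ} (X : SchottkyData m)

/-! ### The generators -/

/-- The closed disk with interior `D_a`. -/
def closedDisk (a : Fin m ⊕ Fin m) : Set ℂ :=
  Metric.closedBall (X.center a : ℂ) (X.radius a)

theorem disk_subset_closedDisk (a : Fin m ⊕ Fin m) : X.disk a ⊆ X.closedDisk a :=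
  Metric.ball_subset_closedBall

theorem swap_ne_self (a : Fin m ⊕ Fin m) : a ≠ a.swap := by
  cases a <;> simp

/-- On finite points, the hypothesis on the Riemann sphere says that the denominator does not vanish
off the closed disk of `ā`, and that the image lies in `D_a`. -/
theorem gen_maps_exterior (a : Fin m ⊕ Fin m) {z : ℂ} (hz : z ∉ X.closedDisk a.swap) :
    moebiusDenom (X.gen a) z ≠ 0 ∧ moebius (X.gen a) z ∈ X.disk a := by
  have h : Matrix.SpecialLinearGroup.mapGL ℂ (X.gen a) • (z : OnePoint ℂ) ∈
      (fun z : ℂ => (z : OnePoint ℂ)) '' Metric.ball (X.center a : ℂ) (X.radius a) := by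
    rw [← X.gen_image a]
    refine ⟨_, ?_, rfl⟩
    rintro ⟨y, hy, hyz⟩
    rw [OnePoint.coe_eq_coe] at hyz
    exact hz (hyz ▸ hy)
  obtain ⟨y, hy, hyz⟩ := h
  rw [OnePoint.smul_some_eq_ite] at hyz
  split_ifs at hyz with h0
  · exact absurd hyz (OnePoint.coe_ne_infty y)
  · refine ⟨by simpa [moebiusDenom] using h0, ?_⟩
    have hyz' : y = _ := OnePoint.coe_injective hyz
    have : moebius (X.gen a) z = y := by
      rw [hyz']; simp [moebius]
    rw [this]; exact hy

/-- The point `∞` lies in the exterior of the disk of `ā`, so that `γ_a(∞)` is finite: the lower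
left entry of `γ_a` is not zero. -/
theorem gen_maps_infty (a : Fin m ⊕ Fin m) :
    X.gen a 1 0 ≠ 0 ∧ ((X.gen a 0 0 / X.gen a 1 0 : ℝ) : ℂ) ∈ X.disk a := by
  have h : Matrix.SpecialLinearGroup.mapGL ℂ (X.gen a) • (OnePoint.infty : OnePoint ℂ) ∈
      (fun z : ℂ => (z : OnePoint ℂ)) '' Metric.ball (X.center a : ℂ) (X.radius a) := by
    rw [← X.gen_image a]
    refine ⟨_, ?_, rfl⟩
    rintro ⟨y, hy, hyz⟩
    exact OnePoint.coe_ne_infty y hyz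
  obtain ⟨y, hy, hyz⟩ := h
  rw [OnePoint.smul_infty_eq_ite] at hyz
  split_ifs at hyz with h0
  · exact absurd hyz (OnePoint.coe_ne_infty y)
  · refine ⟨by simpa using h0, ?_⟩
    have hyz' : y = _ := OnePoint.coe_injective hyz
    have : ((X.gen a 0 0 / X.gen a 1 0 : ℝ) : ℂ) = y := by
      rw [hyz']; simp
    rw [this]; exact hy

theorem disjoint_closedDisk {a b : Fin m ⊕ Fin m} (h : a ≠ b) :
    Disjoint (X.closedDisk a) (X.closedDisk b) := X.disjoint_closedBall h

theorem eq_of_mem_closedDisk {a b : Fin m ⊕ Fin m} {z : ℂ} (ha : z ∈ X.closedDisk a)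
    (hb : z ∈ X.closedDisk b) : a = b := by
  by_contra h
  exact Set.disjoint_left.mp (X.disjoint_closedDisk h) ha hb

/-! ### Words -/

theorem wordElement_nil : X.wordElement [] = 1 := rfl

theorem wordElement_append (u v : List (Fin m ⊕ Fin m)) :
    X.wordElement (u ++ v) = X.wordElement u * X.wordElement v := by
  simp [wordElement]

theorem wordElement_cons (a : Fin m ⊕ Fin m) (v : List (Fin m ⊕ Fin m)) :
    X.wordElement (a :: v) = X.gen a * X.wordElement v := by
  simp [wordElement]

theorem mirror_cons (a : Fin m ⊕ Fin m) (v : List (Fin m ⊕ Fin m)) :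
    mirror (a :: v) = mirror v ++ [a.swap] := by
  simp [mirror]

theorem mirror_append (u v : List (Fin m ⊕ Fin m)) :
    mirror (u ++ v) = mirror v ++ mirror u := by
  simp [mirror]

theorem mirror_mirror (u : List (Fin m ⊕ Fin m)) : mirror (mirror u) = u := by
  simp [mirror]

theorem mirror_eq_nil {u : List (Fin m ⊕ Fin m)} : mirror u = [] ↔ u = [] := by
  simp [mirror]

theorem length_mirror (u : List (Fin m ⊕ Fin m)) : (mirror u).length = u.length := by
  simp [mirror]

theorem wordElement_mirror (u : List (Fin m ⊕ Fin m)) :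
    X.wordElement (mirror u) = (X.wordElement u)⁻¹ := by
  induction u with
  | nil => simp [mirror, wordElement]
  | cons a v ih =>
    rw [mirror_cons, wordElement_append, ih, wordElement_cons X a v, mul_inv_rev, wordElement_cons,
      wordElement_nil, mul_one, X.gen_swap]

theorem isReduced_mirror {u : List (Fin m ⊕ Fin m)} (h : IsReduced u) :
    IsReduced (mirror u) := by
  rw [IsReduced] at h ⊢
  rw [mirror, List.isChain_reverse, List.isChain_map]
  refine h.imp ?_
  intro a b hab
  simp only [Sum.swap_swap, ne_eq]
  exact fun h => hab h.symm

theorem isReduced_append {u v : List (Fin m ⊕ Fin m)} :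
    IsReduced (u ++ v) ↔ IsReduced u ∧ IsReduced v ∧
      ∀ a ∈ u.getLast?, ∀ b ∈ v.head?, a ≠ b.swap :=
  List.isChain_append

theorem isReduced_concat {u : List (Fin m ⊕ Fin m)} {b : Fin m ⊕ Fin m} :
    IsReduced (u ++ [b]) ↔ IsReduced u ∧ Precedes u b := by
  rw [isReduced_append]
  simp [IsReduced, Precedes]

theorem isReduced_cons {u : List (Fin m ⊕ Fin m)} {a : Fin m ⊕ Fin m} :
    IsReduced (a :: u) ↔ (∀ b ∈ u.head?, a ≠ b.swap) ∧ IsReduced u :=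
  List.isChain_cons

theorem IsReduced.prefix {u v : List (Fin m ⊕ Fin m)} (h : IsReduced v) (huv : u <+: v) :
    IsReduced u := by
  obtain ⟨t, rfl⟩ := huv
  exact (isReduced_append.mp h).1

theorem IsReduced.suffix {u v : List (Fin m ⊕ Fin m)} (h : IsReduced v) (huv : u <:+ v) :
    IsReduced u := by
  obtain ⟨t, rfl⟩ := huv
  exact (isReduced_append.mp h).2.1

/-- A reduced word `w` followed by the letter `d` maps the closed disk of `d` into the disk of the
first letter. -/
theorem wordMap_closedDisk {w : List (Fin m ⊕ Fin m)} {d : Fin m ⊕ Fin m}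
    (hw : IsReduced (w ++ [d])) {z : ℂ} (hz : z ∈ X.closedDisk d) :
    moebiusDenom (X.wordElement w) z ≠ 0 ∧ ∀ e ∈ (w ++ [d]).head?,
      X.wordMap w z ∈ X.closedDisk e ∧ (w ≠ [] → X.wordMap w z ∈ X.disk e) := by
  induction w with
  | nil =>
    simp only [wordElement_nil, moebiusDenom, wordMap, moebius_one]
    simpa using hz
  | cons a w ih =>
    rw [List.cons_append, isReduced_cons] at hw
    obtain ⟨h1, h2⟩ := ih hw.2
    obtain ⟨e, he⟩ : ∃ e, (w ++ [d]).head? = some e := by cases w <;> simp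
    have hae := hw.1 e (by simp [he])
    have hm := (h2 e (by simp [he])).1
    have hn : X.wordMap w z ∉ X.closedDisk a.swap := by
      intro hc
      refine hae ?_
      have := X.eq_of_mem_closedDisk hm hc
      rw [this, Sum.swap_swap]
    obtain ⟨h3, h4⟩ := X.gen_maps_exterior a hn
    refine ⟨?_, ?_⟩
    · rw [wordElement_cons, moebiusDenom_mul _ _ h1]
      exact mul_ne_zero h3 h1
    · intro e' he'
      simp only [List.cons_append, List.head?_cons, Option.mem_some_iff] at he'
      subst he'
      have : X.wordMap (a :: w) z ∈ X.disk a := by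
        rw [wordMap, wordElement_cons, moebius_mul _ _ h1]
        exact h4
      exact ⟨X.disk_subset_closedDisk _ this, fun _ => this⟩

theorem moebiusDenom_ne_zero {w : List (Fin m ⊕ Fin m)} {d : Fin m ⊕ Fin m}
    (hw : IsReduced (w ++ [d])) {z : ℂ} (hz : z ∈ X.closedDisk d) :
    moebiusDenom (X.wordElement w) z ≠ 0 := (X.wordMap_closedDisk hw hz).1

theorem wordMap_mem_disk {a : Fin m ⊕ Fin m} {w : List (Fin m ⊕ Fin m)} {d : Fin m ⊕ Fin m}
    (hw : IsReduced (a :: w ++ [d])) {z : ℂ} (hz : z ∈ X.closedDisk d) :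
    X.wordMap (a :: w) z ∈ X.disk a :=
  ((X.wordMap_closedDisk hw hz).2 a (by simp)).2 (by simp)

theorem wordMap_nil (z : ℂ) : X.wordMap [] z = z := moebius_one z

theorem wordMap_append {u v : List (Fin m ⊕ Fin m)} {d : Fin m ⊕ Fin m}
    (hw : IsReduced (v ++ [d])) {z : ℂ} (hz : z ∈ X.closedDisk d) :
    X.wordMap (u ++ v) z = X.wordMap u (X.wordMap v z) := by
  rw [wordMap, wordElement_append, moebius_mul _ _ (X.moebiusDenom_ne_zero hw hz)]
  rfl

/-- The lower left entry of the matrix of `γ_w`. -/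
def lower (w : List (Fin m ⊕ Fin m)) : ℝ := X.wordElement w 1 0

/-- The image `γ_w(∞)`, for a non-empty reduced word. -/
noncomputable def imageInfty (w : List (Fin m ⊕ Fin m)) : ℝ :=
  X.wordElement w 0 0 / X.wordElement w 1 0

/-- The pole `γ_w⁻¹(∞)` of `γ_w`, for a non-empty reduced word. -/
noncomputable def pole (w : List (Fin m ⊕ Fin m)) : ℝ := X.imageInfty (mirror w)

/-- By induction on the word: `γ_w(∞)` lies outside the closed disk of `ā` if `a w` is reduced, so
that `γ_a` maps it to a finite point of `D_a`. -/
theorem lower_ne_zero_and_imageInfty_mem {a : Fin m ⊕ Fin m} {w : List (Fin m ⊕ Fin m)}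
    (hw : IsReduced (a :: w)) :
    X.lower (a :: w) ≠ 0 ∧ (X.imageInfty (a :: w) : ℂ) ∈ X.disk a := by
  induction w generalizing a with
  | nil =>
    have := X.gen_maps_infty a
    simpa [lower, imageInfty, wordElement] using this
  | cons b w ih =>
    have hw' := isReduced_cons.mp hw
    obtain ⟨h1, h2⟩ := ih hw'.2
    have hab := hw'.1 b (by simp)
    have hn : (X.imageInfty (b :: w) : ℂ) ∉ X.closedDisk a.swap := by
      intro hc
      have := X.eq_of_mem_closedDisk (X.disk_subset_closedDisk _ h2) hc
      exact hab (by rw [this, Sum.swap_swap])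
    obtain ⟨h3, h4⟩ := X.gen_maps_exterior a hn
    set g := X.gen a
    set k := X.wordElement (b :: w) with hk
    have hk0 : k 1 0 ≠ 0 := h1
    have h3' : g 1 0 * (k 0 0 / k 1 0) + g 1 1 ≠ 0 := by
      intro h
      apply h3
      rw [moebiusDenom, imageInfty, ← hk]
      exact_mod_cast h
    have e10 : (g * k) 1 0 = (g 1 0 * (k 0 0 / k 1 0) + g 1 1) * k 1 0 := by
      simp only [Matrix.SpecialLinearGroup.coe_mul, Matrix.mul_apply, Fin.sum_univ_two]
      field_simp
    have e00 : (g * k) 0 0 = (g 0 0 * (k 0 0 / k 1 0) + g 0 1) * k 1 0 := by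
      simp only [Matrix.SpecialLinearGroup.coe_mul, Matrix.mul_apply, Fin.sum_univ_two]
      field_simp
    refine ⟨?_, ?_⟩
    · rw [lower, wordElement_cons, ← hk, e10]
      exact mul_ne_zero h3' hk0
    · rw [imageInfty, wordElement_cons, ← hk, e10, e00, mul_div_mul_right _ _ hk0]
      rw [moebius_ofReal] at h4
      exact h4

theorem lower_ne_zero {w : List (Fin m ⊕ Fin m)} (hw : IsReduced w) (h : w ≠ []) :
    X.lower w ≠ 0 := by
  obtain ⟨a, w, rfl⟩ := List.exists_cons_of_ne_nil h
  exact (X.lower_ne_zero_and_imageInfty_mem hw).1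

theorem imageInfty_mem {a : Fin m ⊕ Fin m} {w : List (Fin m ⊕ Fin m)}
    (hw : IsReduced (a :: w)) : (X.imageInfty (a :: w) : ℂ) ∈ X.disk a :=
  (X.lower_ne_zero_and_imageInfty_mem hw).2

theorem lower_mirror (w : List (Fin m ⊕ Fin m)) : X.lower (mirror w) = -X.lower w := by
  rw [lower, wordElement_mirror, Matrix.SpecialLinearGroup.coe_inv, Matrix.adjugate_fin_two]
  simp [lower]

theorem pole_eq (w : List (Fin m ⊕ Fin m)) :
    X.pole w = -(X.wordElement w 1 1 / X.lower w) := by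
  rw [pole, imageInfty, wordElement_mirror, Matrix.SpecialLinearGroup.coe_inv,
    Matrix.adjugate_fin_two]
  simp [lower, div_neg]

theorem pole_mem {a : Fin m ⊕ Fin m} {w : List (Fin m ⊕ Fin m)}
    (hw : IsReduced (w ++ [a])) : (X.pole (w ++ [a]) : ℂ) ∈ X.disk a.swap := by
  have h := isReduced_mirror hw
  rw [mirror_append] at h
  rw [pole, mirror_append]
  exact X.imageInfty_mem h

theorem moebiusDenom_eq {w : List (Fin m ⊕ Fin m)} (hw : IsReduced w) (h : w ≠ []) (z : ℂ) :
    moebiusDenom (X.wordElement w) z = X.lower w * (z - X.pole w) := by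
  have := X.lower_ne_zero hw h
  have h' : (X.lower w : ℂ) ≠ 0 := by exact_mod_cast this
  rw [pole_eq, moebiusDenom, lower] at *
  push_cast
  field_simp
  ring

/-- The cocycle relation `c_{uv} = c_u c_v (γ_v(∞) - γ_u⁻¹(∞))` for the lower left entries. -/
theorem lower_append {u v : List (Fin m ⊕ Fin m)} (hu : IsReduced u) (hv : IsReduced v)
    (hu0 : u ≠ []) (hv0 : v ≠ []) :
    X.lower (u ++ v) = X.lower u * X.lower v * (X.imageInfty v - X.pole u) := by
  have h1 := X.lower_ne_zero hu hu0
  have h2 := X.lower_ne_zero hv hv0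
  rw [pole_eq, imageInfty, lower, wordElement_append]
  simp only [Matrix.SpecialLinearGroup.coe_mul, Matrix.mul_apply, Fin.sum_univ_two]
  rw [lower] at *
  rw [lower] at *
  field_simp
  ring

theorem imageInfty_append {u v : List (Fin m ⊕ Fin m)} (hv : IsReduced v) (hv0 : v ≠ []) :
    (X.imageInfty (u ++ v) : ℂ) = X.wordMap u (X.imageInfty v) := by
  have h2 := X.lower_ne_zero hv hv0
  rw [wordMap, moebius_ofReal, imageInfty, wordElement_append]
  congr 1
  simp only [Matrix.SpecialLinearGroup.coe_mul, Matrix.mul_apply, Fin.sum_univ_two, imageInfty]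
  rw [lower] at h2
  have e (p q x y : ℝ) (hy : y ≠ 0) : p * (x / y) + q = (p * x + q * y) / y := by field_simp
  rw [e _ _ _ _ h2, e _ _ _ _ h2, div_div_div_cancel_right₀ h2]

end SchottkyData

namespace SchottkyData

variable {m : ℕ} (X : SchottkyData m)

/-! ### Uniform constants and sizes of words -/

/-- Finitely many conditions, each monotone in `M` and satisfied by some `M`, have a common
solution. -/
theorem exists_uniform_bound {ι : Type*} [Finite ι] (p : ι → ℝ → Prop)
    (mono : ∀ i M M', 1 ≤ M → M ≤ M' → p i M → p i M') (h : ∀ i, ∃ M, 1 ≤ M ∧ p i M) :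
    ∃ M, 1 ≤ M ∧ ∀ i, p i M := by
  choose f hf1 hf using h
  obtain ⟨M, hM⟩ := Finite.exists_le f
  exact ⟨max 1 M, le_max_left _ _, fun i =>
    mono i (f i) _ (hf1 i) ((hM i).trans (le_max_right _ _)) (hf i)⟩

theorem exists_inv_le_le {c C : ℝ} (hc : 0 < c) : ∃ M : ℝ, 1 ≤ M ∧ M⁻¹ ≤ c ∧ C ≤ M := by
  refine ⟨max 1 (max c⁻¹ C), le_max_left _ _, ?_, by simp⟩
  rw [inv_le_comm₀ (by positivity) hc]
  simp

/-- `M` is a uniform constant for the Schottky data: it bounds the distances between points of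
different closed disks, the radii and the sizes of the generators from above and (inverted) from
below, and `M⁻¹` bounds from below the distance of `γ_a(D_b)` to the boundary of `D_a`. -/
structure IsUniformBound (M : ℝ) : Prop where
  one_le : 1 ≤ M
  sep : ∀ a b, a ≠ b → ∀ z ∈ X.closedDisk a, ∀ w ∈ X.closedDisk b,
    M⁻¹ ≤ ‖z - w‖ ∧ ‖z - w‖ ≤ M
  radius : ∀ a, M⁻¹ ≤ X.radius a ∧ X.radius a ≤ M
  lower : ∀ a, M⁻¹ ≤ 1 / X.lower [a] ^ 2 ∧ 1 / X.lower [a] ^ 2 ≤ M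
  margin : ∀ a b, IsReduced [a, b] → ∀ z ∈ X.closedDisk b,
    Metric.ball (X.wordMap [a] z) M⁻¹ ⊆ X.disk a

theorem isReduced_singleton (a : Fin m ⊕ Fin m) : IsReduced [a] := by
  simp [IsReduced]

theorem continuousOn_wordMap {w : List (Fin m ⊕ Fin m)} {d : Fin m ⊕ Fin m}
    (hw : IsReduced (w ++ [d])) : ContinuousOn (X.wordMap w) (X.closedDisk d) := fun _ hz =>
  (hasDerivAt_moebius _ (X.moebiusDenom_ne_zero hw hz)).continuousAt.continuousWithinAt

theorem exists_isUniformBound : ∃ M, X.IsUniformBound M := by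
  have inv_mono : ∀ M M' c : ℝ, 1 ≤ M → M ≤ M' → M⁻¹ ≤ c → M'⁻¹ ≤ c := by
    intro M M' c h1 h2 h3
    exact (inv_anti₀ (by linarith) h2).trans h3
  obtain ⟨M₁, h1, H1⟩ := exists_uniform_bound
    (fun (p : (Fin m ⊕ Fin m) × (Fin m ⊕ Fin m)) M => p.1 ≠ p.2 →
      ∀ z ∈ X.closedDisk p.1, ∀ w ∈ X.closedDisk p.2, M⁻¹ ≤ ‖z - w‖ ∧ ‖z - w‖ ≤ M)
    (fun p M M' h1 h2 h hp z hz w hw => ⟨inv_mono _ _ _ h1 h2 (h hp z hz w hw).1,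
      (h hp z hz w hw).2.trans h2⟩)
    (by
      rintro ⟨a, b⟩
      by_cases hab : a = b
      · exact ⟨1, le_rfl, fun h => absurd hab h⟩
      have hd := X.disjoint_closedDisk hab
      rw [closedDisk, closedDisk,
        disjoint_closedBall_closedBall_iff (X.radius_pos a).le (X.radius_pos b).le] at hd
      obtain ⟨M, hM, h2, h3⟩ := exists_inv_le_le
        (C := dist (X.center a : ℂ) (X.center b) + X.radius a + X.radius b) (sub_pos.mpr hd)
      refine ⟨M, hM, fun _ z hz w hw => ?_⟩
      simp only [closedDisk, Metric.mem_closedBall] at hz hw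
      rw [← dist_eq_norm]
      have t1 := dist_triangle4 (X.center a : ℂ) z w (X.center b)
      have t2 := dist_triangle4 z (X.center a : ℂ) (X.center b) w
      rw [dist_comm] at hz
      rw [dist_comm (X.center b : ℂ) w, dist_comm z (X.center a : ℂ)] at t2
      exact ⟨by linarith, by linarith⟩)
  obtain ⟨M₂, h2, H2⟩ := exists_uniform_bound
    (fun a M => M⁻¹ ≤ X.radius a ∧ X.radius a ≤ M)
    (fun a M M' h1 h2 h => ⟨inv_mono _ _ _ h1 h2 h.1, h.2.trans h2⟩)
    (fun a => exists_inv_le_le (X.radius_pos a))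
  obtain ⟨M₃, h3, H3⟩ := exists_uniform_bound
    (fun a M => M⁻¹ ≤ 1 / X.lower [a] ^ 2 ∧ 1 / X.lower [a] ^ 2 ≤ M)
    (fun a M M' h1 h2 h => ⟨inv_mono _ _ _ h1 h2 h.1, h.2.trans h2⟩)
    (fun a => by
      have := X.lower_ne_zero (isReduced_singleton a) (by simp)
      exact exists_inv_le_le (by positivity))
  obtain ⟨M₄, h4, H4⟩ := exists_uniform_bound
    (fun (p : (Fin m ⊕ Fin m) × (Fin m ⊕ Fin m)) M => IsReduced [p.1, p.2] →
      ∀ z ∈ X.closedDisk p.2, Metric.ball (X.wordMap [p.1] z) M⁻¹ ⊆ X.disk p.1)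
    (fun p M M' h1 h2 h hp z hz =>
      (Metric.ball_subset_ball (inv_anti₀ (by linarith) h2)).trans (h hp z hz))
    (by
      rintro ⟨a, b⟩
      by_cases hab : IsReduced [a, b]
      swap
      · exact ⟨1, le_rfl, fun h => absurd h hab⟩
      -- The image of the closed disk `D_b` is a compact subset of the open disk `D_a`.
      have hK : IsCompact (X.wordMap [a] '' X.closedDisk b) :=
        (isCompact_closedBall _ _).image_of_continuousOn
          (X.continuousOn_wordMap (w := [a]) (d := b) (by simpa using hab))
      obtain ⟨δ, hδ, hsub⟩ := hK.exists_thickening_subset_open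
        (t := X.disk a) Metric.isOpen_ball (by
          rintro _ ⟨z, hz, rfl⟩
          exact X.wordMap_mem_disk (w := []) (by simpa using hab) hz)
      obtain ⟨M, hM, hMδ, -⟩ := exists_inv_le_le (C := 1) hδ
      refine ⟨M, hM, fun _ z hz => (Metric.ball_subset_ball hMδ).trans ?_⟩
      exact (Metric.ball_subset_thickening (Set.mem_image_of_mem _ hz) _).trans hsub)
  have b1 : M₁ ≤ max (max M₁ M₂) (max M₃ M₄) := by simp
  have b2 : M₂ ≤ max (max M₁ M₂) (max M₃ M₄) := by simp
  have b3 : M₃ ≤ max (max M₁ M₂) (max M₃ M₄) := by simp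
  have b4 : M₄ ≤ max (max M₁ M₂) (max M₃ M₄) := by simp
  refine ⟨max (max M₁ M₂) (max M₃ M₄), h1.trans b1, ?_, ?_, ?_, ?_⟩
  · intro a b hab z hz w hw
    have := H1 (a, b) hab z hz w hw
    exact ⟨inv_mono _ _ _ h1 b1 this.1, this.2.trans b1⟩
  · exact fun a => ⟨inv_mono _ _ _ h2 b2 (H2 a).1, (H2 a).2.trans b2⟩
  · exact fun a => ⟨inv_mono _ _ _ h3 b3 (H3 a).1, (H3 a).2.trans b3⟩
  · exact fun a b hab z hz => (Metric.ball_subset_ball (inv_anti₀ (by linarith) b4)).trans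
      (H4 (a, b) hab z hz)

/-- A uniform constant `M` of the Schottky data, see `IsUniformBound`. -/
noncomputable def bd : ℝ := X.exists_isUniformBound.choose

theorem bd_spec : X.IsUniformBound X.bd := X.exists_isUniformBound.choose_spec

theorem one_le_bd : 1 ≤ X.bd := X.bd_spec.one_le

theorem bd_pos : 0 < X.bd := one_pos.trans_le X.one_le_bd

open Classical in
/-- The size `|c|⁻²` of a reduced word, `c` being the lower left entry of `γ_w`; the empty word has
size `1`. It is comparable to the length of `I_w` and to the derivative of `γ_w`, multiplicative up
to constants, and invariant under `w ↦ mirror w`. -/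
noncomputable def size (w : List (Fin m ⊕ Fin m)) : ℝ :=
  if w = [] then 1 else 1 / X.lower w ^ 2

theorem size_nil : X.size [] = 1 := by simp [size]

theorem size_of_ne_nil {w : List (Fin m ⊕ Fin m)} (h : w ≠ []) :
    X.size w = 1 / X.lower w ^ 2 := by simp [size, h]

theorem size_pos {w : List (Fin m ⊕ Fin m)} (hw : IsReduced w) : 0 < X.size w := by
  by_cases h : w = []
  · simp [h, size_nil]
  · have := X.lower_ne_zero hw h
    rw [X.size_of_ne_nil h]; positivity

theorem size_mirror (w : List (Fin m ⊕ Fin m)) : X.size (mirror w) = X.size w := by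
  simp [size, mirror_eq_nil, lower_mirror]

/-- The pole of a word `w` ending in `a` lies in `D_ā`, hence in a disk different from `D_d` if `w
d` is reduced. -/
theorem dist_pole {w : List (Fin m ⊕ Fin m)} {d : Fin m ⊕ Fin m} (hw : IsReduced (w ++ [d]))
    (h : w ≠ []) {z : ℂ} (hz : z ∈ X.closedDisk d) :
    X.bd⁻¹ ≤ ‖z - X.pole w‖ ∧ ‖z - X.pole w‖ ≤ X.bd := by
  obtain ⟨u, a, rfl⟩ := List.eq_nil_or_concat' w |>.resolve_left h
  have h1 := isReduced_concat.mp hw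
  have h2 := X.pole_mem h1.1
  refine X.bd_spec.sep d a.swap ?_ z hz _ (X.disk_subset_closedDisk _ h2)
  intro hc
  have := h1.2 a (by simp)
  exact this (by rw [hc, Sum.swap_swap])

theorem dist_imageInfty_pole {u v : List (Fin m ⊕ Fin m)} (hw : IsReduced (u ++ v))
    (hu : u ≠ []) (hv : v ≠ []) :
    X.bd⁻¹ ≤ |X.imageInfty v - X.pole u| ∧ |X.imageInfty v - X.pole u| ≤ X.bd := by
  obtain ⟨d, v, rfl⟩ := List.exists_cons_of_ne_nil hv
  have h1 := isReduced_append.mp hw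
  have h2 := X.disk_subset_closedDisk _ (X.imageInfty_mem h1.2.1)
  have h3 : IsReduced (u ++ [d]) := hw.prefix ⟨v, by simp⟩
  have := X.dist_pole h3 hu h2
  rwa [← Complex.ofReal_sub, Complex.norm_real, Real.norm_eq_abs] at this

theorem one_div_sq_bounds {M x : ℝ} (hM : 0 < M) (h1 : M⁻¹ ≤ x) (h2 : x ≤ M) :
    M⁻¹ ^ 2 ≤ 1 / x ^ 2 ∧ 1 / x ^ 2 ≤ M ^ 2 := by
  have hx : 0 < x := (inv_pos.mpr hM).trans_le h1
  rw [one_div, ← inv_pow]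
  exact ⟨pow_le_pow_left₀ (inv_pos.mpr hM).le (inv_anti₀ hx h2) 2,
    pow_le_pow_left₀ (inv_pos.mpr hx).le ((inv_le_comm₀ hM hx).mp h1) 2⟩

/-- Sizes are multiplicative up to uniform constants. -/
theorem size_append {u v : List (Fin m ⊕ Fin m)} (hw : IsReduced (u ++ v)) :
    X.bd⁻¹ ^ 2 * (X.size u * X.size v) ≤ X.size (u ++ v) ∧
      X.size (u ++ v) ≤ X.bd ^ 2 * (X.size u * X.size v) := by
  obtain ⟨hur, hvr, -⟩ := isReduced_append.mp hw
  have hM := X.one_le_bd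
  have e1 : (1 : ℝ) ≤ X.bd ^ 2 := one_le_pow₀ hM
  have e2 : X.bd⁻¹ ^ 2 ≤ 1 := pow_le_one₀ (inv_pos.mpr X.bd_pos).le (inv_le_one_of_one_le₀ hM)
  have s1 := X.size_pos hur
  have s2 := X.size_pos hvr
  by_cases hu : u = []
  · subst hu
    simp only [List.nil_append, size_nil, one_mul]
    exact ⟨by nlinarith, by nlinarith⟩
  by_cases hv : v = []
  · subst hv
    simp only [List.append_nil, size_nil, mul_one]
    exact ⟨by nlinarith, by nlinarith⟩
  have hd := X.dist_imageInfty_pole hw hu hv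
  have h3 := one_div_sq_bounds X.bd_pos hd.1 hd.2
  rw [sq_abs] at h3
  have : X.size (u ++ v) =
      (1 / (X.imageInfty v - X.pole u) ^ 2) * (X.size u * X.size v) := by
    rw [X.size_of_ne_nil (by simp [hu]), X.size_of_ne_nil hu, X.size_of_ne_nil hv,
      X.lower_append hur hvr hu hv, mul_pow, mul_pow]
    simp only [one_div, mul_inv]
    ring
  rw [this]
  exact ⟨mul_le_mul_of_nonneg_right h3.1 (by positivity),
    mul_le_mul_of_nonneg_right h3.2 (by positivity)⟩

theorem size_singleton (a : Fin m ⊕ Fin m) : X.bd⁻¹ ≤ X.size [a] ∧ X.size [a] ≤ X.bd := by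
  rw [X.size_of_ne_nil (by simp)]
  exact X.bd_spec.lower a

theorem size_concat_ge {u : List (Fin m ⊕ Fin m)} {a : Fin m ⊕ Fin m}
    (hw : IsReduced (u ++ [a])) : X.bd⁻¹ ^ 3 * X.size u ≤ X.size (u ++ [a]) := by
  have h1 := (X.size_append hw).1
  have h2 := (X.size_singleton a).1
  have := X.bd_pos
  have hs := X.size_pos (isReduced_append.mp hw).1
  refine le_trans ?_ h1
  calc X.bd⁻¹ ^ 3 * X.size u = X.bd⁻¹ ^ 2 * (X.size u * X.bd⁻¹) := by ring
    _ ≤ _ := by gcongr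

theorem size_concat_le {u : List (Fin m ⊕ Fin m)} {a : Fin m ⊕ Fin m}
    (hw : IsReduced (u ++ [a])) : X.size (u ++ [a]) ≤ X.bd ^ 3 * X.size u := by
  have h1 := (X.size_append hw).2
  have h2 := (X.size_singleton a).2
  have := X.bd_pos
  have hs := X.size_pos (isReduced_append.mp hw).1
  refine h1.trans ?_
  calc _ ≤ X.bd ^ 2 * (X.size u * X.bd) := by gcongr
    _ = _ := by ring

theorem norm_moebiusDenom_sq {w : List (Fin m ⊕ Fin m)} (hw : IsReduced w) (h : w ≠ []) (z : ℂ) :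
    ‖moebiusDenom (X.wordElement w) z‖ ^ 2 = (X.size w)⁻¹ * ‖z - X.pole w‖ ^ 2 := by
  rw [X.moebiusDenom_eq hw h, norm_mul, mul_pow, Complex.norm_real, Real.norm_eq_abs, sq_abs,
    X.size_of_ne_nil h, one_div, inv_inv]

theorem norm_moebiusDenom_bounds {w : List (Fin m ⊕ Fin m)} {d : Fin m ⊕ Fin m}
    (hw : IsReduced (w ++ [d])) {z : ℂ} (hz : z ∈ X.closedDisk d) :
    X.bd⁻¹ * √(X.size w)⁻¹ ≤ ‖moebiusDenom (X.wordElement w) z‖ ∧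
      ‖moebiusDenom (X.wordElement w) z‖ ≤ X.bd * √(X.size w)⁻¹ := by
  have hM := X.one_le_bd
  by_cases h : w = []
  · subst h
    simp [wordElement_nil, moebiusDenom, size_nil, hM, inv_le_one_of_one_le₀ hM]
  · have hr := (isReduced_append.mp hw).1
    have hd := X.dist_pole hw h hz
    have h0 := X.size_pos hr
    have e : ‖moebiusDenom (X.wordElement w) z‖ = √(X.size w)⁻¹ * ‖z - X.pole w‖ := by
      rw [← Real.sqrt_sq (norm_nonneg (moebiusDenom _ _)), X.norm_moebiusDenom_sq hr h,
        Real.sqrt_mul (by positivity), Real.sqrt_sq (norm_nonneg _)]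
    rw [e, mul_comm _ ‖_‖]
    exact ⟨mul_le_mul_of_nonneg_right hd.1 (Real.sqrt_nonneg _),
      mul_le_mul_of_nonneg_right hd.2 (Real.sqrt_nonneg _)⟩

theorem deriv_wordMap {w : List (Fin m ⊕ Fin m)} {d : Fin m ⊕ Fin m}
    (hw : IsReduced (w ++ [d])) {z : ℂ} (hz : z ∈ X.closedDisk d) :
    deriv (X.wordMap w) z = 1 / moebiusDenom (X.wordElement w) z ^ 2 :=
  (hasDerivAt_moebius _ (X.moebiusDenom_ne_zero hw hz)).deriv

theorem norm_deriv_wordMap_bounds {w : List (Fin m ⊕ Fin m)} {d : Fin m ⊕ Fin m}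
    (hw : IsReduced (w ++ [d])) {z : ℂ} (hz : z ∈ X.closedDisk d) :
    X.bd⁻¹ ^ 2 * X.size w ≤ ‖deriv (X.wordMap w) z‖ ∧
      ‖deriv (X.wordMap w) z‖ ≤ X.bd ^ 2 * X.size w := by
  have hb := X.norm_moebiusDenom_bounds hw hz
  have hs := X.size_pos (isReduced_append.mp hw).1
  have hM := X.bd_pos
  rw [X.deriv_wordMap hw hz, norm_div, norm_one, norm_pow]
  set t := ‖moebiusDenom (X.wordElement w) z‖
  have h1 : 0 < t := norm_pos_iff.mpr (X.moebiusDenom_ne_zero hw hz)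
  have h2 : √(X.size w)⁻¹ ^ 2 = (X.size w)⁻¹ := Real.sq_sqrt (by positivity)
  have e1 : t ^ 2 ≤ X.bd ^ 2 * (X.size w)⁻¹ := by
    rw [← h2, ← mul_pow]; exact pow_le_pow_left₀ h1.le hb.2 2
  have e2 : X.bd⁻¹ ^ 2 * (X.size w)⁻¹ ≤ t ^ 2 := by
    rw [← h2, ← mul_pow]; exact pow_le_pow_left₀ (by positivity) hb.1 2
  constructor
  · rw [le_div_iff₀ (by positivity)]
    calc _ ≤ X.bd⁻¹ ^ 2 * X.size w * (X.bd ^ 2 * (X.size w)⁻¹) := by gcongr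
      _ = 1 := by field_simp
  · rw [div_le_iff₀ (by positivity)]
    calc 1 = X.bd ^ 2 * X.size w * (X.bd⁻¹ ^ 2 * (X.size w)⁻¹) := by field_simp
      _ ≤ _ := by gcongr

/-- On the disks of the letters that may follow `w`, the map `γ_w` is a similarity with ratio the
size of `w`, up to constants. -/
theorem norm_wordMap_sub_bounds {w : List (Fin m ⊕ Fin m)} {d e : Fin m ⊕ Fin m}
    (hd : IsReduced (w ++ [d])) (he : IsReduced (w ++ [e])) {z z' : ℂ} (hz : z ∈ X.closedDisk d)
    (hz' : z' ∈ X.closedDisk e) :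
    X.bd⁻¹ ^ 2 * (X.size w * ‖z - z'‖) ≤ ‖X.wordMap w z - X.wordMap w z'‖ ∧
      ‖X.wordMap w z - X.wordMap w z'‖ ≤ X.bd ^ 2 * (X.size w * ‖z - z'‖) := by
  have hb := X.norm_moebiusDenom_bounds hd hz
  have hb' := X.norm_moebiusDenom_bounds he hz'
  have hs := X.size_pos (isReduced_append.mp hd).1
  have hM := X.bd_pos
  have n1 := X.moebiusDenom_ne_zero hd hz
  have n2 := X.moebiusDenom_ne_zero he hz'
  rw [wordMap, moebius_sub_moebius _ n1 n2, norm_div, norm_mul]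
  set t := ‖moebiusDenom (X.wordElement w) z‖
  set t' := ‖moebiusDenom (X.wordElement w) z'‖
  have h1 : 0 < t := norm_pos_iff.mpr n1
  have h1' : 0 < t' := norm_pos_iff.mpr n2
  have h2 : √(X.size w)⁻¹ * √(X.size w)⁻¹ = (X.size w)⁻¹ := Real.mul_self_sqrt (by positivity)
  have e1 : t * t' ≤ X.bd ^ 2 * (X.size w)⁻¹ := by
    calc t * t' ≤ (X.bd * √(X.size w)⁻¹) * (X.bd * √(X.size w)⁻¹) := by
          gcongr
          exacts [hb.2, hb'.2]
      _ = X.bd ^ 2 * (√(X.size w)⁻¹ * √(X.size w)⁻¹) := by ring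
      _ = _ := by rw [h2]
  have e2 : X.bd⁻¹ ^ 2 * (X.size w)⁻¹ ≤ t * t' := by
    calc _ = X.bd⁻¹ ^ 2 * (√(X.size w)⁻¹ * √(X.size w)⁻¹) := by rw [h2]
      _ = (X.bd⁻¹ * √(X.size w)⁻¹) * (X.bd⁻¹ * √(X.size w)⁻¹) := by ring
      _ ≤ t * t' := by
          gcongr
          exacts [hb.1, hb'.1]
  constructor
  · rw [le_div_iff₀ (by positivity)]
    calc _ ≤ X.bd⁻¹ ^ 2 * (X.size w * ‖z - z'‖) * (X.bd ^ 2 * (X.size w)⁻¹) := by gcongr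
      _ = ‖z - z'‖ := by field_simp
  · rw [div_le_iff₀ (by positivity)]
    calc ‖z - z'‖ = X.bd ^ 2 * (X.size w * ‖z - z'‖) * (X.bd⁻¹ ^ 2 * (X.size w)⁻¹) := by field_simp
      _ ≤ _ := by gcongr

/-! ### Disks of words -/

theorem mem_wordDisk_concat {u : List (Fin m ⊕ Fin m)} {a : Fin m ⊕ Fin m} {z : ℂ} :
    z ∈ X.wordDisk (u ++ [a]) ↔ z ∈ X.wordMap u '' X.disk a := by
  simp [wordDisk]

theorem wordDisk_subset_disk {a : Fin m ⊕ Fin m} {u : List (Fin m ⊕ Fin m)}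
    (h : IsReduced (a :: u)) : X.wordDisk (a :: u) ⊆ X.disk a := by
  intro z hz
  obtain rfl | ⟨u, b, rfl⟩ := List.eq_nil_or_concat' u
  · rw [← List.nil_append [a], mem_wordDisk_concat] at hz
    obtain ⟨y, hy, rfl⟩ := hz
    rwa [wordMap_nil]
  · rw [← List.cons_append, mem_wordDisk_concat] at hz
    obtain ⟨y, hy, rfl⟩ := hz
    exact X.wordMap_mem_disk h (X.disk_subset_closedDisk _ hy)

theorem wordDisk_append {u v : List (Fin m ⊕ Fin m)} (h : IsReduced (u ++ v)) (hv : v ≠ []) :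
    X.wordDisk (u ++ v) = X.wordMap u '' X.wordDisk v := by
  obtain ⟨v, b, rfl⟩ := List.eq_nil_or_concat' v |>.resolve_left hv
  have hvb := (isReduced_append.mp h).2.1
  ext z
  rw [← List.append_assoc, mem_wordDisk_concat]
  constructor
  · rintro ⟨y, hy, rfl⟩
    refine ⟨X.wordMap v y, X.mem_wordDisk_concat.mpr ⟨y, hy, rfl⟩, ?_⟩
    rw [X.wordMap_append hvb (X.disk_subset_closedDisk _ hy)]
  · rintro ⟨_, hy', rfl⟩
    obtain ⟨y, hy, rfl⟩ := X.mem_wordDisk_concat.mp hy'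
    refine ⟨y, hy, ?_⟩
    rw [X.wordMap_append hvb (X.disk_subset_closedDisk _ hy)]

theorem wordDisk_subset_of_prefix {u v : List (Fin m ⊕ Fin m)} (h : IsReduced v)
    (huv : u <+: v) (hu : u ≠ []) : X.wordDisk v ⊆ X.wordDisk u := by
  obtain ⟨t, rfl⟩ := huv
  obtain ⟨u, a, rfl⟩ := List.eq_nil_or_concat' u |>.resolve_left hu
  rw [List.append_assoc] at h ⊢
  rw [X.wordDisk_append h (by simp)]
  intro z hz
  rw [mem_wordDisk_concat]
  exact Set.image_mono (X.wordDisk_subset_disk (isReduced_append.mp h).2.1) hz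

/-- Two lists are comparable for the prefix order, or diverge after a common prefix `w`. -/
theorem list_trichotomy {β : Type*} (u v : List β) : u <+: v ∨ v <+: u ∨
    ∃ w a b s t, a ≠ b ∧ u = w ++ a :: s ∧ v = w ++ b :: t := by
  induction u generalizing v with
  | nil => simp
  | cons x u ih =>
    cases v with
    | nil => simp
    | cons y v =>
      by_cases hxy : x = y
      · subst hxy
        rcases ih v with h | h | ⟨w, a, b, s, t, hab, rfl, rfl⟩
        · left; simpa using h
        · right; left; simpa using h
        · exact Or.inr (Or.inr ⟨x :: w, a, b, s, t, hab, rfl, rfl⟩)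
      · exact Or.inr (Or.inr ⟨[], x, y, u, v, hxy, rfl, rfl⟩)

theorem gap_of_mem_image {w : List (Fin m ⊕ Fin m)} {a b : Fin m ⊕ Fin m} (hab : a ≠ b)
    (ha : IsReduced (w ++ [a])) (hb : IsReduced (w ++ [b])) {z z' : ℂ}
    (hz : z ∈ X.wordMap w '' X.closedDisk a) (hz' : z' ∈ X.wordMap w '' X.closedDisk b) :
    X.bd⁻¹ ^ 3 * X.size w ≤ ‖z - z'‖ := by
  obtain ⟨y, hy, rfl⟩ := hz
  obtain ⟨y', hy', rfl⟩ := hz'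
  have h1 := (X.norm_wordMap_sub_bounds ha hb hy hy').1
  have h2 := (X.bd_spec.sep a b hab y hy y' hy').1
  have hs := X.size_pos (isReduced_append.mp ha).1
  have := X.bd_pos
  refine le_trans ?_ h1
  calc _ = X.bd⁻¹ ^ 2 * (X.size w * X.bd⁻¹) := by ring
    _ ≤ _ := by gcongr

theorem isReduced_concat_of_append_cons {w s : List (Fin m ⊕ Fin m)} {a : Fin m ⊕ Fin m}
    (h : IsReduced (w ++ a :: s)) : IsReduced (w ++ [a]) :=
  h.prefix ⟨s, by simp⟩

/-- The disks of two words that diverge after `w` are separated by the size of `w`. -/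
theorem gap_wordDisk {w s t : List (Fin m ⊕ Fin m)} {a b : Fin m ⊕ Fin m} (hab : a ≠ b)
    (ha : IsReduced (w ++ a :: s)) (hb : IsReduced (w ++ b :: t)) {z z' : ℂ}
    (hz : z ∈ X.wordDisk (w ++ a :: s)) (hz' : z' ∈ X.wordDisk (w ++ b :: t)) :
    X.bd⁻¹ ^ 3 * X.size w ≤ ‖z - z'‖ := by
  rw [X.wordDisk_append ha (by simp)] at hz
  rw [X.wordDisk_append hb (by simp)] at hz'
  refine X.gap_of_mem_image hab (isReduced_concat_of_append_cons ha)
    (isReduced_concat_of_append_cons hb) ?_ ?_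
  · exact Set.image_mono ((X.wordDisk_subset_disk (isReduced_append.mp ha).2.1).trans
      (X.disk_subset_closedDisk a)) hz
  · exact Set.image_mono ((X.wordDisk_subset_disk (isReduced_append.mp hb).2.1).trans
      (X.disk_subset_closedDisk b)) hz'

/-- The analogue of `gap_wordDisk` for the points `γ_u(∞)`. For mirror words it separates poles. -/
theorem gap_imageInfty {w s t : List (Fin m ⊕ Fin m)} {a b : Fin m ⊕ Fin m} (hab : a ≠ b)
    (ha : IsReduced (w ++ a :: s)) (hb : IsReduced (w ++ b :: t)) :
    X.bd⁻¹ ^ 3 * X.size w ≤ |X.imageInfty (w ++ a :: s) - X.imageInfty (w ++ b :: t)| := by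
  have h1 := (isReduced_append.mp ha).2.1
  have h2 := (isReduced_append.mp hb).2.1
  have := X.gap_of_mem_image hab (isReduced_concat_of_append_cons ha)
    (isReduced_concat_of_append_cons hb)
    ⟨_, X.disk_subset_closedDisk _ (X.imageInfty_mem h1), rfl⟩
    ⟨_, X.disk_subset_closedDisk _ (X.imageInfty_mem h2), rfl⟩
  rwa [← X.imageInfty_append h1 (by simp), ← X.imageInfty_append h2 (by simp),
    ← Complex.ofReal_sub, Complex.norm_real, Real.norm_eq_abs] at this

/-- The disks of two words meet only if one of the words is a prefix of the other. -/
theorem prefix_or_of_mem_wordDisk {u v : List (Fin m ⊕ Fin m)} (hu : IsReduced u)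
    (hv : IsReduced v) {z : ℂ} (hzu : z ∈ X.wordDisk u) (hzv : z ∈ X.wordDisk v) :
    u <+: v ∨ v <+: u := by
  rcases list_trichotomy u v with h | h | ⟨w, a, b, s, t, hab, rfl, rfl⟩
  · exact Or.inl h
  · exact Or.inr h
  · have := X.gap_wordDisk hab hu hv hzu hzv
    have h1 := X.size_pos (isReduced_append.mp hu).1
    have h2 := X.bd_pos
    have h3 : 0 < X.bd⁻¹ ^ 3 * X.size w := by positivity
    rw [sub_self, norm_zero] at this
    linarith

/-- If points of the disks of two words are at distance at most `r`, then a prefix `p` of the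
first word all of whose proper prefixes have size more than `M³ r` is comparable with the second
word. -/
theorem prefix_or_of_near {p u v : List (Fin m ⊕ Fin m)} (hu : IsReduced u) (hv : IsReduced v)
    {z z' : ℂ} (hzu : z ∈ X.wordDisk u) (hzv : z' ∈ X.wordDisk v) {r : ℝ} (hr : ‖z - z'‖ ≤ r)
    (hp : p <+: u) (hpr : ∀ q, q <+: p → q ≠ p → X.bd ^ 3 * r < X.size q) :
    p <+: v ∨ v <+: p := by
  rcases list_trichotomy u v with h | h | ⟨w, a, b, s, t, hab, rfl, rfl⟩
  · exact Or.inl (hp.trans h)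
  · exact List.prefix_or_prefix_of_prefix hp h
  · left
    have h1 := (X.gap_wordDisk hab hu hv hzu hzv).trans hr
    have h2 : X.size w ≤ X.bd ^ 3 * r := by
      have := X.bd_pos
      calc X.size w = X.bd ^ 3 * (X.bd⁻¹ ^ 3 * X.size w) := by field_simp
        _ ≤ _ := by gcongr
    rcases List.prefix_or_prefix_of_prefix hp (List.prefix_append w (a :: s)) with h | h
    · exact h.trans (List.prefix_append w _)
    · by_cases hwp : w = p
      · exact hwp ▸ List.prefix_append w _
      · exact absurd (hpr w h hwp) (not_lt.mpr h2)

end SchottkyData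

namespace SchottkyData

variable {m : ℕ} (X : SchottkyData m)

/-! ### Intervals of words and exponential decay -/

theorem isOpen_wordDisk {u : List (Fin m ⊕ Fin m)} (hu : IsReduced u) :
    IsOpen (X.wordDisk u) := by
  obtain rfl | ⟨u, a, rfl⟩ := List.eq_nil_or_concat' u
  · simp [wordDisk]
  rw [isOpen_iff_mem_nhds]
  intro z hz
  obtain ⟨y, hy, rfl⟩ := X.mem_wordDisk_concat.mp hz
  have hne := X.moebiusDenom_ne_zero hu (X.disk_subset_closedDisk _ hy)
  have h := (hasStrictDerivAt_moebius _ hne).map_nhds_eq (by simp [hne])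
  change _ ∈ 𝓝 (moebius (X.wordElement u) y)
  rw [← h]
  have : X.wordDisk (u ++ [a]) = X.wordMap u '' X.disk a := by
    ext; exact X.mem_wordDisk_concat
  rw [this]
  exact Filter.image_mem_map (Metric.isOpen_ball.mem_nhds hy)

theorem isOpen_wordInterval {u : List (Fin m ⊕ Fin m)} (hu : IsReduced u) :
    IsOpen (X.wordInterval u) :=
  (X.isOpen_wordDisk hu).preimage Complex.continuous_ofReal

theorem abs_sub_le_of_mem_wordInterval {u : List (Fin m ⊕ Fin m)} {a : Fin m ⊕ Fin m}
    (hu : IsReduced (u ++ [a])) {x y : ℝ} (hx : x ∈ X.wordInterval (u ++ [a]))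
    (hy : y ∈ X.wordInterval (u ++ [a])) : |x - y| ≤ 2 * X.bd ^ 3 * X.size u := by
  obtain ⟨x', hx', ex⟩ := X.mem_wordDisk_concat.mp hx
  obtain ⟨y', hy', ey⟩ := X.mem_wordDisk_concat.mp hy
  have h := (X.norm_wordMap_sub_bounds hu hu (X.disk_subset_closedDisk _ hx')
    (X.disk_subset_closedDisk _ hy')).2
  rw [ex, ey, ← Complex.ofReal_sub, Complex.norm_real, Real.norm_eq_abs] at h
  have hs := X.size_pos (isReduced_append.mp hu).1
  have := X.bd_pos
  have h3 : ‖x' - y'‖ ≤ 2 * X.bd := by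
    rw [← dist_eq_norm]
    rw [disk, Metric.mem_ball] at hx' hy'
    have := dist_triangle_right x' y' (X.center a : ℂ)
    linarith [(X.bd_spec.radius a).2]
  calc _ ≤ _ := h
    _ ≤ X.bd ^ 2 * (X.size u * (2 * X.bd)) := by gcongr
    _ = _ := by ring

/-- The interval of a word `w = u a` contains a compact interval of length comparable to the size
of `u`. -/
theorem exists_Icc_subset_wordInterval {u : List (Fin m ⊕ Fin m)} {a : Fin m ⊕ Fin m}
    (hu : IsReduced (u ++ [a])) : ∃ x y : ℝ, x ≤ y ∧ X.bd⁻¹ ^ 3 / 2 * X.size u ≤ y - x ∧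
      Set.Icc x y ⊆ X.wordInterval (u ++ [a]) := by
  set f : ℝ → ℝ := fun x => (X.wordMap u x).re with hf
  have hfc : ∀ x : ℝ, (f x : ℂ) = X.wordMap u x := by
    intro x
    simp only [hf, wordMap, moebius_ofReal, Complex.ofReal_re]
  have hr := X.radius_pos a
  set c := X.center a
  set r := X.radius a
  have hmem : ∀ x ∈ Set.Icc c (c + r / 2), (x : ℂ) ∈ X.disk a := by
    intro x hx
    rw [disk, Metric.mem_ball, Complex.dist_of_im_eq (by simp)]
    simp only [Complex.ofReal_re, Real.dist_eq]
    rw [abs_lt]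
    exact ⟨by linarith [hx.1], by linarith [hx.2]⟩
  have hcont : ContinuousOn f (Set.Icc c (c + r / 2)) := by
    refine Complex.continuous_re.comp_continuousOn
      ((X.continuousOn_wordMap hu).comp Complex.continuous_ofReal.continuousOn ?_)
    exact fun x hx => X.disk_subset_closedDisk _ (hmem x hx)
  have hpre := (isPreconnected_Icc.image f hcont).ordConnected
  have hsub : f '' Set.Icc c (c + r / 2) ⊆ X.wordInterval (u ++ [a]) := by
    rintro _ ⟨x, hx, rfl⟩
    rw [wordInterval, Set.mem_ofPred_eq, mem_wordDisk_concat]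
    exact ⟨x, hmem x hx, (hfc x).symm⟩
  have m1 : c ∈ Set.Icc c (c + r / 2) := ⟨le_rfl, by linarith⟩
  have m2 : c + r / 2 ∈ Set.Icc c (c + r / 2) := ⟨by linarith, le_rfl⟩
  have hlen : X.bd⁻¹ ^ 3 / 2 * X.size u ≤ |f c - f (c + r / 2)| := by
    have h := (X.norm_wordMap_sub_bounds hu hu (X.disk_subset_closedDisk _ (hmem c m1))
      (X.disk_subset_closedDisk _ (hmem _ m2))).1
    rw [← hfc, ← hfc, ← Complex.ofReal_sub, ← Complex.ofReal_sub, Complex.norm_real,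
      Complex.norm_real, Real.norm_eq_abs, Real.norm_eq_abs] at h
    refine le_trans ?_ h
    have e : |c - (c + r / 2)| = r / 2 := by
      rw [abs_sub_comm, add_sub_cancel_left, abs_of_pos (by linarith)]
    rw [e]
    have hs := X.size_pos (isReduced_append.mp hu).1
    have := X.bd_pos
    calc _ = X.bd⁻¹ ^ 2 * (X.size u * (X.bd⁻¹ / 2)) := by ring
      _ ≤ _ := by gcongr; exact (X.bd_spec.radius a).1
  rcases le_total (f c) (f (c + r / 2)) with hle | hle
  · refine ⟨_, _, hle, ?_, (hpre.out ⟨_, m1, rfl⟩ ⟨_, m2, rfl⟩).trans hsub⟩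
    rwa [abs_sub_comm, abs_of_nonneg (by linarith)] at hlen
  · refine ⟨_, _, hle, ?_, (hpre.out ⟨_, m2, rfl⟩ ⟨_, m1, rfl⟩).trans hsub⟩
    rwa [abs_of_nonneg (by linarith)] at hlen

theorem isBounded_wordInterval {u : List (Fin m ⊕ Fin m)} {a : Fin m ⊕ Fin m}
    (hu : IsReduced (u ++ [a])) : Bornology.IsBounded (X.wordInterval (u ++ [a])) := by
  rw [Metric.isBounded_iff]
  exact ⟨_, fun x hx y hy => X.abs_sub_le_of_mem_wordInterval hu hx hy⟩

theorem diam_wordInterval_bounds {u : List (Fin m ⊕ Fin m)} {a : Fin m ⊕ Fin m}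
    (hu : IsReduced (u ++ [a])) :
    X.bd⁻¹ ^ 3 / 2 * X.size u ≤ Metric.diam (X.wordInterval (u ++ [a])) ∧
      Metric.diam (X.wordInterval (u ++ [a])) ≤ 2 * X.bd ^ 3 * X.size u := by
  have hs := X.size_pos (isReduced_append.mp hu).1
  have := X.bd_pos
  constructor
  · obtain ⟨x, y, hxy, h, hsub⟩ := X.exists_Icc_subset_wordInterval hu
    refine h.trans ?_
    have := Metric.dist_le_diam_of_mem (X.isBounded_wordInterval hu) (hsub ⟨hxy, le_rfl⟩)
      (hsub ⟨le_rfl, hxy⟩)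
    rwa [Real.dist_eq, abs_of_nonneg (by linarith)] at this
  · refine Metric.diam_le_of_forall_dist_le (by positivity) fun x hx y hy => ?_
    exact X.abs_sub_le_of_mem_wordInterval hu hx hy

theorem exists_letter_ne (hm : 2 ≤ m) (b c : Fin m ⊕ Fin m) : ∃ d, d ≠ b ∧ d ≠ c := by
  by_contra! h
  have : (Finset.univ : Finset (Fin m ⊕ Fin m)) ⊆ {b, c} := by
    intro d _
    by_cases hd : d = b
    · simp [hd]
    · simp [h d hd]
  have h1 := Finset.card_le_card this
  have h2 := Finset.card_le_two (a := b) (b := c)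
  simp at h1
  omega

theorem exists_isReduced_concat (hm : 2 ≤ m) {w : List (Fin m ⊕ Fin m)} (hw : IsReduced w)
    (b : Fin m ⊕ Fin m) : ∃ d, d ≠ b ∧ IsReduced (w ++ [d]) := by
  obtain rfl | ⟨u, a, rfl⟩ := List.eq_nil_or_concat' w
  · obtain ⟨d, hd, -⟩ := exists_letter_ne hm b b
    exact ⟨d, hd, by simp [IsReduced]⟩
  · obtain ⟨d, hd, hd'⟩ := exists_letter_ne hm b a.swap
    refine ⟨d, hd, isReduced_concat.mpr ⟨hw, ?_⟩⟩
    intro e he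
    simp only [List.getLast?_append, List.getLast?_singleton, Option.some_or,
      Option.mem_some_iff] at he
    subst he
    intro h
    exact hd' (by rw [h, Sum.swap_swap])

/-- The length of `I_w`, as its Lebesgue measure, so that the lengths of disjoint intervals add
up. -/
noncomputable def len (w : List (Fin m ⊕ Fin m)) : ℝ := (volume (X.wordInterval w)).toReal

theorem volume_wordInterval_ne_top {u : List (Fin m ⊕ Fin m)} {a : Fin m ⊕ Fin m}
    (hu : IsReduced (u ++ [a])) : volume (X.wordInterval (u ++ [a])) ≠ ∞ :=
  (X.isBounded_wordInterval hu).measure_lt_top.ne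

theorem len_bounds {u : List (Fin m ⊕ Fin m)} {a : Fin m ⊕ Fin m}
    (hu : IsReduced (u ++ [a])) :
    X.bd⁻¹ ^ 3 / 2 * X.size u ≤ X.len (u ++ [a]) ∧ X.len (u ++ [a]) ≤ 2 * X.bd ^ 3 * X.size u := by
  constructor
  · obtain ⟨x, y, hxy, h, hsub⟩ := X.exists_Icc_subset_wordInterval hu
    refine h.trans ?_
    have := ENNReal.toReal_mono (X.volume_wordInterval_ne_top hu) (measure_mono (μ := volume) hsub)
    rwa [Real.volume_Icc, ENNReal.toReal_ofReal (by linarith)] at this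
  · refine le_trans ?_ (X.diam_wordInterval_bounds hu).2
    have h1 : volume (X.wordInterval (u ++ [a])) ≤ _ := Real.volume_le_diam _
    have h2 := ENNReal.toReal_mono (X.isBounded_wordInterval hu).ediam_ne_top h1
    exact h2

theorem wordInterval_subset_of_prefix {u v : List (Fin m ⊕ Fin m)} (h : IsReduced v)
    (huv : u <+: v) (hu : u ≠ []) : X.wordInterval v ⊆ X.wordInterval u :=
  fun _ hx => X.wordDisk_subset_of_prefix h huv hu hx

/-- Lengths contract by a uniform factor under extension by a letter: a sibling of `w b` takes up a
definite proportion of `I_w`. -/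
theorem len_concat_le (hm : 2 ≤ m) {u : List (Fin m ⊕ Fin m)} {a b : Fin m ⊕ Fin m}
    (h : IsReduced (u ++ [a] ++ [b])) :
    X.len (u ++ [a] ++ [b]) ≤ (1 - X.bd⁻¹ ^ 9 / 4) * X.len (u ++ [a]) := by
  have hua := (isReduced_append.mp h).1
  have hu := (isReduced_append.mp hua).1
  obtain ⟨d, hdb, hd⟩ := exists_isReduced_concat hm hua b
  obtain ⟨x, y, hxy, hlen, hsub⟩ := X.exists_Icc_subset_wordInterval hd
  have hs := X.size_pos hu
  have hM := X.bd_pos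
  have hdisj : Disjoint (X.wordInterval (u ++ [a] ++ [b])) (Set.Icc x y) := by
    rw [Set.disjoint_left]
    intro t ht1 ht2
    rcases X.prefix_or_of_mem_wordDisk h hd ht1 (hsub ht2) with h' | h'
    · have := h'.eq_of_length (by simp)
      simp at this
      exact hdb this.symm
    · have := h'.eq_of_length (by simp)
      simp at this
      exact hdb this
  have h1 : volume (X.wordInterval (u ++ [a] ++ [b])) + volume (Set.Icc x y) ≤
      volume (X.wordInterval (u ++ [a])) := by
    rw [← measure_union hdisj measurableSet_Icc]
    refine measure_mono (Set.union_subset ?_ (hsub.trans ?_))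
    · exact X.wordInterval_subset_of_prefix h (List.prefix_append _ _) (by simp)
    · exact X.wordInterval_subset_of_prefix hd (List.prefix_append _ _) (by simp)
  have h2 := ENNReal.toReal_mono (X.volume_wordInterval_ne_top hua) h1
  rw [ENNReal.toReal_add (X.volume_wordInterval_ne_top h) (by simp), Real.volume_Icc,
    ENNReal.toReal_ofReal (by linarith)] at h2
  have h3 := (X.len_bounds hua).2
  have h4 := X.size_concat_ge hua
  change X.len _ + (y - x) ≤ X.len _ at h2
  have h5 : X.bd⁻¹ ^ 9 / 4 * X.len (u ++ [a]) ≤ y - x := by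
    calc _ ≤ X.bd⁻¹ ^ 9 / 4 * (2 * X.bd ^ 3 * X.size u) := by gcongr
      _ = X.bd⁻¹ ^ 3 / 2 * (X.bd⁻¹ ^ 3 * X.size u) := by field_simp; ring
      _ ≤ X.bd⁻¹ ^ 3 / 2 * X.size (u ++ [a]) := by gcongr
      _ ≤ y - x := hlen
  linarith

/-- Sizes decay exponentially in the length of the word. -/
theorem exists_size_le_pow (hm : 2 ≤ m) : ∃ C θ : ℝ, 1 ≤ C ∧ 0 < θ ∧ θ < 1 ∧
    ∀ w : List (Fin m ⊕ Fin m), IsReduced w → X.size w ≤ C * θ ^ w.length := by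
  have hM := X.bd_pos
  have hM1 := X.one_le_bd
  have hinv : X.bd⁻¹ ^ 9 ≤ 1 := pow_le_one₀ (by positivity) (inv_le_one_of_one_le₀ hM1)
  have hinv0 : 0 < X.bd⁻¹ ^ 9 := by positivity
  set θ := 1 - X.bd⁻¹ ^ 9 / 4 with hθ
  have h0 : 0 < θ := by linarith
  have h1 : θ < 1 := by linarith
  have key : ∀ n (w : List (Fin m ⊕ Fin m)), w.length = n + 1 → IsReduced w →
      X.len w ≤ 2 * X.bd ^ 3 * θ ^ n := by
    intro n
    induction n with
    | zero =>
      intro w hw hr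
      obtain ⟨a, rfl⟩ := List.length_eq_one_iff.mp hw
      have := (X.len_bounds (u := []) (a := a) (by simpa using hr)).2
      simpa [size_nil] using this
    | succ n ih =>
      intro w hw hr
      obtain ⟨v, b, rfl⟩ := List.eq_nil_or_concat' w |>.resolve_left (by rintro rfl; simp at hw)
      simp only [List.length_append, List.length_singleton, Nat.add_right_cancel_iff] at hw
      have h2 := ih v hw (isReduced_append.mp hr).1
      obtain ⟨u, a, rfl⟩ := List.eq_nil_or_concat' v |>.resolve_left (by rintro rfl; simp at hw)
      have h3 := X.len_concat_le hm hr
      calc _ ≤ θ * X.len (u ++ [a]) := h3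
        _ ≤ θ * (2 * X.bd ^ 3 * θ ^ n) := by gcongr
        _ = _ := by ring
  refine ⟨4 * X.bd ^ 9 / θ, θ, ?_, h0, h1, ?_⟩
  · rw [le_div_iff₀ h0]
    have : (1 : ℝ) ≤ X.bd ^ 9 := one_le_pow₀ hM1
    linarith
  · intro w hr
    obtain rfl | ⟨u, a, rfl⟩ := List.eq_nil_or_concat' w
    · simp only [size_nil, List.length_nil, pow_zero, mul_one]
      rw [le_div_iff₀ h0]
      have : (1 : ℝ) ≤ X.bd ^ 9 := one_le_pow₀ hM1
      linarith
    · have h2 := key u.length (u ++ [a]) (by simp) hr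
      have h3 := (X.len_bounds hr).1
      have h4 := X.size_concat_le hr
      have h5 : X.size u ≤ 2 * X.bd ^ 3 * (2 * X.bd ^ 3 * θ ^ u.length) := by
        calc X.size u = 2 * X.bd ^ 3 * (X.bd⁻¹ ^ 3 / 2 * X.size u) := by field_simp
          _ ≤ 2 * X.bd ^ 3 * X.len (u ++ [a]) := by gcongr
          _ ≤ _ := by gcongr
      calc _ ≤ X.bd ^ 3 * X.size u := h4
        _ ≤ X.bd ^ 3 * (2 * X.bd ^ 3 * (2 * X.bd ^ 3 * θ ^ u.length)) := by gcongr
        _ = _ := by simp only [List.length_append, List.length_singleton, pow_succ]; field_simp; ring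

/-! ### The limit set -/

theorem mem_limitSet_iff {x : ℝ} : x ∈ X.limitSet ↔
    ∀ n, 1 ≤ n → ∃ w, IsReduced w ∧ w.length = n ∧ x ∈ X.wordInterval w := by
  simp only [limitSet, Set.mem_iInter, Set.mem_iUnion, exists_prop, and_assoc]

/-- The closed interval with interior `I_w`. -/
def closedInterval (w : List (Fin m ⊕ Fin m)) : Set ℝ :=
  {x | ∃ a ∈ w.getLast?, (x : ℂ) ∈ X.wordMap w.dropLast '' X.closedDisk a}

theorem mem_closedInterval_concat {u : List (Fin m ⊕ Fin m)} {a : Fin m ⊕ Fin m} {x : ℝ} :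
    x ∈ X.closedInterval (u ++ [a]) ↔ (x : ℂ) ∈ X.wordMap u '' X.closedDisk a := by
  simp [closedInterval]

theorem isCompact_closedInterval {w : List (Fin m ⊕ Fin m)} (hw : IsReduced w) :
    IsCompact (X.closedInterval w) := by
  obtain rfl | ⟨u, a, rfl⟩ := List.eq_nil_or_concat' w
  · simp [closedInterval]
  · have hK : IsCompact (X.wordMap u '' X.closedDisk a) :=
      (isCompact_closedBall _ _).image_of_continuousOn (X.continuousOn_wordMap hw)
    have : X.closedInterval (u ++ [a]) =
        (fun x : ℝ => (x : ℂ)) ⁻¹' (X.wordMap u '' X.closedDisk a) := by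
      ext x; exact X.mem_closedInterval_concat
    rw [this]
    exact Complex.isometry_ofReal.isClosedEmbedding.isCompact_preimage hK

theorem wordInterval_subset_closedInterval (w : List (Fin m ⊕ Fin m)) :
    X.wordInterval w ⊆ X.closedInterval w := by
  rintro x ⟨a, ha, y, hy, e⟩
  exact ⟨a, ha, y, X.disk_subset_closedDisk _ hy, e⟩

theorem closedInterval_concat_subset {u : List (Fin m ⊕ Fin m)} {a b : Fin m ⊕ Fin m}
    (h : IsReduced (u ++ [a] ++ [b])) :
    X.closedInterval (u ++ [a] ++ [b]) ⊆ X.wordInterval (u ++ [a]) := by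
  intro x hx
  obtain ⟨y, hy, e⟩ := X.mem_closedInterval_concat.mp hx
  rw [wordInterval, Set.mem_ofPred_eq, mem_wordDisk_concat]
  have hab : IsReduced ([a] ++ [b]) := h.suffix ⟨u, by simp⟩
  refine ⟨X.wordMap [a] y, X.wordMap_mem_disk (w := []) hab hy, ?_⟩
  rw [← X.wordMap_append hab hy, e]

/-- The limit set is also the intersection of the unions of the closed intervals, as the closed
interval of `u a b` lies in the open interval of `u a`. This makes it compact. -/
theorem limitSet_eq : X.limitSet = ⋂ (n : ℕ) (_ : 1 ≤ n),
    ⋃ w ∈ {w : List (Fin m ⊕ Fin m) | IsReduced w ∧ w.length = n}, X.closedInterval w := by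
  ext x
  simp only [mem_limitSet_iff, Set.mem_iInter, Set.mem_iUnion, Set.mem_ofPred_eq, exists_prop,
    and_assoc]
  constructor
  · intro h n hn
    obtain ⟨w, h1, h2, h3⟩ := h n hn
    exact ⟨w, h1, h2, X.wordInterval_subset_closedInterval w h3⟩
  · intro h n hn
    obtain ⟨w, h1, h2, h3⟩ := h (n + 1) (by omega)
    obtain ⟨v, b, rfl⟩ := List.eq_nil_or_concat' w |>.resolve_left (by rintro rfl; simp at h2)
    simp only [List.length_append, List.length_singleton, Nat.add_right_cancel_iff] at h2
    obtain ⟨u, a, rfl⟩ := List.eq_nil_or_concat' v |>.resolve_left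
      (by rintro rfl; simp at h2; omega)
    exact ⟨_, (isReduced_append.mp h1).1, h2, X.closedInterval_concat_subset h1 h3⟩

theorem isCompact_limitSet : IsCompact X.limitSet := by
  have hfin : ∀ n : ℕ, {w : List (Fin m ⊕ Fin m) | IsReduced w ∧ w.length = n}.Finite :=
    fun n => (List.finite_length_le _ n).subset fun w hw => hw.2.le
  have hc : ∀ n : ℕ, IsCompact (⋃ w ∈ {w : List (Fin m ⊕ Fin m) | IsReduced w ∧ w.length = n},
      X.closedInterval w) := fun n =>
    (hfin n).isCompact_biUnion fun w hw => X.isCompact_closedInterval hw.1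
  rw [limitSet_eq]
  refine (hc 1).of_isClosed_subset ?_ ?_
  · exact isClosed_iInter fun n => isClosed_iInter fun _ => (hc n).isClosed
  · exact Set.iInter₂_subset 1 le_rfl

theorem isReduced_append_replicate {u : List (Fin m ⊕ Fin m)} {a : Fin m ⊕ Fin m}
    (hu : IsReduced (u ++ [a])) (n : ℕ) : IsReduced (u ++ List.replicate (n + 1) a) := by
  induction n with
  | zero => simpa using hu
  | succ n ih =>
    rw [List.replicate_succ', ← List.append_assoc, isReduced_concat]
    refine ⟨ih, ?_⟩
    intro e he
    rw [List.replicate_succ', ← List.append_assoc] at he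
    simp only [List.getLast?_append, List.getLast?_singleton, Option.some_or,
      Option.mem_some_iff] at he
    subst he
    exact swap_ne_self _

/-- Every interval `I_w` meets `Λ`: repeating the last letter of `w` forever gives a nested sequence
of closed intervals in it. -/
theorem exists_mem_limitSet {w : List (Fin m ⊕ Fin m)} (hw : IsReduced w) (h : w ≠ []) :
    ∃ x ∈ X.limitSet, x ∈ X.wordInterval w := by
  obtain ⟨u, a, rfl⟩ := List.eq_nil_or_concat' w |>.resolve_left h
  set W : ℕ → List (Fin m ⊕ Fin m) := fun n => u ++ List.replicate (n + 1) a with hW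
  have hWr : ∀ n, IsReduced (W n) := isReduced_append_replicate hw
  have hstep : ∀ n, W (n + 1) = u ++ List.replicate n a ++ [a] ++ [a] := by
    intro n
    simp only [hW, List.replicate_succ', List.append_assoc]
  have hstep' : ∀ n, W n = u ++ List.replicate n a ++ [a] := by
    intro n
    simp only [hW, List.replicate_succ', List.append_assoc]
  have hsub : ∀ n, X.closedInterval (W (n + 1)) ⊆ X.wordInterval (W n) := by
    intro n
    rw [hstep, hstep']
    exact X.closedInterval_concat_subset (hstep n ▸ hWr (n + 1))
  obtain ⟨x, hx⟩ := IsCompact.nonempty_iInter_of_sequence_nonempty_isCompact_isClosed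
    (fun n => X.closedInterval (W n))
    (fun n => (hsub n).trans (X.wordInterval_subset_closedInterval _))
    (fun n => by
      rw [hstep']
      obtain ⟨x, y, hxy, -, hs⟩ := X.exists_Icc_subset_wordInterval (hstep' n ▸ hWr n)
      exact ⟨x, X.wordInterval_subset_closedInterval _ (hs ⟨le_rfl, hxy⟩)⟩)
    (X.isCompact_closedInterval (hWr 0)) (fun n => (X.isCompact_closedInterval (hWr n)).isClosed)
  simp only [Set.mem_iInter] at hx
  have hx' : ∀ n, x ∈ X.wordInterval (W n) := fun n => hsub n (hx (n + 1))
  refine ⟨x, X.mem_limitSet_iff.mpr fun n hn => ?_, by simpa [hW] using hx' 0⟩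
  refine ⟨(W n).take n, (hWr n).prefix (List.take_prefix _ _), ?_, ?_⟩
  · simp [hW]; omega
  · refine X.wordInterval_subset_of_prefix (hWr n) (List.take_prefix _ _) ?_ (hx' n)
    intro h0
    have := congrArg List.length h0
    simp [hW] at this
    omega

theorem exists_word_of_mem_limitSet {x : ℝ} (hx : x ∈ X.limitSet) {n : ℕ} (hn : 1 ≤ n) :
    ∃ w, IsReduced w ∧ w.length = n ∧ x ∈ X.wordInterval w :=
  X.mem_limitSet_iff.mp hx n hn

/-- A point of `Λ` in `I_p` has arbitrarily long codes that start with `p`. -/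
theorem exists_word_extending {x : ℝ} (hx : x ∈ X.limitSet) {p : List (Fin m ⊕ Fin m)}
    (hp : IsReduced p) (hxp : x ∈ X.wordInterval p) {n : ℕ} (hn : 1 ≤ n)
    (hpn : p.length ≤ n) : ∃ w, IsReduced w ∧ w.length = n ∧ x ∈ X.wordInterval w ∧ p <+: w := by
  obtain ⟨w, h1, h2, h3⟩ := X.exists_word_of_mem_limitSet hx hn
  refine ⟨w, h1, h2, h3, ?_⟩
  rcases X.prefix_or_of_mem_wordDisk hp h1 hxp h3 with h | h
  · exact h
  · exact (h.eq_of_length_le (by omega)) ▸ List.prefix_rfl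

/-- The map `γ_w` sends `Λ ∩ D_d` into `Λ` if `w d` is reduced. -/
theorem limitSet_invariant {w : List (Fin m ⊕ Fin m)} {d : Fin m ⊕ Fin m}
    (hw : IsReduced (w ++ [d])) {x : ℝ} (hx : x ∈ X.limitSet) (hxd : (x : ℂ) ∈ X.disk d) :
    ∃ y ∈ X.limitSet, (y : ℂ) = X.wordMap w x := by
  refine ⟨(X.wordMap w x).re, ?_, ?_⟩
  swap
  · simp only [wordMap, moebius_ofReal, Complex.ofReal_re]
  have hy : (((X.wordMap w x).re : ℝ) : ℂ) = X.wordMap w x := by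
    simp only [wordMap, moebius_ofReal, Complex.ofReal_re]
  refine X.mem_limitSet_iff.mpr fun n hn => ?_
  have hxd' : x ∈ X.wordInterval [d] := by
    rw [wordInterval, Set.mem_ofPred_eq, ← List.nil_append [d], mem_wordDisk_concat]
    exact ⟨x, hxd, X.wordMap_nil _⟩
  obtain ⟨v, h1, h2, h3, ⟨t, rfl⟩⟩ := X.exists_word_extending hx (isReduced_singleton d) hxd'
    hn (by simpa using hn)
  have hr : IsReduced (w ++ ([d] ++ t)) := by
    rw [isReduced_append]
    refine ⟨(isReduced_append.mp hw).1, h1, ?_⟩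
    simpa using (isReduced_append.mp hw).2.2
  have hmem : (X.wordMap w x).re ∈ X.wordInterval (w ++ ([d] ++ t)) := by
    rw [wordInterval, Set.mem_ofPred_eq, hy, X.wordDisk_append hr (by simp)]
    exact ⟨x, h3, rfl⟩
  refine ⟨(w ++ ([d] ++ t)).take n, hr.prefix (List.take_prefix _ _), ?_, ?_⟩
  · simp at h2 ⊢
    omega
  · refine X.wordInterval_subset_of_prefix hr (List.take_prefix _ _) ?_ hmem
    simp
    omega

/-! ### Stopping words -/

/-- `p` is a stopping word at scale `r`: it is reduced, has size at most `r`, and all its proper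
prefixes have size more than `r`. The intervals of the stopping words at scale `r < 1` cut `Λ` into
pieces of length about `r`. -/
def IsStop (r : ℝ) (p : List (Fin m ⊕ Fin m)) : Prop :=
  IsReduced p ∧ X.size p ≤ r ∧ ∀ q, q <+: p → q ≠ p → r < X.size q

theorem exists_stop_prefix {u : List (Fin m ⊕ Fin m)} (hu : IsReduced u) {r : ℝ}
    (hr : X.size u ≤ r) : ∃ p, p <+: u ∧ X.IsStop r p := by
  classical
  have hex : ∃ n, X.size (u.take n) ≤ r := ⟨u.length, by simpa using hr⟩
  refine ⟨u.take (Nat.find hex), List.take_prefix _ _, hu.prefix (List.take_prefix _ _),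
    Nat.find_spec hex, fun q hq hne => ?_⟩
  have hql : q.length < Nat.find hex := by
    have h1 : q.length < (u.take (Nat.find hex)).length :=
      lt_of_le_of_ne hq.length_le fun h => hne (hq.eq_of_length h)
    have h2 := List.length_take_le (Nat.find hex) u
    omega
  have hqe : q = u.take q.length :=
    List.prefix_iff_eq_take.mp (hq.trans (List.take_prefix _ _))
  have := Nat.find_min hex hql
  rw [← hqe] at this
  exact not_le.mp this

variable {X}

theorem IsStop.ne_nil {r : ℝ} {p : List (Fin m ⊕ Fin m)} (h : X.IsStop r p) (hr : r < 1) :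
    p ≠ [] := by
  rintro rfl
  have := h.2.1
  rw [size_nil] at this
  linarith

/-- The size of a stopping word at scale `r` is comparable to `r`, as one letter changes sizes by a
bounded factor. -/
theorem IsStop.size_ge {r : ℝ} {p : List (Fin m ⊕ Fin m)} (h : X.IsStop r p) (hr : r < 1) :
    X.bd⁻¹ ^ 3 * r ≤ X.size p := by
  obtain ⟨q, a, rfl⟩ := List.eq_nil_or_concat' p |>.resolve_left (h.ne_nil hr)
  have h1 := h.2.2 q (List.prefix_append _ _) (by simp)
  have := X.bd_pos
  calc _ ≤ X.bd⁻¹ ^ 3 * X.size q := by gcongr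
    _ ≤ _ := X.size_concat_ge h.1

theorem IsStop.eq_of_prefix {r : ℝ} {p q : List (Fin m ⊕ Fin m)} (hp : X.IsStop r p)
    (hq : X.IsStop r q) (h : p <+: q) : p = q := by
  by_contra hne
  have := hq.2.2 p h hne
  linarith [hp.2.1]

variable (X)

/-- Each point of `Λ` lies in the interval of a stopping word, since sizes tend to zero along its
codes. -/
theorem exists_stop_of_mem_limitSet (hm : 2 ≤ m) {x : ℝ} (hx : x ∈ X.limitSet) {r : ℝ}
    (hr : 0 < r) (hr1 : r < 1) : ∃ p, X.IsStop r p ∧ x ∈ X.wordInterval p := by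
  obtain ⟨C, θ, hC, hθ0, hθ1, H⟩ := X.exists_size_le_pow hm
  obtain ⟨n, hn⟩ := exists_pow_lt_of_lt_one (show 0 < r / C by positivity) hθ1
  obtain ⟨w, h1, h2, h3⟩ := X.exists_word_of_mem_limitSet hx (n := n + 1) (by omega)
  have hw : X.size w ≤ r := by
    refine (H w h1).trans ?_
    rw [h2, pow_succ]
    rw [lt_div_iff₀ (by linarith)] at hn
    have : 0 < θ ^ n := by positivity
    nlinarith
  obtain ⟨p, hp, hs⟩ := X.exists_stop_prefix h1 hw
  exact ⟨p, hs, X.wordInterval_subset_of_prefix h1 hp (hs.ne_nil hr1) h3⟩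

/-- A stopping word at scale `M³ r` codes all points of `Λ` within distance `r` of a point that it
codes. -/
theorem mem_wordInterval_of_near {x y r : ℝ} {p : List (Fin m ⊕ Fin m)}
    (hy : y ∈ X.limitSet) (hr1 : X.bd ^ 3 * r < 1)
    (hp : X.IsStop (X.bd ^ 3 * r) p) (hxp : x ∈ X.wordInterval p) (hxy : |x - y| ≤ r) :
    y ∈ X.wordInterval p := by
  have hp0 := hp.ne_nil hr1
  have hl : 1 ≤ p.length := List.length_pos_iff.mpr hp0
  obtain ⟨w, h1, h2, h3⟩ := X.exists_word_of_mem_limitSet hy hl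
  rcases X.prefix_or_of_near hp.1 h1 hxp h3 (r := r)
    (by rwa [← Complex.ofReal_sub, Complex.norm_real]) List.prefix_rfl hp.2.2 with h | h
  · exact X.wordInterval_subset_of_prefix h1 h hp0 h3
  · exact (h.eq_of_length_le (by omega)) ▸ h3

end SchottkyData

/-! ### Poincaré series and counting -/

/-- A finite sum is at most a sum of non-negative terms over a set that covers its index set and
dominates its terms. -/
theorem sum_le_sum_of_cover {ι κ : Type*} {F : Finset ι} {G : Finset κ} {f : ι → ℝ} {g : κ → ℝ}
    (e : κ → ι) (hg : ∀ k ∈ G, 0 ≤ g k) (h : ∀ i ∈ F, ∃ k ∈ G, e k = i ∧ f i ≤ g k) :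
    ∑ i ∈ F, f i ≤ ∑ k ∈ G, g k := by
  classical
  by_cases hF : F.Nonempty
  swap
  · rw [Finset.not_nonempty_iff_eq_empty.mp hF, Finset.sum_empty]
    exact Finset.sum_nonneg hg
  obtain ⟨i₀, hi₀⟩ := hF
  have hex : ∀ i, ∃ k, i ∈ F → k ∈ G ∧ e k = i ∧ f i ≤ g k := by
    intro i
    by_cases hi : i ∈ F
    · obtain ⟨k, h1, h2⟩ := h i hi
      exact ⟨k, fun _ => ⟨h1, h2⟩⟩
    · exact ⟨(h i₀ hi₀).choose, fun h => absurd h hi⟩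
  choose c hc using hex
  have hinj : Set.InjOn c F := by
    intro i hi j hj hij
    rw [← (hc i hi).2.1, ← (hc j hj).2.1, hij]
  calc ∑ i ∈ F, f i ≤ ∑ i ∈ F, g (c i) := Finset.sum_le_sum fun i hi => (hc i hi).2.2
    _ = ∑ k ∈ F.image c, g k := (Finset.sum_image hinj).symm
    _ ≤ ∑ k ∈ G, g k := by
      refine Finset.sum_le_sum_of_subset_of_nonneg ?_ fun k hk _ => hg k hk
      intro k hk
      obtain ⟨i, hi, rfl⟩ := Finset.mem_image.mp hk
      exact (hc i hi).1

namespace SchottkyData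

variable {m : ℕ} (X : SchottkyData m)

theorem delta_nonneg : 0 ≤ X.delta := ENNReal.toReal_nonneg

theorem dimH_limitSet_le_one : dimH X.limitSet ≤ 1 :=
  (dimH_mono (Set.subset_univ _)).trans Real.dimH_univ.le

theorem delta_le_one : X.delta ≤ 1 := by
  have := ENNReal.toReal_mono ENNReal.one_ne_top X.dimH_limitSet_le_one
  simpa [delta] using this

theorem hausdorffMeasure_limitSet {s : ℝ} (hs : X.delta < s) :
    Measure.hausdorffMeasure s X.limitSet = 0 := by
  have hs0 : 0 ≤ s := X.delta_nonneg.trans hs.le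
  have h : dimH X.limitSet < (s.toNNReal : ℝ≥0∞) := by
    have : dimH X.limitSet ≠ ∞ := (X.dimH_limitSet_le_one.trans_lt ENNReal.one_lt_top).ne
    exact (ENNReal.lt_ofReal_iff_toReal_lt this).mpr hs
  have := hausdorffMeasure_of_dimH_lt h
  rwa [Real.coe_toNNReal s hs0] at this

/-- For `s > δ` the `s`-dimensional Hausdorff measure of `Λ` vanishes. Each set of an efficient
cover of `Λ` is replaced by the interval of a stopping word at the scale of its diameter, and
compactness leaves finitely many of these. -/
theorem exists_cover (hm : 2 ≤ m) {s : ℝ} (hs : X.delta < s) {η : ℝ} (hη : 0 < η) :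
    ∃ W : Finset (List (Fin m ⊕ Fin m)), (∀ w ∈ W, IsReduced w ∧ w ≠ []) ∧
      X.limitSet ⊆ ⋃ w ∈ W, X.wordInterval w ∧ ∑ w ∈ W, X.size w ^ s ≤ η := by
  classical
  have hs0 : 0 < s := X.delta_nonneg.trans_lt hs
  have hM := X.bd_pos
  set K : ℝ := (X.bd ^ 3) ^ s with hK
  have hK0 : 0 < K := by positivity
  set ε : ℝ := min (η / (2 * K)) (1 / (4 * K)) with hε
  have hε0 : 0 < ε := by positivity
  have hε1 : 2 * K * ε ≤ η := by
    calc 2 * K * ε ≤ 2 * K * (η / (2 * K)) := by gcongr; exact min_le_left _ _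
      _ = η := by field_simp
  have hε2 : 2 * K * ε < 1 := by
    calc 2 * K * ε ≤ 2 * K * (1 / (4 * K)) := by gcongr; exact min_le_right _ _
      _ = 1 / 2 := by field_simp; norm_num
      _ < 1 := by norm_num
  have h0 := X.hausdorffMeasure_limitSet hs
  rw [Measure.hausdorffMeasure_apply] at h0
  have h1 : (⨅ (t : ℕ → Set ℝ) (_ : X.limitSet ⊆ ⋃ n, t n) (_ : ∀ n, Metric.ediam (t n) ≤ 1),
      ∑' n, ⨆ _ : (t n).Nonempty, Metric.ediam (t n) ^ s) < ENNReal.ofReal ε := by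
    refine lt_of_le_of_lt ?_ (ENNReal.ofReal_pos.mpr hε0)
    rw [← h0]
    exact le_iSup₂_of_le (1 : ℝ≥0∞) one_pos le_rfl
  simp only [iInf_lt_iff] at h1
  obtain ⟨t, ht, htd, hsum⟩ := h1
  -- Only the members of the cover that meet `Λ` are needed.
  let N := {n : ℕ // (t n ∩ X.limitSet).Nonempty}
  choose x hx using fun n : N => n.2
  set d : N → ℝ := fun n => (Metric.ediam (t n)).toReal with hd
  have hdtop : ∀ n : N, Metric.ediam (t n) ≠ ∞ := fun n =>
    ((htd n).trans_lt ENNReal.one_lt_top).ne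
  have hdsum : ∀ G : Finset N, ∑ n ∈ G, d n ^ s ≤ ε := by
    intro G
    have h2 : ∑ n ∈ G, Metric.ediam (t n) ^ s ≤ ENNReal.ofReal ε := by
      refine le_trans ?_ hsum.le
      calc ∑ n ∈ G, Metric.ediam (t n) ^ s
          ≤ ∑ n ∈ G, ⨆ _ : (t n).Nonempty, Metric.ediam (t n) ^ s := by
            refine Finset.sum_le_sum fun n _ => ?_
            exact le_iSup_of_le ⟨x n, (hx n).1⟩ le_rfl
        _ = ∑ n ∈ G.map (Function.Embedding.subtype _),
              ⨆ _ : (t n).Nonempty, Metric.ediam (t n) ^ s := by rw [Finset.sum_map]; rfl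
        _ ≤ _ := ENNReal.sum_le_tsum _
    have h3 := ENNReal.toReal_mono ENNReal.ofReal_ne_top h2
    rw [ENNReal.toReal_ofReal hε0.le, ENNReal.toReal_sum] at h3
    · simpa only [← ENNReal.toReal_rpow] using h3
    · intro n _
      exact ENNReal.rpow_ne_top_of_nonneg hs0.le (hdtop n)
  -- The scale `r n` exceeds the diameter `d n` by little, so as to be positive, while the sum of
  -- the numbers `r n ^ s` stays small.
  set r : N → ℝ := fun n => (d n ^ s + ε * (1 / 2) ^ ((n : ℕ) + 1)) ^ (1 / s) with hr
  have hd0 : ∀ n, 0 ≤ d n := fun n => ENNReal.toReal_nonneg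
  have hrpos : ∀ n, 0 < r n := fun n => by
    have := hd0 n
    simp only [hr]; positivity
  have hrs : ∀ n, r n ^ s = d n ^ s + ε * (1 / 2) ^ ((n : ℕ) + 1) := by
    intro n
    have := hd0 n
    simp only [hr]
    rw [← Real.rpow_mul (by positivity), one_div_mul_cancel hs0.ne', Real.rpow_one]
  have hdr : ∀ n, d n ≤ r n := by
    intro n
    have h2 : d n ^ s ≤ r n ^ s := by
      rw [hrs]; have : 0 < ε * (1 / 2) ^ ((n : ℕ) + 1) := by positivity
      linarith
    exact (Real.rpow_le_rpow_iff (hd0 n) (hrpos n).le hs0).mp h2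
  have hrlt : ∀ n, X.bd ^ 3 * r n < 1 := by
    intro n
    have h2 : (X.bd ^ 3 * r n) ^ s < 1 := by
      rw [Real.mul_rpow (by positivity) (hrpos n).le, hrs]
      have h3 := hdsum {n}
      rw [Finset.sum_singleton] at h3
      have h4 : ((1 : ℝ) / 2) ^ ((n : ℕ) + 1) ≤ 1 := pow_le_one₀ (by norm_num) (by norm_num)
      refine lt_of_le_of_lt ?_ hε2
      have h5 : d n ^ s + ε * (1 / 2) ^ ((n : ℕ) + 1) ≤ 2 * ε := by nlinarith
      calc _ ≤ K * (2 * ε) := by gcongr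
        _ = _ := by ring
    by_contra hc
    exact absurd h2 (not_lt.mpr (Real.one_le_rpow (not_lt.mp hc) hs0.le))
  choose p hp hxp using fun n : N =>
    X.exists_stop_of_mem_limitSet hm (hx n).2 (mul_pos (pow_pos hM 3) (hrpos n)) (hrlt n)
  have hcov : ∀ n : N, t n ∩ X.limitSet ⊆ X.wordInterval (p n) := by
    rintro n y ⟨hy1, hy2⟩
    refine X.mem_wordInterval_of_near hy2 (hrlt n) (hp n) (hxp n) (le_trans ?_ (hdr n))
    have h2 := ENNReal.toReal_mono (hdtop n) (Metric.edist_le_ediam_of_mem (hx n).1 hy1)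
    rwa [edist_dist, ENNReal.toReal_ofReal dist_nonneg, Real.dist_eq] at h2
  obtain ⟨G, hG⟩ := X.isCompact_limitSet.elim_finite_subcover
    (fun n : N => X.wordInterval (p n)) (fun n => X.isOpen_wordInterval (hp n).1) (by
      intro y hy
      obtain ⟨n, hn⟩ := Set.mem_iUnion.mp (ht hy)
      exact Set.mem_iUnion.mpr ⟨⟨n, y, hn, hy⟩, hcov _ ⟨hn, hy⟩⟩)
  refine ⟨G.image p, ?_, ?_, ?_⟩
  · intro w hw
    obtain ⟨n, -, rfl⟩ := Finset.mem_image.mp hw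
    exact ⟨(hp n).1, (hp n).ne_nil (hrlt n)⟩
  · simpa using hG
  · have hgeo : ∀ G : Finset N, ∑ n ∈ G, ε * (1 / 2 : ℝ) ^ ((n : ℕ) + 1) ≤ ε := by
      intro G
      have : ∑ n ∈ G, (1 / 2 : ℝ) ^ ((n : ℕ) + 1) ≤ 1 := by
        calc ∑ n ∈ G, (1 / 2 : ℝ) ^ ((n : ℕ) + 1)
            = ∑ n ∈ G.map (Function.Embedding.subtype _), (1 / 2 : ℝ) ^ (n + 1) := by
              rw [Finset.sum_map]; rfl
          _ ≤ ∑' n : ℕ, (1 / 2 : ℝ) ^ (n + 1) := by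
              refine Summable.sum_le_tsum _ (fun n _ => by positivity) ?_
              simp_rw [pow_succ]
              exact summable_geometric_two.mul_right _
          _ = 1 := by
              simp_rw [pow_succ]
              rw [tsum_mul_right, tsum_geometric_two]; norm_num
      rw [← Finset.mul_sum]
      nlinarith
    calc ∑ w ∈ G.image p, X.size w ^ s ≤ ∑ n ∈ G, X.size (p n) ^ s := by
          refine sum_le_sum_of_cover p ?_ ?_
          · intro n _
            have := X.size_pos (hp n).1
            positivity
          · intro w hw
            obtain ⟨n, hn, rfl⟩ := Finset.mem_image.mp hw
            exact ⟨n, hn, rfl, le_rfl⟩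
      _ ≤ ∑ n ∈ G, K * (d n ^ s + ε * (1 / 2 : ℝ) ^ ((n : ℕ) + 1)) := by
          refine Finset.sum_le_sum fun n _ => ?_
          rw [← hrs, hK, ← Real.mul_rpow (by positivity) (hrpos n).le]
          exact Real.rpow_le_rpow (X.size_pos (hp n).1).le (hp n).2.1 hs0.le
      _ = K * (∑ n ∈ G, d n ^ s + ∑ n ∈ G, ε * (1 / 2 : ℝ) ^ ((n : ℕ) + 1)) := by
          rw [← Finset.mul_sum, Finset.sum_add_distrib]
      _ ≤ K * (ε + ε) := by
          gcongr
          · exact hdsum G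
          · exact hgeo G
      _ ≤ η := by linarith

/-- The Poincaré series converges for exponents `s > δ`. Let `W` be a finite set of words whose
intervals cover `Λ`. A long word is `w u` with `w ∈ W`, so that by multiplicativity the part of the
sum over the long words is at most half of the whole sum, if `∑ size w ^ s` over `W` is small. -/
theorem exists_poincare_bound (hm : 2 ≤ m) {s : ℝ} (hs : X.delta < s) :
    ∃ C : ℝ, 1 ≤ C ∧ ∀ F : Finset (List (Fin m ⊕ Fin m)), (∀ w ∈ F, IsReduced w) →
      ∑ w ∈ F, X.size w ^ s ≤ C := by
  classical
  have hs0 : 0 < s := X.delta_nonneg.trans_lt hs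
  have hM := X.bd_pos
  set K : ℝ := (X.bd ^ 2) ^ s with hK
  have hK0 : 0 < K := by positivity
  obtain ⟨W, hW, hcov, hsum⟩ := X.exists_cover hm hs (η := 1 / (2 * K)) (by positivity)
  set S : ℕ → Finset (List (Fin m ⊕ Fin m)) := fun n =>
    (List.finite_length_le (Fin m ⊕ Fin m) n).toFinset.filter IsReduced with hS
  have memS : ∀ n w, w ∈ S n ↔ w.length ≤ n ∧ IsReduced w := by
    intro n w; simp [hS]
  obtain ⟨N, hN⟩ : ∃ N, ∀ w ∈ W, w.length ≤ N := by
    exact ⟨W.sup List.length, fun w hw => Finset.le_sup (f := List.length) hw⟩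
  have hpos : ∀ n, ∀ w ∈ S n, 0 ≤ X.size w ^ s := fun n w hw =>
    Real.rpow_nonneg (X.size_pos ((memS n w).mp hw).2).le _
  set f : ℕ → ℝ := fun n => ∑ w ∈ S n, X.size w ^ s with hf
  have hfn : ∀ n, 0 ≤ f n := fun n => Finset.sum_nonneg (hpos n)
  have key : ∀ n, f n ≤ 2 * f N := by
    intro n
    -- A word longer than all words of `W` has a prefix in `W`: its interval contains a point of
    -- `Λ`.
    have h1 : ∑ v ∈ (S n).filter (fun v => ¬ v.length ≤ N), X.size v ^ s ≤ (1 / 2) * f n := by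
      calc _ ≤ ∑ q ∈ W ×ˢ S n, K * (X.size q.1 ^ s * X.size q.2 ^ s) := by
            refine sum_le_sum_of_cover (fun q => q.1 ++ q.2) ?_ ?_
            · intro q hq
              obtain ⟨h1, h2⟩ := Finset.mem_product.mp hq
              have := X.size_pos (hW _ h1).1
              have := hpos n _ h2
              positivity
            · intro v hv
              obtain ⟨hv1, hv2⟩ := Finset.mem_filter.mp hv
              obtain ⟨hv3, hv4⟩ := (memS n v).mp hv1
              obtain ⟨x, hx, hxv⟩ := X.exists_mem_limitSet hv4
                (by rintro rfl; simp at hv2)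
              obtain ⟨w, hw, hxw⟩ := Set.mem_iUnion₂.mp (hcov hx)
              rcases X.prefix_or_of_mem_wordDisk (hW w hw).1 hv4 hxw hxv with h | h
              · obtain ⟨u, rfl⟩ := h
                have hur := (isReduced_append.mp hv4).2.1
                refine ⟨(w, u), Finset.mem_product.mpr ⟨hw, (memS n u).mpr ⟨?_, hur⟩⟩, rfl, ?_⟩
                · simp at hv3; omega
                · have p1 := X.size_pos (hW w hw).1
                  have p2 := X.size_pos hur
                  calc _ ≤ (X.bd ^ 2 * (X.size w * X.size u)) ^ s :=
                        Real.rpow_le_rpow (X.size_pos hv4).le (X.size_append hv4).2 hs0.le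
                    _ = _ := by
                        rw [Real.mul_rpow (by positivity) (by positivity),
                          Real.mul_rpow p1.le p2.le]
              · have := h.length_le
                have := hN w hw
                omega
        _ = K * ((∑ w ∈ W, X.size w ^ s) * f n) := by
            rw [← Finset.mul_sum, Finset.sum_product, Finset.sum_mul_sum]
        _ ≤ K * ((1 / (2 * K)) * f n) := by
            gcongr
            exact hfn n
        _ = (1 / 2) * f n := by field_simp
    have h2 : ∑ v ∈ (S n).filter (fun v => v.length ≤ N), X.size v ^ s ≤ f N := by
      refine Finset.sum_le_sum_of_subset_of_nonneg ?_ fun w hw _ => hpos N w hw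
      intro v hv
      obtain ⟨hv1, hv2⟩ := Finset.mem_filter.mp hv
      exact (memS N v).mpr ⟨hv2, ((memS n v).mp hv1).2⟩
    have h3 := Finset.sum_filter_add_sum_filter_not (S n) (fun v => v.length ≤ N)
      (fun v => X.size v ^ s)
    change _ = f n at h3
    linarith
  refine ⟨max 1 (2 * f N), le_max_left _ _, fun F hF => ?_⟩
  refine le_trans ?_ ((key (F.sup List.length)).trans (le_max_right _ _))
  refine Finset.sum_le_sum_of_subset_of_nonneg ?_ fun w hw _ => hpos _ w hw
  intro w hw
  exact (memS _ w).mpr ⟨Finset.le_sup (f := List.length) hw, hF w hw⟩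

theorem size_ge_pow {w : List (Fin m ⊕ Fin m)} (hw : IsReduced w) :
    (X.bd⁻¹ ^ 3) ^ w.length ≤ X.size w := by
  have := X.bd_pos
  induction w using List.reverseRecOn with
  | nil => simp [size_nil]
  | append_singleton u a ih =>
    refine le_trans ?_ (X.size_concat_ge hw)
    rw [List.length_append, List.length_singleton, pow_succ, mul_comm]
    gcongr
    exact ih (isReduced_append.mp hw).1

theorem isReduced_map_inl (l : List (Fin m)) : IsReduced (l.map Sum.inl) := by
  induction l with
  | nil => simp [IsReduced]
  | cons a l ih =>
    rw [List.map_cons, isReduced_cons]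
    refine ⟨fun b hb => ?_, ih⟩
    cases l with
    | nil => simp at hb
    | cons c l =>
      simp only [List.map_cons, List.head?_cons, Option.mem_some_iff] at hb
      subst hb
      simp

/-- The limit set has positive dimension: the sizes of the `mⁿ` words in the letters `1, …, m` decay
at most exponentially, so that the Poincaré series diverges for small exponents. -/
theorem delta_pos (hm : 2 ≤ m) : 0 < X.delta := by
  classical
  by_contra hc
  have h0 : X.delta ≤ 0 := not_lt.mp hc
  have hM := X.bd_pos
  have hM1 := X.one_le_bd
  set L := Real.log (X.bd ^ 3) with hL
  have hL0 : 0 ≤ L := Real.log_nonneg (one_le_pow₀ hM1)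
  have hlog2 : 0 < Real.log 2 := Real.log_pos (by norm_num)
  set s := Real.log 2 / (L + 1) with hs
  have hs0 : 0 < s := by positivity
  obtain ⟨C, hC, H⟩ := X.exists_poincare_bound hm (h0.trans_lt hs0)
  set q : ℝ := X.bd⁻¹ ^ 3 with hq
  have hq0 : 0 < q := by positivity
  -- The exponent `s` is so small that the sum over the words of length `n`, at least `2 ^ n` of
  -- size at least `q ^ n`, is unbounded.
  have hqs : 1 < 2 * q ^ s := by
    have h1 : q ^ s = Real.exp (-(L * s)) := by
      rw [hq, inv_pow, Real.inv_rpow (by positivity), Real.rpow_def_of_pos (by positivity),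
        ← Real.exp_neg]
    have h2 : L * s < Real.log 2 := by
      rw [hs, ← mul_div_assoc, div_lt_iff₀ (by positivity)]
      nlinarith
    have h3 : Real.exp (-Real.log 2) < q ^ s := by
      rw [h1]; exact Real.exp_lt_exp.mpr (by linarith)
    rw [Real.exp_neg, Real.exp_log (by norm_num)] at h3
    linarith
  obtain ⟨n, hn⟩ := pow_unbounded_of_one_lt C hqs
  set e : (Fin n → Fin m) → List (Fin m ⊕ Fin m) := fun f => (List.ofFn f).map Sum.inl with he
  have hinj : Function.Injective e := by
    intro f g hfg
    exact List.ofFn_injective (List.map_injective_iff.mpr Sum.inl_injective hfg)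
  have h1 := H (Finset.univ.image e) (by
    intro w hw
    obtain ⟨f, -, rfl⟩ := Finset.mem_image.mp hw
    exact isReduced_map_inl _)
  rw [Finset.sum_image hinj.injOn] at h1
  have h2 : (2 * q ^ s) ^ n ≤ ∑ f : Fin n → Fin m, X.size (e f) ^ s := by
    calc (2 * q ^ s) ^ n ≤ ∑ f : Fin n → Fin m, (q ^ s) ^ n := by
          rw [Finset.sum_const, Finset.card_univ, Fintype.card_fun, Fintype.card_fin,
            Fintype.card_fin, nsmul_eq_mul, mul_pow]
          push_cast
          gcongr
          exact_mod_cast hm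
      _ ≤ _ := by
          refine Finset.sum_le_sum fun f _ => ?_
          rw [← Real.rpow_natCast, ← Real.rpow_mul hq0.le, mul_comm, Real.rpow_mul hq0.le,
            Real.rpow_natCast]
          refine Real.rpow_le_rpow (by positivity) ?_ hs0.le
          have := X.size_ge_pow (isReduced_map_inl (List.ofFn f))
          rwa [List.length_map, List.length_ofFn] at this
  linarith

/-- A bound for the number of words of size at least `r` that start with `v`. After removal of `v`,
such words have size at least about `r / size v`, and the Poincaré series counts them. -/
theorem exists_card_bound (hm : 2 ≤ m) {s : ℝ} (hs : X.delta < s) :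
    ∃ C : ℝ, 1 ≤ C ∧ ∀ (v : List (Fin m ⊕ Fin m)) (F : Finset (List (Fin m ⊕ Fin m))) (r : ℝ),
      IsReduced v → 0 < r → (∀ w ∈ F, IsReduced w ∧ v <+: w ∧ r ≤ X.size w) →
      (F.card : ℝ) ≤ C * (X.size v / r) ^ s := by
  classical
  have hs0 : 0 < s := X.delta_nonneg.trans_lt hs
  have hM := X.bd_pos
  obtain ⟨C, hC, H⟩ := X.exists_poincare_bound hm hs
  refine ⟨C * (X.bd ^ 2) ^ s, ?_, fun v F r hv hr hF => ?_⟩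
  · have : (1 : ℝ) ≤ (X.bd ^ 2) ^ s := Real.one_le_rpow (one_le_pow₀ X.one_le_bd) hs0.le
    nlinarith
  have pv := X.size_pos hv
  set K := X.bd ^ 2 * (X.size v / r) with hK
  have hK0 : 0 < K := by positivity
  have h1 : ∀ w ∈ F, IsReduced (w.drop v.length) ∧ 1 ≤ K * X.size (w.drop v.length) := by
    intro w hw
    obtain ⟨hwr, ⟨q, rfl⟩, hwr'⟩ := hF w hw
    rw [List.drop_left]
    refine ⟨(isReduced_append.mp hwr).2.1, ?_⟩
    have := hwr'.trans (X.size_append hwr).2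
    rw [hK]
    calc (1 : ℝ) = r / r := (div_self hr.ne').symm
      _ ≤ _ := div_le_div_of_nonneg_right this hr.le
      _ = _ := by ring
  have hinj : Set.InjOn (List.drop v.length) (F : Set (List (Fin m ⊕ Fin m))) := by
    intro w hw w' hw' h
    obtain ⟨-, ⟨q, rfl⟩, -⟩ := hF w hw
    obtain ⟨-, ⟨q', rfl⟩, -⟩ := hF w' hw'
    simp only [List.drop_left] at h
    rw [h]
  have h2 := H (F.image (List.drop v.length)) (by
    intro w hw
    obtain ⟨u, hu, rfl⟩ := Finset.mem_image.mp hw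
    exact (h1 u hu).1)
  rw [Finset.sum_image hinj] at h2
  calc (F.card : ℝ) = ∑ w ∈ F, (1 : ℝ) := by simp
    _ ≤ ∑ w ∈ F, K ^ s * X.size (w.drop v.length) ^ s := by
        refine Finset.sum_le_sum fun w hw => ?_
        rw [← Real.mul_rpow hK0.le (X.size_pos (h1 w hw).1).le]
        exact Real.one_le_rpow (h1 w hw).2 hs0.le
    _ = K ^ s * ∑ w ∈ F, X.size (w.drop v.length) ^ s := by rw [Finset.mul_sum]
    _ ≤ K ^ s * C := by gcongr
    _ = _ := by rw [hK, Real.mul_rpow (by positivity) (by positivity)]; ring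

/-- The sizes of the prefixes of a word have bounded moments of all positive orders. -/
theorem exists_prefix_sum_bound (hm : 2 ≤ m) {η : ℝ} (hη : 0 < η) :
    ∃ C : ℝ, 1 ≤ C ∧ ∀ w : List (Fin m ⊕ Fin m), IsReduced w →
      ∑ n ∈ Finset.range (w.length + 1), X.size (w.take n) ^ η ≤ C := by
  obtain ⟨C, θ, hC, hθ0, hθ1, H⟩ := X.exists_size_le_pow hm
  have ht1 : θ ^ η < 1 := Real.rpow_lt_one hθ0.le hθ1 hη
  have ht0 : 0 < θ ^ η := Real.rpow_pos_of_pos hθ0 _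
  have hC1 : (1 : ℝ) ≤ C ^ η := Real.one_le_rpow hC hη.le
  refine ⟨C ^ η * (1 - θ ^ η)⁻¹, ?_, fun w hw => ?_⟩
  · have : (1 : ℝ) ≤ (1 - θ ^ η)⁻¹ := (one_le_inv₀ (by linarith)).mpr (by linarith)
    nlinarith
  calc _ ≤ ∑ n ∈ Finset.range (w.length + 1), C ^ η * (θ ^ η) ^ n := by
        refine Finset.sum_le_sum fun n hn => ?_
        have hr := hw.prefix (List.take_prefix n w)
        have hl : (w.take n).length = n := by
          simp at hn ⊢; omega
        have := H _ hr
        rw [hl] at this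
        calc _ ≤ (C * θ ^ n) ^ η := Real.rpow_le_rpow (X.size_pos hr).le this hη.le
          _ = _ := by
            rw [Real.mul_rpow (by linarith) (by positivity), ← Real.rpow_natCast,
              ← Real.rpow_natCast, ← Real.rpow_mul hθ0.le, ← Real.rpow_mul hθ0.le, mul_comm η]
    _ = C ^ η * ∑ n ∈ Finset.range (w.length + 1), (θ ^ η) ^ n := by rw [Finset.mul_sum]
    _ ≤ C ^ η * ∑' n : ℕ, (θ ^ η) ^ n := by
        gcongr
        exact (summable_geometric_of_lt_one ht0.le ht1).sum_le_tsum _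
          (fun n _ => by positivity)
    _ = _ := by rw [tsum_geometric_of_lt_one ht0.le ht1]

theorem exists_size_le (hm : 2 ≤ m) : ∃ C : ℝ, 1 ≤ C ∧ ∀ w : List (Fin m ⊕ Fin m),
    IsReduced w → X.size w ≤ C := by
  obtain ⟨C, θ, hC, hθ0, hθ1, H⟩ := X.exists_size_le_pow hm
  refine ⟨C, hC, fun w hw => (H w hw).trans ?_⟩
  have : θ ^ w.length ≤ 1 := pow_le_one₀ hθ0.le hθ1.le
  nlinarith

/-- The length of a word is at most a small negative power of its size: each of the `length + 1`
prefixes has size at least a constant times the size of the word, and the moments of the sizes of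
the prefixes are bounded. -/
theorem exists_length_bound (hm : 2 ≤ m) {η : ℝ} (hη : 0 < η) :
    ∃ C : ℝ, 1 ≤ C ∧ ∀ w : List (Fin m ⊕ Fin m), IsReduced w →
      (w.length + 1 : ℝ) ≤ C * X.size w ^ (-η) := by
  obtain ⟨C, hC, H⟩ := X.exists_prefix_sum_bound hm hη
  obtain ⟨B, hB, HB⟩ := X.exists_size_le hm
  have hM1 : 1 ≤ X.bd ^ 2 * B := by
    have := one_le_pow₀ X.one_le_bd (n := 2)
    nlinarith
  have hM := X.bd_pos
  have hB0 : 0 < B := by linarith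
  refine ⟨C * (X.bd ^ 2 * B) ^ η, ?_, fun w hw => ?_⟩
  · have := Real.one_le_rpow hM1 hη.le
    nlinarith
  have pw := X.size_pos hw
  have h1 : ∀ n ∈ Finset.range (w.length + 1),
      (X.size w / (X.bd ^ 2 * B)) ^ η ≤ X.size (w.take n) ^ η := by
    intro n _
    refine Real.rpow_le_rpow (by positivity) ?_ hη.le
    rw [div_le_iff₀ (by positivity)]
    have h2 : IsReduced (w.take n ++ w.drop n) := by rwa [List.take_append_drop]
    have h3 := (X.size_append h2).2
    rw [List.take_append_drop] at h3
    have h4 := HB _ (isReduced_append.mp h2).2.1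
    have h5 := X.size_pos (isReduced_append.mp h2).1
    calc _ ≤ _ := h3
      _ ≤ X.bd ^ 2 * (X.size (w.take n) * B) := by gcongr
      _ = _ := by ring
  have h2 := (Finset.sum_le_sum h1).trans (H w hw)
  rw [Finset.sum_const, Finset.card_range, nsmul_eq_mul,
    Real.div_rpow pw.le (by positivity)] at h2
  push_cast at h2
  rw [Real.rpow_neg pw.le, ← div_eq_mul_inv, le_div_iff₀ (by positivity)]
  rw [← mul_div_assoc, div_le_iff₀ (by positivity)] at h2
  exact h2

/-- The energy estimate: a sum over words `u` of negative powers of the size of the common prefix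
of `u` with a fixed word `ω`. The exponent `β` being less than `s`, the sum is
dominated by the words whose common prefix with `ω` is short. -/
theorem exists_energy_bound (hm : 2 ≤ m) {s β : ℝ} (hs : X.delta < s) (hβ : β < s) :
    ∃ C : ℝ, 1 ≤ C ∧ ∀ (ω : List (Fin m ⊕ Fin m)) (F : Finset (List (Fin m ⊕ Fin m))) (r : ℝ)
      (g : List (Fin m ⊕ Fin m) → ℝ), IsReduced ω → 0 < r →
      (∀ u ∈ F, IsReduced u ∧ r ≤ X.size u ∧ ∃ w a b p q, a ≠ b ∧ u = w ++ a :: p ∧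
        ω = w ++ b :: q ∧ g u ≤ X.size w ^ (-β)) →
      ∑ u ∈ F, g u ≤ C * r ^ (-s) := by
  classical
  obtain ⟨C₁, hC₁, H₁⟩ := X.exists_card_bound hm hs
  obtain ⟨C₂, hC₂, H₂⟩ := X.exists_prefix_sum_bound hm (sub_pos.mpr hβ)
  refine ⟨C₁ * C₂, by nlinarith, fun ω F r g hω hr hF => ?_⟩
  have hpre : ∀ n, IsReduced (ω.take n) := fun n => hω.prefix (List.take_prefix n ω)
  have hpos : ∀ n, 0 < X.size (ω.take n) := fun n => X.size_pos (hpre n)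
  -- The words `u` are grouped by their common prefix with `ω`, the first `n` letters of `ω`.
  calc ∑ u ∈ F, g u
      ≤ ∑ q ∈ (Finset.range (ω.length + 1)).sigma (fun n => F.filter (fun u => ω.take n <+: u)),
          X.size (ω.take q.1) ^ (-β) := by
        refine sum_le_sum_of_cover (fun q => q.2) ?_ ?_
        · intro q _
          exact Real.rpow_nonneg (hpos _).le _
        · intro u hu
          obtain ⟨hur, hru, w, a, b, p, q, hab, rfl, rfl, hg⟩ := hF u hu
          refine ⟨⟨w.length, w ++ a :: p⟩, ?_, rfl, ?_⟩
          · simp only [Finset.mem_sigma, Finset.mem_range, Finset.mem_filter, List.take_left]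
            refine ⟨by simp, hu, List.prefix_append _ _⟩
          · simpa using hg
    _ = ∑ n ∈ Finset.range (ω.length + 1),
          ((F.filter (fun u => ω.take n <+: u)).card : ℝ) * X.size (ω.take n) ^ (-β) := by
        rw [Finset.sum_sigma]
        simp
    _ ≤ ∑ n ∈ Finset.range (ω.length + 1),
          (C₁ * (X.size (ω.take n) / r) ^ s) * X.size (ω.take n) ^ (-β) := by
        refine Finset.sum_le_sum fun n _ => ?_
        have := (hpos n).le
        gcongr
        refine H₁ _ _ _ (hpre n) hr fun w hw => ?_
        obtain ⟨h1, h2⟩ := Finset.mem_filter.mp hw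
        exact ⟨(hF w h1).1, h2, (hF w h1).2.1⟩
    _ = C₁ * r ^ (-s) * ∑ n ∈ Finset.range (ω.length + 1), X.size (ω.take n) ^ (s - β) := by
        rw [Finset.mul_sum]
        refine Finset.sum_congr rfl fun n _ => ?_
        rw [Real.div_rpow (hpos n).le hr.le, sub_eq_add_neg, Real.rpow_add (hpos n),
          Real.rpow_neg hr.le]
        ring
    _ ≤ C₁ * r ^ (-s) * C₂ := by
        gcongr
        exact H₂ ω hω
    _ = _ := by ring

end SchottkyData

namespace SchottkyData

variable {m : ℕ} (X : SchottkyData m)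

/-! ### Sums over pieces and over pairs of words -/

theorem abs_sub_one_div_le_abs_log {R B : ℝ} (hR : 0 < R) (hB : 1 ≤ B) (hRB : R ≤ B) :
    |R - 1| / B ≤ |Real.log R| := by
  have hB0 : 0 < B := by linarith
  rw [div_le_iff₀ hB0]
  rcases le_total 1 R with h | h
  · rw [abs_of_nonneg (by linarith), abs_of_nonneg (Real.log_nonneg h)]
    have h1 := Real.one_sub_inv_le_log_of_pos hR
    have h2 := Real.log_nonneg h
    have h3 : R * (1 - R⁻¹) = R - 1 := by field_simp
    nlinarith
  · rw [abs_of_nonpos (by linarith), abs_of_nonpos (Real.log_nonpos hR.le h)]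
    have h1 := Real.log_le_sub_one_of_pos hR
    nlinarith

/-- A real point `Q` outside the closed disk of `d` is on the same side of all real points of the
disk. -/
theorem mul_sub_pos_of_convex {d : Fin m ⊕ Fin m} {Q x x' : ℝ}
    (hQ : ∀ z ∈ X.closedDisk d, X.bd⁻¹ ≤ ‖z - Q‖ ∧ ‖z - Q‖ ≤ X.bd)
    (hx : (x : ℂ) ∈ X.disk d) (hx' : (x' : ℂ) ∈ X.disk d) : 0 < (x - Q) * (x' - Q) := by
  by_contra hc
  have hmem : (Q : ℂ) ∈ X.closedDisk d := by
    rw [disk, Metric.mem_ball, Complex.dist_of_im_eq (by simp), Real.dist_eq] at hx hx'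
    rw [closedDisk, Metric.mem_closedBall, Complex.dist_of_im_eq (by simp), Real.dist_eq]
    simp only [Complex.ofReal_re] at *
    rw [abs_lt] at hx hx'
    rw [abs_le]
    rcases mul_nonpos_iff.mp (not_lt.mp hc) with ⟨h1, h2⟩ | ⟨h1, h2⟩
    · constructor <;> linarith
    · constructor <;> linarith
  have := (hQ _ hmem).1
  rw [sub_self, norm_zero] at this
  exact absurd this (not_le.mpr (inv_pos.mpr X.bd_pos))

/-- The difference of the logarithms of two derivatives with poles `Q` and `Q'` varies on a disk at
speed at least `|Q - Q'|`, up to a constant: a cross ratio computation. -/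
theorem log_dist_sub_log_dist {d : Fin m ⊕ Fin m} {Q Q' x x' : ℝ}
    (hQ : ∀ z ∈ X.closedDisk d, X.bd⁻¹ ≤ ‖z - Q‖ ∧ ‖z - Q‖ ≤ X.bd)
    (hQ' : ∀ z ∈ X.closedDisk d, X.bd⁻¹ ≤ ‖z - Q'‖ ∧ ‖z - Q'‖ ≤ X.bd)
    (hx : (x : ℂ) ∈ X.disk d) (hx' : (x' : ℂ) ∈ X.disk d) :
    X.bd⁻¹ ^ 6 * (|x - x'| * |Q - Q'|) ≤
      |(Real.log |x - Q'| - Real.log |x - Q|) - (Real.log |x' - Q'| - Real.log |x' - Q|)| := by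
  have hM := X.bd_pos
  have hM1 := X.one_le_bd
  have p1 := X.mul_sub_pos_of_convex hQ hx hx'
  have p2 := X.mul_sub_pos_of_convex hQ' hx hx'
  have red : ∀ {q y : ℝ}, (∀ z ∈ X.closedDisk d, X.bd⁻¹ ≤ ‖z - (q : ℂ)‖ ∧ ‖z - (q : ℂ)‖ ≤ X.bd) →
      (y : ℂ) ∈ X.disk d → X.bd⁻¹ ≤ |y - q| ∧ |y - q| ≤ X.bd := by
    intro q y hq hy
    have := hq _ (X.disk_subset_closedDisk _ hy)
    rwa [← Complex.ofReal_sub, Complex.norm_real, Real.norm_eq_abs] at this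
  have b1 := red hQ hx
  have b2 := red hQ hx'
  have b3 := red hQ' hx
  have b4 := red hQ' hx'
  have hi : 0 < X.bd⁻¹ := inv_pos.mpr hM
  have n1 : x - Q ≠ 0 := abs_pos.mp (by linarith [b1.1])
  have n2 : x' - Q ≠ 0 := abs_pos.mp (by linarith [b2.1])
  have n3 : x - Q' ≠ 0 := abs_pos.mp (by linarith [b3.1])
  have n4 : x' - Q' ≠ 0 := abs_pos.mp (by linarith [b4.1])
  -- The logarithm in question is that of a cross ratio `R`, which is positive and bounded; the
  -- numerator of `R - 1` is the product of `x - x'` and `Q' - Q`.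
  set R := (x - Q') * (x' - Q) / ((x - Q) * (x' - Q')) with hR
  have hR0 : 0 < R := by
    have : R = ((x - Q) * (x' - Q)) * ((x - Q') * (x' - Q')) /
        ((x - Q) ^ 2 * (x' - Q') ^ 2) := by
      rw [hR]; field_simp
    rw [this]; positivity
  have hden : |(x - Q) * (x' - Q')| ≤ X.bd ^ 2 := by
    rw [abs_mul, sq]; exact mul_le_mul b1.2 b4.2 (abs_nonneg _) hM.le
  have hden' : X.bd⁻¹ ^ 2 ≤ |(x - Q) * (x' - Q')| := by
    rw [abs_mul, sq]; exact mul_le_mul b1.1 b4.1 hi.le (abs_nonneg _)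
  have hden0 : 0 < |(x - Q) * (x' - Q')| := abs_pos.mpr (mul_ne_zero n1 n4)
  have hlog : (Real.log |x - Q'| - Real.log |x - Q|) - (Real.log |x' - Q'| - Real.log |x' - Q|) =
      Real.log R := by
    rw [hR, Real.log_div (mul_ne_zero n3 n2) (mul_ne_zero n1 n4), Real.log_mul n3 n2,
      Real.log_mul n1 n4]
    simp only [Real.log_abs]
    ring
  have hRB : R ≤ X.bd ^ 4 := by
    rw [← abs_of_pos hR0, hR, abs_div, div_le_iff₀ hden0, abs_mul]
    calc |x - Q'| * |x' - Q| ≤ X.bd * X.bd := mul_le_mul b3.2 b2.2 (abs_nonneg _) hM.le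
      _ = X.bd ^ 4 * X.bd⁻¹ ^ 2 := by field_simp
      _ ≤ _ := by gcongr
  have hR1 : R - 1 = (x - x') * (Q' - Q) / ((x - Q) * (x' - Q')) := by
    rw [hR]; field_simp; ring
  rw [hlog]
  refine le_trans ?_ (abs_sub_one_div_le_abs_log hR0 (one_le_pow₀ hM1) hRB)
  rw [hR1, abs_div, abs_mul, abs_sub_comm Q' Q, le_div_iff₀ (by positivity), le_div_iff₀ hden0]
  calc _ ≤ X.bd⁻¹ ^ 6 * (|x - x'| * |Q - Q'|) * X.bd ^ 4 * X.bd ^ 2 := by gcongr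
    _ = _ := by field_simp

theorem inv_one_add_le_rpow_neg {β x : ℝ} (h0 : 0 ≤ β) (h1 : β ≤ 1) (hx : 0 < x) :
    (1 + x)⁻¹ ≤ x ^ (-β) := by
  rw [Real.rpow_neg hx.le]
  refine inv_anti₀ (by positivity) ?_
  rcases le_total x 1 with h | h
  · exact (Real.rpow_le_one hx.le h h0).trans (by linarith)
  · exact (Real.rpow_le_rpow_of_exponent_le h h1).trans (by rw [Real.rpow_one]; linarith)

/-- The average over the pieces of `Λ` at scale `T⁻¹` of the decay caused by the phase
`log |x - Q'| - log |x - Q|`. The phase is close to zero on few pieces, since it varies at speed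
`|Q - Q'|`. -/
theorem exists_phase_bound (hm : 2 ≤ m) {s : ℝ} (hs : X.delta < s) :
    ∃ C : ℝ, 1 ≤ C ∧ ∀ (T : ℝ) (d : Fin m ⊕ Fin m) (Q Q' k : ℝ)
      (F : Finset (List (Fin m ⊕ Fin m))) (x : List (Fin m ⊕ Fin m) → ℝ), 1 < T →
      (∀ z ∈ X.closedDisk d, X.bd⁻¹ ≤ ‖z - Q‖ ∧ ‖z - Q‖ ≤ X.bd) →
      (∀ z ∈ X.closedDisk d, X.bd⁻¹ ≤ ‖z - Q'‖ ∧ ‖z - Q'‖ ≤ X.bd) →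
      (∀ p ∈ F, X.IsStop T⁻¹ p ∧ x p ∈ X.wordInterval p ∧ (x p : ℂ) ∈ X.disk d) →
      (∑ p ∈ F, (1 + T * |2 * (Real.log |x p - Q'| - Real.log |x p - Q|) + k|)⁻¹ ≤ C * T ^ s) ∧
      (Q ≠ Q' → ∑ p ∈ F, (1 + T * |2 * (Real.log |x p - Q'| - Real.log |x p - Q|) + k|)⁻¹ ≤
        C * (T ^ (s - X.delta) * |Q - Q'| ^ (-X.delta))) := by
  classical
  have hδ0 := X.delta_nonneg
  have hδ1 := X.delta_le_one
  have hs0 : 0 < s := hδ0.trans_lt hs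
  have hM := X.bd_pos
  have hM1 := X.one_le_bd
  obtain ⟨C₁, hC₁, H₁⟩ := X.exists_card_bound hm hs
  obtain ⟨C₂, hC₂, H₂⟩ := X.exists_energy_bound hm hs hs
  set K : ℝ := (X.bd ^ 3) ^ s with hK
  have hK1 : 1 ≤ K := Real.one_le_rpow (one_le_pow₀ hM1) hs0.le
  set L : ℝ := (X.bd⁻¹ ^ 9) ^ (-X.delta) with hL
  have hL0 : 0 < L := by positivity
  set N : ℝ := (2 * X.bd) ^ X.delta with hN
  have hN0 : 0 < N := by positivity
  refine ⟨C₁ * K + (N + L * C₂ * K), ?_, fun T d Q Q' k F x hT hQ hQ' hF => ?_⟩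
  · have : 0 < L * C₂ * K := by positivity
    nlinarith
  have hT0 : 0 < T := by linarith
  have hTi : T⁻¹ < 1 := inv_lt_one_of_one_lt₀ hT
  have hsz : ∀ p ∈ F, X.bd⁻¹ ^ 3 * T⁻¹ ≤ X.size p := fun p hp => (hF p hp).1.size_ge hTi
  set g : List (Fin m ⊕ Fin m) → ℝ :=
    fun p => 2 * (Real.log |x p - Q'| - Real.log |x p - Q|) + k with hg
  have hr0 : 0 < X.bd⁻¹ ^ 3 * T⁻¹ := by positivity
  have hpow : ∀ e : ℝ, (X.bd⁻¹ ^ 3 * T⁻¹) ^ (-e) = (X.bd ^ 3) ^ e * T ^ e := by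
    intro e
    rw [← Real.mul_rpow (by positivity) hT0.le, Real.rpow_neg (by positivity),
      ← Real.inv_rpow (by positivity)]
    congr 1
    field_simp
  have hterm : ∀ p, (1 + T * |g p|)⁻¹ ≤ 1 := fun p =>
    inv_le_one_of_one_le₀ (by have := abs_nonneg (g p); nlinarith)
  have htriv : ∑ p ∈ F, (1 + T * |g p|)⁻¹ ≤ C₁ * K * T ^ s := by
    calc _ ≤ ∑ p ∈ F, (1 : ℝ) := Finset.sum_le_sum fun p _ => hterm p
      _ = F.card := by simp
      _ ≤ C₁ * (X.size [] / (X.bd⁻¹ ^ 3 * T⁻¹)) ^ s :=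
          H₁ [] F _ (by simp [IsReduced]) hr0 fun w hw => ⟨(hF w hw).1.1, List.nil_prefix, hsz w hw⟩
      _ = _ := by
          rw [size_nil, one_div, Real.inv_rpow hr0.le, ← Real.rpow_neg hr0.le, hpow, mul_assoc]
  have hTs : 0 < T ^ s := by positivity
  refine ⟨htriv.trans ?_, fun hne => ?_⟩
  · have : 0 < N + L * C₂ * K := by positivity
    nlinarith
  set r := |Q - Q'| with hr
  have hrpos : 0 < r := abs_pos.mpr (sub_ne_zero.mpr hne)
  have hrle : r ≤ 2 * X.bd := by
    have hc : (X.center d : ℂ) ∈ X.closedDisk d :=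
      Metric.mem_closedBall_self (X.radius_pos d).le
    have h1 := (hQ _ hc).2
    have h2 := (hQ' _ hc).2
    rw [← Complex.ofReal_sub, Complex.norm_real, Real.norm_eq_abs] at h1 h2
    have := abs_sub_le Q (X.center d) Q'
    rw [abs_sub_comm] at h1
    linarith
  have hT1 : 1 ≤ T ^ (s - X.delta) := Real.one_le_rpow hT.le (by linarith)
  have hone : 1 ≤ N * (T ^ (s - X.delta) * r ^ (-X.delta)) := by
    have h1 : 1 ≤ N * r ^ (-X.delta) := by
      rw [Real.rpow_neg hrpos.le, ← div_eq_mul_inv, le_div_iff₀ (by positivity), one_mul]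
      exact Real.rpow_le_rpow hrpos.le hrle hδ0
    nlinarith
  have hfin : 0 ≤ C₁ * K * (T ^ (s - X.delta) * r ^ (-X.delta)) := by positivity
  by_cases hFe : F.Nonempty
  swap
  · rw [Finset.not_nonempty_iff_eq_empty.mp hFe, Finset.sum_empty]
    positivity
  -- `P` is the piece on which the phase `g` is smallest. For another piece `u`, twice `|g u|`
  -- bounds `|g u - g P|`, which is at least the speed `r` times the distance of the two pieces, and
  -- that is at least the size of their common prefix. So the energy estimate with `ω = P` applies.
  obtain ⟨P, hP, hmin⟩ := F.exists_min_image (fun p => |g p|) hFe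
  have hmain : ∑ p ∈ F.erase P, (1 + T * |g p|)⁻¹ * (T * r * X.bd⁻¹ ^ 9) ^ X.delta ≤
      C₂ * (X.bd⁻¹ ^ 3 * T⁻¹) ^ (-s) := by
    refine H₂ P _ _ _ (hF P hP).1.1 hr0 fun u hu => ?_
    obtain ⟨huP, huF⟩ := Finset.mem_erase.mp hu
    obtain ⟨hus, hux, hud⟩ := hF u huF
    obtain ⟨hPs, hPx, hPd⟩ := hF P hP
    refine ⟨hus.1, hsz u huF, ?_⟩
    rcases list_trichotomy u P with h | h | ⟨w, a, b, p, q, hab, rfl, rfl⟩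
    · exact absurd (hus.eq_of_prefix hPs h) huP
    · exact absurd (hPs.eq_of_prefix hus h).symm huP
    refine ⟨w, a, b, p, q, hab, rfl, rfl, ?_⟩
    have hw := X.size_pos (isReduced_append.mp hus.1).1
    have h1 := X.log_dist_sub_log_dist hQ hQ' hud hPd
    have h2 := X.gap_wordDisk hab hus.1 hPs.1 hux hPx
    rw [← Complex.ofReal_sub, Complex.norm_real, Real.norm_eq_abs] at h2
    have h3 : X.bd⁻¹ ^ 9 * (X.size w * r) ≤ |g (w ++ a :: p)| := by
      have h4 := abs_sub (g (w ++ a :: p)) (g (w ++ b :: q))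
      have h5 := hmin _ huF
      have h6 : |g (w ++ a :: p) - g (w ++ b :: q)| = 2 *
          |(Real.log |x (w ++ a :: p) - Q'| - Real.log |x (w ++ a :: p) - Q|) -
            (Real.log |x (w ++ b :: q) - Q'| - Real.log |x (w ++ b :: q) - Q|)| := by
        have e2 : ∀ y : ℝ, 2 * |y| = |2 * y| := fun y => by rw [abs_mul, abs_two]
        rw [e2]
        congr 1
        simp only [hg]
        ring
      have h7 : X.bd⁻¹ ^ 9 * (X.size w * r) ≤
          X.bd⁻¹ ^ 6 * (|x (w ++ a :: p) - x (w ++ b :: q)| * r) := by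
        calc _ = X.bd⁻¹ ^ 6 * (X.bd⁻¹ ^ 3 * X.size w * r) := by ring
          _ ≤ _ := by gcongr
      linarith
    have h4 : 0 < X.bd⁻¹ ^ 9 * (X.size w * r) := by positivity
    have h5 : 0 < |g (w ++ a :: p)| := h4.trans_le h3
    calc (1 + T * |g (w ++ a :: p)|)⁻¹ * (T * r * X.bd⁻¹ ^ 9) ^ X.delta
        ≤ (T * |g (w ++ a :: p)|) ^ (-X.delta) * (T * r * X.bd⁻¹ ^ 9) ^ X.delta := by
          gcongr
          exact inv_one_add_le_rpow_neg hδ0 hδ1 (by positivity)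
      _ ≤ (T * r * X.bd⁻¹ ^ 9 * X.size w) ^ (-X.delta) * (T * r * X.bd⁻¹ ^ 9) ^ X.delta := by
          gcongr ?_ * _
          refine Real.rpow_le_rpow_of_nonpos (by positivity) ?_ (by linarith)
          calc _ = T * (X.bd⁻¹ ^ 9 * (X.size w * r)) := by ring
            _ ≤ _ := by gcongr
      _ = X.size w ^ (-X.delta) := by
          rw [Real.mul_rpow (by positivity) hw.le, mul_right_comm, ← Real.rpow_add (by positivity)]
          simp
  rw [← Finset.sum_mul, hpow, Real.mul_rpow (by positivity) (by positivity),
    Real.mul_rpow hT0.le hrpos.le] at hmain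
  have hmain' : ∑ p ∈ F.erase P, (1 + T * |g p|)⁻¹ ≤
      L * C₂ * K * (T ^ (s - X.delta) * r ^ (-X.delta)) := by
    have e1 : L = ((X.bd⁻¹ ^ 9) ^ X.delta)⁻¹ := Real.rpow_neg (by positivity) _
    have e2 : r ^ (-X.delta) = (r ^ X.delta)⁻¹ := Real.rpow_neg hrpos.le _
    have e3 : T ^ (s - X.delta) = T ^ s * (T ^ X.delta)⁻¹ := by
      rw [Real.rpow_sub hT0, div_eq_mul_inv]
    rw [e1, e2, e3]
    rw [← le_div_iff₀ (by positivity)] at hmain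
    refine hmain.trans (le_of_eq ?_)
    rw [← hK]
    field_simp
  -- The piece `P` itself contributes at most `1`, which is bounded by `hone`.
  rw [← Finset.add_sum_erase F _ hP]
  have := hterm P
  nlinarith

/-- The sum over the words `w'` that share with `w` a prefix `p` of size about `T⁻¹` of a quantity
`J` controlled by the size of the common prefix of the mirror words. The bound is, up to
factors `T ^ ε`, the one that `J w' ≤ T ^ s` gives for a single term: after removal of `p` the words
have size at least about `τ₁`, and `τ₁` is at least of the order of `T⁻¹`. -/
theorem exists_pair_sum_bound (hm : 2 ≤ m) {s : ℝ} (hs : X.delta < s) {B : ℝ} (hB : 1 ≤ B) :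
    ∃ C : ℝ, 1 ≤ C ∧ ∀ (T τ₀ τ₁ : ℝ) (p w : List (Fin m ⊕ Fin m))
      (G : Finset (List (Fin m ⊕ Fin m))) (J : List (Fin m ⊕ Fin m) → ℝ), 1 ≤ T →
      0 < τ₀ → 0 < τ₁ → B⁻¹ * T⁻¹ ≤ τ₀ → τ₀ ≤ B * T⁻¹ → B⁻¹ * T⁻¹ ≤ τ₁ →
      IsReduced w → B⁻¹ * (τ₀ * τ₁) ≤ X.size w → X.size w ≤ B * (τ₀ * τ₁) →
      IsReduced p → X.size p ≤ B * T⁻¹ →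
      (∀ w' ∈ G, IsReduced w' ∧ p <+: w' ∧ B⁻¹ * (τ₀ * τ₁) ≤ X.size w' ∧ 0 ≤ J w' ∧
        J w' ≤ T ^ s ∧ ∀ v a b t t', a ≠ b → mirror w' = v ++ a :: t → mirror w = v ++ b :: t' →
          J w' ≤ T ^ (s - X.delta) * X.size v ^ (-X.delta)) →
      ∑ w' ∈ G, J w' ≤ C * T ^ (X.delta + 3 * (s - X.delta)) := by
  classical
  have hδ0 := X.delta_nonneg
  have hs0 : 0 < s := hδ0.trans_lt hs
  have hM := X.bd_pos
  have hM1 := X.one_le_bd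
  have hη : 0 < s - X.delta := by linarith
  obtain ⟨C₁, hC₁, H₁⟩ := X.exists_card_bound hm hs
  obtain ⟨C₂, hC₂, H₂⟩ := X.exists_energy_bound hm hs hs
  obtain ⟨C₃, hC₃, H₃⟩ := X.exists_length_bound hm hη
  have hB0 : 0 < B := by linarith
  set K : ℝ := X.bd ^ 2 * B ^ 3 with hK
  have hK0 : 0 < K := by positivity
  set K₁ : ℝ := C₃ * (B ^ 3) ^ (s - X.delta) with hK₁
  set K₂ : ℝ := C₁ * (B * K * B) ^ s with hK₂
  set K₃ : ℝ := C₂ * (B * K) ^ s with hK₃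
  have hK₁0 : 0 < K₁ := by positivity
  have hK₂0 : 0 < K₂ := by positivity
  have hK₃0 : 0 < K₃ := by positivity
  refine ⟨1 + K₁ + K₂ + K₃, by linarith, ?_⟩
  intro T τ₀ τ₁ p w G J hT hτ₀ hτ₁ h0 h0' h1 hw hw1 hw2 hp hpT hG
  have hT0 : 0 < T := by linarith
  have pp := X.size_pos hp
  have pw := X.size_pos hw
  set ω := mirror w with hω
  have hωr : IsReduced ω := isReduced_mirror hw
  have hωs : X.size ω = X.size w := X.size_mirror w
  set ρ := τ₁ / K with hρ
  have hρ0 : 0 < ρ := by positivity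
  -- The words `w' = p q` are indexed by `v = mirror q`, which is a prefix of `mirror w'` and has
  -- size at least `ρ`.
  set G' := G.image (fun w' => mirror (w'.drop p.length)) with hG'
  set f : List (Fin m ⊕ Fin m) → ℝ := fun v => J (p ++ mirror v) with hf
  have hG'1 : ∀ v ∈ G', p ++ mirror v ∈ G := by
    intro v hv
    obtain ⟨w', hw', rfl⟩ := Finset.mem_image.mp hv
    obtain ⟨q, rfl⟩ := (hG w' hw').2.1
    simpa [mirror_mirror] using hw'
  have hG'2 : ∀ v ∈ G', IsReduced v ∧ ρ ≤ X.size v := by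
    intro v hv
    obtain ⟨h2, -, h3, -⟩ := hG _ (hG'1 v hv)
    have h4 := (isReduced_append.mp h2).2.1
    have h5 : IsReduced v := by simpa [mirror_mirror] using isReduced_mirror h4
    refine ⟨h5, ?_⟩
    have h6 := h3.trans (X.size_append h2).2
    rw [size_mirror] at h6
    have pv := X.size_pos h5
    have h7 : B⁻¹ * (B⁻¹ * T⁻¹ * τ₁) ≤ X.bd ^ 2 * (B * T⁻¹ * X.size v) := by
      calc _ ≤ B⁻¹ * (τ₀ * τ₁) := by gcongr
        _ ≤ _ := h6
        _ ≤ _ := by gcongr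
    rw [hρ, div_le_iff₀ hK0, hK]
    have h8 : τ₁ = B ^ 2 * T * (B⁻¹ * (B⁻¹ * T⁻¹ * τ₁)) := by field_simp
    rw [h8]
    calc _ ≤ B ^ 2 * T * (X.bd ^ 2 * (B * T⁻¹ * X.size v)) := by gcongr
      _ = _ := by field_simp
  have hsum : ∑ w' ∈ G, J w' ≤ ∑ v ∈ G', f v := by
    refine sum_le_sum_of_cover (fun v => p ++ mirror v) ?_ ?_
    · exact fun v hv => (hG _ (hG'1 v hv)).2.2.2.1
    · intro w' hw'
      obtain ⟨q, rfl⟩ := (hG w' hw').2.1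
      refine ⟨mirror q, Finset.mem_image.mpr ⟨_, hw', by simp⟩, by simp [mirror_mirror], ?_⟩
      simp [hf, mirror_mirror]
  have hfT : ∀ v ∈ G', f v ≤ T ^ s := fun v hv => (hG _ (hG'1 v hv)).2.2.2.2.1
  have hf0 : ∀ v ∈ G', 0 ≤ f v := fun v hv => (hG _ (hG'1 v hv)).2.2.2.1
  set E := X.delta + 3 * (s - X.delta) with hE
  have hTE : ∀ e, e ≤ E → T ^ e ≤ T ^ E := fun e he => Real.rpow_le_rpow_of_exponent_le hT he
  have hTs : 0 < T ^ s := by positivity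
  -- The prefixes `v` of `ω` are few: `ω` has length at most a small power of `T`.
  have s1 : ∑ v ∈ G'.filter (fun v => v <+: ω), f v ≤ K₁ * T ^ E := by
    have hcard : ((G'.filter (fun v => v <+: ω)).card : ℝ) ≤ w.length + 1 := by
      have : (G'.filter (fun v => v <+: ω)).card ≤ (Finset.range (w.length + 1)).card := by
        refine Finset.card_le_card_of_injOn List.length ?_ ?_
        · intro v hv
          have h2 := (Finset.mem_filter.mp hv).2.length_le
          rw [hω, length_mirror] at h2
          simp; omega
        · intro v hv v' hv' h
          have h2 := (Finset.mem_filter.mp hv).2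
          have h3 := (Finset.mem_filter.mp hv').2
          rw [List.prefix_iff_eq_take.mp h2, List.prefix_iff_eq_take.mp h3, h]
      rw [Finset.card_range] at this
      exact_mod_cast this
    have hlen : (w.length + 1 : ℝ) ≤ K₁ * T ^ (2 * (s - X.delta)) := by
      refine (H₃ w hw).trans ?_
      have h2 : (B ^ 3 * T ^ 2)⁻¹ ≤ X.size w := by
        calc (B ^ 3 * T ^ 2)⁻¹ = B⁻¹ * ((B⁻¹ * T⁻¹) * (B⁻¹ * T⁻¹)) := by field_simp
          _ ≤ B⁻¹ * (τ₀ * τ₁) := by gcongr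
          _ ≤ _ := hw1
      calc C₃ * X.size w ^ (-(s - X.delta))
          ≤ C₃ * ((B ^ 3 * T ^ 2)⁻¹) ^ (-(s - X.delta)) := by
            gcongr ?_ * ?_
            exact Real.rpow_le_rpow_of_nonpos (by positivity) h2 (by linarith)
        _ = _ := by
            rw [Real.rpow_neg (by positivity), Real.inv_rpow (by positivity), inv_inv,
              Real.mul_rpow (by positivity) (by positivity), ← Real.rpow_natCast T 2,
              ← Real.rpow_mul hT0.le]
            push_cast
            ring
    calc _ ≤ ∑ v ∈ G'.filter (fun v => v <+: ω), T ^ s :=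
          Finset.sum_le_sum fun v hv => hfT v (Finset.mem_filter.mp hv).1
      _ = ((G'.filter (fun v => v <+: ω)).card : ℝ) * T ^ s := by simp
      _ ≤ (K₁ * T ^ (2 * (s - X.delta))) * T ^ s := by
          gcongr; exact hcard.trans hlen
      _ = K₁ * T ^ E := by
          rw [mul_assoc, ← Real.rpow_add hT0]
          congr 2
          rw [hE]; ring
  -- The words `v` that start with `ω` are few: the size of `ω` is at most a constant times `ρ`.
  have s2 : ∑ v ∈ G'.filter (fun v => ω <+: v), f v ≤ K₂ * T ^ E := by
    have hcard := H₁ ω (G'.filter (fun v => ω <+: v)) ρ hωr hρ0 (fun v hv => by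
      obtain ⟨h2, h3⟩ := Finset.mem_filter.mp hv
      exact ⟨(hG'2 v h2).1, h3, (hG'2 v h2).2⟩)
    have h2 : X.size ω / ρ ≤ B * K * B := by
      rw [hωs, div_le_iff₀ hρ0]
      calc X.size w ≤ B * (τ₀ * τ₁) := hw2
        _ ≤ B * (B * 1 * τ₁) := by
            gcongr
            exact h0'.trans (by gcongr; exact inv_le_one_of_one_le₀ hT)
        _ = _ := by rw [hρ]; field_simp
    calc _ ≤ ∑ v ∈ G'.filter (fun v => ω <+: v), T ^ s :=
          Finset.sum_le_sum fun v hv => hfT v (Finset.mem_filter.mp hv).1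
      _ = ((G'.filter (fun v => ω <+: v)).card : ℝ) * T ^ s := by simp
      _ ≤ (C₁ * (X.size ω / ρ) ^ s) * T ^ s := by gcongr
      _ ≤ (C₁ * (B * K * B) ^ s) * T ^ E := by
          have : 0 < X.size ω := by rw [hωs]; exact pw
          gcongr
          rw [hE]; linarith
  -- The other words diverge from `ω`, so that `J` is controlled by the common prefix.
  have s3 : ∑ v ∈ G'.filter (fun v => ¬ v <+: ω ∧ ¬ ω <+: v), f v ≤ K₃ * T ^ E := by
    have hTη : 0 < T ^ (s - X.delta) := by positivity
    have h2 := H₂ ω (G'.filter (fun v => ¬ v <+: ω ∧ ¬ ω <+: v)) ρ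
      (fun v => f v / T ^ (s - X.delta)) hωr hρ0 (fun v hv => by
        obtain ⟨h2, h3, h4⟩ := Finset.mem_filter.mp hv
        refine ⟨(hG'2 v h2).1, (hG'2 v h2).2, ?_⟩
        rcases list_trichotomy v ω with h | h | ⟨u, a, b, t, t', hab, h5, h6⟩
        · exact absurd h h3
        · exact absurd h h4
        refine ⟨u, a, b, t, t', hab, h5, h6, ?_⟩
        rw [div_le_iff₀ hTη, mul_comm]
        refine (hG _ (hG'1 v h2)).2.2.2.2.2 u a b (t ++ mirror p) t' hab ?_ h6
        rw [mirror_append, mirror_mirror, h5]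
        simp)
    rw [← Finset.sum_div, div_le_iff₀ hTη] at h2
    refine h2.trans ?_
    have h3 : ρ ^ (-s) ≤ (B * K) ^ s * T ^ s := by
      rw [← Real.mul_rpow (by positivity) hT0.le, Real.rpow_neg hρ0.le, ← Real.inv_rpow hρ0.le]
      refine Real.rpow_le_rpow (by positivity) ?_ hs0.le
      rw [hρ, inv_div, div_le_iff₀ hτ₁]
      calc K = B * K * T * (B⁻¹ * T⁻¹) := by field_simp
        _ ≤ _ := by gcongr
    calc C₂ * ρ ^ (-s) * T ^ (s - X.delta) ≤ C₂ * ((B * K) ^ s * T ^ s) * T ^ (s - X.delta) := by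
          gcongr
      _ = K₃ * T ^ (s + (s - X.delta)) := by rw [Real.rpow_add hT0]; ring
      _ ≤ _ := by
          gcongr
          rw [hE]; linarith
  have hcov : ∑ v ∈ G', f v ≤ ∑ v ∈ G'.filter (fun v => v <+: ω), f v +
      (∑ v ∈ G'.filter (fun v => ω <+: v), f v +
        ∑ v ∈ G'.filter (fun v => ¬ v <+: ω ∧ ¬ ω <+: v), f v) := by
    rw [Finset.sum_filter, Finset.sum_filter, Finset.sum_filter, ← Finset.sum_add_distrib,
      ← Finset.sum_add_distrib]
    refine Finset.sum_le_sum fun v hv => ?_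
    have := hf0 v hv
    by_cases h2 : v <+: ω <;> by_cases h3 : ω <+: v <;> simp [h2, h3, this]
  have hTE0 : 0 < T ^ E := by positivity
  nlinarith

theorem finite_size_ge (hm : 2 ≤ m) {r : ℝ} (hr : 0 < r) :
    {w : List (Fin m ⊕ Fin m) | IsReduced w ∧ r ≤ X.size w}.Finite := by
  by_contra hinf
  obtain ⟨C, -, H⟩ := X.exists_card_bound hm (lt_add_one X.delta)
  obtain ⟨n, hn⟩ := exists_nat_gt (C * (X.size [] / r) ^ (X.delta + 1))
  obtain ⟨F, hF, hcard⟩ := Set.Infinite.exists_subset_card_eq hinf n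
  have := H [] F r (by simp [IsReduced]) hr fun w hw =>
    ⟨(hF hw).1, List.nil_prefix, (hF hw).2⟩
  rw [hcard] at this
  linarith

theorem finite_isStop (hm : 2 ≤ m) {r : ℝ} (hr : 0 < r) (hr1 : r < 1) :
    {p | X.IsStop r p}.Finite :=
  (X.finite_size_ge hm (r := X.bd⁻¹ ^ 3 * r) (by have := X.bd_pos; positivity)).subset
    fun _ hp => ⟨hp.1, hp.size_ge hr1⟩

end SchottkyData

/-! ### Point evaluations on the Bergman space -/

theorem bergmanSpace.rep_add {Ω : Set ℂ} (hΩ : IsOpen Ω) (f g : bergmanSpace Ω) :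
    Set.EqOn (bergmanSpace.rep (f + g)) (bergmanSpace.rep f + bergmanSpace.rep g) Ω :=
  bergmanSpace.rep_eqOn hΩ _ ((bergmanSpace.differentiableOn_rep f).add
    (bergmanSpace.differentiableOn_rep g)) ((Lp.coeFn_add _ _).trans
      ((bergmanSpace.coe_ae_eq_rep f).add (bergmanSpace.coe_ae_eq_rep g)))

theorem bergmanSpace.rep_smul {Ω : Set ℂ} (hΩ : IsOpen Ω) (c : ℂ) (f : bergmanSpace Ω) :
    Set.EqOn (bergmanSpace.rep (c • f)) (c • bergmanSpace.rep f) Ω :=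
  bergmanSpace.rep_eqOn hΩ _ ((bergmanSpace.differentiableOn_rep f).const_smul c)
    ((Lp.coeFn_smul _ _).trans ((bergmanSpace.coe_ae_eq_rep f).const_smul c))

theorem bergmanSpace.enorm_sq {Ω : Set ℂ} (f : bergmanSpace Ω) :
    ‖f‖ₑ ^ 2 = ∫⁻ z in Ω, ‖bergmanSpace.rep f z‖ₑ ^ 2 := by
  have h : ‖f‖ₑ = ‖(f : Lp ℂ 2 (volume.restrict Ω))‖ₑ := rfl
  rw [h, Lp.enorm_def, eLpNorm_eq_lintegral_rpow_enorm_toReal (by norm_num) (by norm_num)]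
  simp only [ENNReal.toReal_ofNat, ENNReal.rpow_ofNat]
  rw [← ENNReal.rpow_natCast, ← ENNReal.rpow_mul]
  norm_num
  refine lintegral_congr_ae ?_
  filter_upwards [bergmanSpace.coe_ae_eq_rep f] with w h1
  simp [h1]

/-- Point evaluations are bounded, by the sub-mean value property of `|f|²`. -/
theorem bergmanSpace.norm_rep_le {Ω : Set ℂ} (f : bergmanSpace Ω) {y : ℂ} {r : ℝ} (hr : 0 < r)
    (hy : Metric.ball y r ⊆ Ω) : ‖bergmanSpace.rep f y‖ ≤ r⁻¹ * ‖f‖ := by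
  have h1 := (enorm_sq_le_of_differentiableOn_ball hr
    ((bergmanSpace.differentiableOn_rep f).mono hy)).trans (lintegral_mono_set hy)
  rw [← bergmanSpace.enorm_sq] at h1
  have h2 := ENNReal.toReal_mono (by finiteness) h1
  simp only [ENNReal.toReal_mul, ENNReal.toReal_pow, toReal_enorm] at h2
  rw [ENNReal.toReal_ofReal (by positivity), ENNReal.toReal_ofReal (by positivity)] at h2
  have h3 : (r * ‖bergmanSpace.rep f y‖) ^ 2 ≤ ‖f‖ ^ 2 := by
    have := Real.pi_gt_three
    have h4 : 0 ≤ r ^ 2 * ‖bergmanSpace.rep f y‖ ^ 2 := by positivity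
    nlinarith
  have h4 := (pow_le_pow_iff_left₀ (by positivity) (norm_nonneg f) two_ne_zero).mp h3
  rw [inv_mul_eq_div, le_div_iff₀ hr, mul_comm]
  exact h4

/-- The reproducing kernel of a point `y`, by Riesz representation of the evaluation at `y`. -/
theorem bergmanSpace.exists_kernel {Ω : Set ℂ} (hΩ : IsOpen Ω) {y : ℂ} {r : ℝ} (hr : 0 < r)
    (hy : Metric.ball y r ⊆ Ω) : ∃ k : bergmanSpace Ω, ‖k‖ ≤ r⁻¹ ∧
      ∀ f : bergmanSpace Ω, inner ℂ k f = bergmanSpace.rep f y := by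
  have := completeSpace_bergmanSpace hΩ
  have hyΩ : y ∈ Ω := hy (Metric.mem_ball_self hr)
  let e : bergmanSpace Ω →L[ℂ] ℂ := LinearMap.mkContinuous
    { toFun := fun f => bergmanSpace.rep f y
      map_add' := fun f g => bergmanSpace.rep_add hΩ f g hyΩ
      map_smul' := fun c f => bergmanSpace.rep_smul hΩ c f hyΩ } r⁻¹
    (fun f => bergmanSpace.norm_rep_le f hr hy)
  refine ⟨(InnerProductSpace.toDual ℂ _).symm e, ?_, fun f => ?_⟩
  · rw [LinearIsometryEquiv.norm_map]
    exact LinearMap.mkContinuous_norm_le _ (by positivity) _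
  · rw [InnerProductSpace.toDual_symm_apply]
    rfl

theorem bergmanSpace.exists_rep_eqOn {Ω : Set ℂ} (hΩ : IsOpen Ω) {g : ℂ → ℂ}
    (hg : DifferentiableOn ℂ g Ω) (hg2 : MemLp g 2 (volume.restrict Ω)) :
    ∃ f : bergmanSpace Ω, Set.EqOn (bergmanSpace.rep f) g Ω := by
  refine ⟨⟨hg2.toLp g, g, hg, hg2.coeFn_toLp⟩, ?_⟩
  exact bergmanSpace.rep_eqOn hΩ _ hg hg2.coeFn_toLp

/-- The reproducing kernels of two points in different parts of a disconnected open set are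
orthogonal. -/
theorem bergmanSpace.inner_kernel_eq_zero {Ω U V : Set ℂ} (hU : IsOpen U) (hV : IsOpen V)
    (hUV : Disjoint U V) (hΩ : Ω = U ∪ V) {y y' : ℂ} (hy : y ∈ U) (hy' : y' ∈ V)
    {k k' : bergmanSpace Ω} (hk : ∀ f : bergmanSpace Ω, inner ℂ k f = bergmanSpace.rep f y)
    (hk' : ∀ f : bergmanSpace Ω, inner ℂ k' f = bergmanSpace.rep f y') :
    inner ℂ k k' = 0 := by
  have hΩo : IsOpen Ω := hΩ ▸ hU.union hV
  set g : ℂ → ℂ := U.indicator (bergmanSpace.rep k') with hg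
  have hgd : DifferentiableOn ℂ g Ω := by
    intro z hz
    rw [hΩ] at hz
    rcases hz with hz | hz
    · have h1 : g =ᶠ[𝓝 z] bergmanSpace.rep k' := by
        filter_upwards [hU.mem_nhds hz] with w hw
        simp [hg, hw]
      have h2 := (bergmanSpace.differentiableOn_rep k').differentiableAt
        (hΩo.mem_nhds (by rw [hΩ]; exact Or.inl hz))
      exact (h2.congr_of_eventuallyEq h1).differentiableWithinAt
    · have h1 : g =ᶠ[𝓝 z] fun _ => 0 := by
        filter_upwards [hV.mem_nhds hz] with w hw
        simp [hg, Set.disjoint_right.mp hUV hw]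
      exact ((differentiableAt_const 0).congr_of_eventuallyEq h1).differentiableWithinAt
  have hm : MemLp (bergmanSpace.rep k') 2 (volume.restrict Ω) :=
    (memLp_congr_ae (bergmanSpace.coe_ae_eq_rep k')).mp (Lp.memLp _)
  obtain ⟨f, hf⟩ := bergmanSpace.exists_rep_eqOn hΩo hgd (hm.indicator hU.measurableSet)
  -- The function `f`, which is `k'` on `U` and zero on `V`, satisfies `⟨k', f⟩ = ⟨f, f⟩`; but `⟨k',
  -- f⟩` is the value `f y' = 0`. Hence `k'` vanishes on `U`.
  have h1 : inner ℂ k' f = inner ℂ f f := by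
    rw [Submodule.coe_inner, Submodule.coe_inner, L2.inner_def, L2.inner_def]
    refine integral_congr_ae ?_
    filter_upwards [bergmanSpace.coe_ae_eq_rep f, bergmanSpace.coe_ae_eq_rep k',
      ae_restrict_mem hΩo.measurableSet] with z e1 e2 hz
    rw [e1, e2, hf hz]
    by_cases hzU : z ∈ U <;> simp [hg, hzU]
  have h2 : inner ℂ k' f = 0 := by
    rw [hk', hf (hΩ ▸ Or.inr hy'), hg, Set.indicator_of_notMem (Set.disjoint_right.mp hUV hy')]
  have h3 : f = 0 := inner_self_eq_zero.mp (h1.symm.trans h2)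
  have hyΩ : y ∈ Ω := hΩ ▸ Or.inl hy
  have h4 : bergmanSpace.rep f y = 0 := by
    rw [← hk, h3, inner_zero_right]
  rw [hk, ← h4, hf hyΩ, hg, Set.indicator_of_mem hy]

/-! ### Operators on the Bergman space -/

/-- A linear map from the Bergman space to holomorphic functions that is bounded in the supremum
norm defines a bounded operator on the Bergman space, if `Ω` has finite area. -/
theorem bergmanSpace.exists_operator {Ω : Set ℂ} (hΩ : IsOpen Ω) (hfin : volume Ω ≠ ∞)
    (A : bergmanSpace Ω → ℂ → ℂ) {C : ℝ} (hd : ∀ f, DifferentiableOn ℂ (A f) Ω)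
    (hb : ∀ f, ∀ z ∈ Ω, ‖A f z‖ ≤ C * ‖f‖)
    (hadd : ∀ f g, Set.EqOn (A (f + g)) (A f + A g) Ω)
    (hsmul : ∀ (c : ℂ) f, Set.EqOn (A (c • f)) (c • A f) Ω) :
    ∃ L : bergmanSpace Ω →L[ℂ] bergmanSpace Ω, ∀ f, Set.EqOn (bergmanSpace.rep (L f)) (A f) Ω := by
  have : IsFiniteMeasure (volume.restrict Ω) := ⟨by simpa using hfin.lt_top⟩
  have hae : ∀ f, ∀ᵐ z ∂volume.restrict Ω, ‖A f z‖ ≤ C * ‖f‖ := by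
    intro f
    filter_upwards [ae_restrict_mem hΩ.measurableSet] with z hz using hb f z hz
  have hmem : ∀ f, MemLp (A f) 2 (volume.restrict Ω) := fun f =>
    MemLp.of_bound ((hd f).continuousOn.aestronglyMeasurable hΩ.measurableSet) (C * ‖f‖) (hae f)
  let B : bergmanSpace Ω → bergmanSpace Ω := fun f =>
    ⟨(hmem f).toLp (A f), A f, hd f, (hmem f).coeFn_toLp⟩
  have hB : ∀ f, ((B f : bergmanSpace Ω) : Lp ℂ 2 (volume.restrict Ω)) =ᵐ[volume.restrict Ω] A f :=
    fun f => (hmem f).coeFn_toLp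
  have hBadd : ∀ f g, B (f + g) = B f + B g := by
    intro f g
    refine Subtype.ext (Lp.ext ?_)
    filter_upwards [hB (f + g), hB f, hB g,
      Lp.coeFn_add (B f : Lp ℂ 2 (volume.restrict Ω)) (B g : Lp ℂ 2 (volume.restrict Ω)),
      ae_restrict_mem hΩ.measurableSet] with z h1 h2 h3 h4 hz
    rw [h1, Submodule.coe_add, h4, Pi.add_apply, h2, h3, hadd f g hz, Pi.add_apply]
  have hBsmul : ∀ (c : ℂ) f, B (c • f) = c • B f := by
    intro c f
    refine Subtype.ext (Lp.ext ?_)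
    filter_upwards [hB (c • f), hB f, Lp.coeFn_smul c (B f : Lp ℂ 2 (volume.restrict Ω)),
      ae_restrict_mem hΩ.measurableSet] with z h1 h2 h4 hz
    rw [h1, Submodule.coe_smul, h4, Pi.smul_apply, h2, hsmul c f hz, Pi.smul_apply]
  let L₀ : bergmanSpace Ω →ₗ[ℂ] bergmanSpace Ω :=
    { toFun := B, map_add' := hBadd, map_smul' := hBsmul }
  set V := (volume.restrict Ω).real Set.univ ^ (2 : ℝ≥0∞).toReal⁻¹ with hV
  have hLb : ∀ f, ‖L₀ f‖ ≤ V * |C| * ‖f‖ := by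
    intro f
    have h1 : ‖(B f : Lp ℂ 2 (volume.restrict Ω))‖ ≤ V * (|C| * ‖f‖) := by
      refine Lp.norm_le_of_ae_bound (by positivity) ?_
      filter_upwards [hB f, hae f] with z h1 h2
      rw [h1]
      exact h2.trans (by gcongr; exact le_abs_self C)
    rw [mul_assoc]
    exact h1
  refine ⟨L₀.mkContinuous _ hLb, fun f => ?_⟩
  exact bergmanSpace.rep_eqOn hΩ _ (hd f) (hB f)

/-- The balls of radius `1 / 2` about the basis vectors, at distance `√2` of each other, are
disjoint. -/
theorem HilbertBasis.countable_index {H ι : Type*} [NormedAddCommGroup H] [InnerProductSpace ℂ H]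
    [TopologicalSpace.SeparableSpace H] (b : HilbertBasis ι ℂ H) : Countable ι := by
  refine Pairwise.countable_of_isOpen_disjoint (s := fun i => Metric.ball (b i) (1 / 2)) ?_
    (fun i => Metric.isOpen_ball) (fun i => ⟨b i, Metric.mem_ball_self (by norm_num)⟩)
  intro i j hij
  refine Metric.ball_disjoint_ball ?_
  have h1 : ‖b i - b j‖ ^ 2 = 2 := by
    have h2 : inner ℂ (b i) (b j) = 0 := b.orthonormal.2 hij
    rw [@norm_sub_sq ℂ, h2, b.orthonormal.1, b.orthonormal.1]
    norm_num
  rw [dist_eq_norm]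
  nlinarith [norm_nonneg (b i - b j)]

/-- The squared Hilbert-Schmidt norm of an operator on the Bergman space is the integral of the
squared norms of the functionals `f ↦ (A f)(z)`; here it is integrated over a parameter. -/
theorem bergmanSpace.lintegral_hsNormSq {Ω : Set ℂ} (hΩ : IsOpen Ω)
    [CompleteSpace (bergmanSpace Ω)]
    (A : ℝ → bergmanSpace Ω →L[ℂ] bergmanSpace Ω) (l : ℝ → ℂ → bergmanSpace Ω)
    (hl : ∀ t, ∀ z ∈ Ω, ∀ f, bergmanSpace.rep (A t f) z = inner ℂ (l t z) f)
    (hc : ∀ f, ContinuousOn (fun q : ℝ × ℂ => bergmanSpace.rep (A q.1 f) q.2) (Set.univ ×ˢ Ω))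
    (I : Set ℝ) :
    AEMeasurable (fun t => hsNormSq (A t)) (volume.restrict I) ∧
      ∫⁻ t in I, hsNormSq (A t) = ∫⁻ z in Ω, ∫⁻ t in I, ‖l t z‖ₑ ^ 2 := by
  obtain ⟨w, b, -⟩ := exists_hilbertBasis ℂ (bergmanSpace Ω)
  have : Fact ((2 : ℝ≥0∞) ≠ ∞) := ⟨by norm_num⟩
  have : SecondCountableTopology (Lp ℂ 2 ((volume : Measure ℂ).restrict Ω)) := inferInstance
  -- A countable basis is needed to interchange the sum over the basis with the integrals.
  have : Countable w := b.countable_index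
  set μ := (volume : Measure ℝ).restrict I with hμ
  set ν := (volume : Measure ℂ).restrict Ω with hν
  have hmeas : ∀ f, AEMeasurable
      (Function.uncurry fun t z => ‖bergmanSpace.rep (A t f) z‖ₑ ^ 2) (μ.prod ν) := by
    intro f
    have h1 : AEStronglyMeasurable (fun q : ℝ × ℂ => bergmanSpace.rep (A q.1 f) q.2)
        (((volume : Measure ℝ).prod (volume : Measure ℂ)).restrict (Set.univ ×ˢ Ω)) :=
      (hc f).aestronglyMeasurable (MeasurableSet.univ.prod hΩ.measurableSet)
    rw [← Measure.prod_restrict, Measure.restrict_univ] at h1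
    have h2 : (μ.prod ν) ≪ (volume : Measure ℝ).prod ν :=
      Measure.AbsolutelyContinuous.prod Measure.restrict_le_self.absolutelyContinuous
        Measure.AbsolutelyContinuous.rfl
    exact ((h1.mono_ac h2).enorm).pow_const 2
  have h1 : ∀ t, hsNormSq (A t) = ∑' i, ∫⁻ z, ‖bergmanSpace.rep (A t (b i)) z‖ₑ ^ 2 ∂ν := by
    intro t
    rw [hsNormSq_eq _ b]
    exact tsum_congr fun i => bergmanSpace.enorm_sq _
  have hmi : ∀ i, AEMeasurable (fun t => ∫⁻ z, ‖bergmanSpace.rep (A t (b i)) z‖ₑ ^ 2 ∂ν) μ :=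
    fun i => (hmeas (b i)).lintegral_prod_right'
  have h2 : ∀ z ∈ Ω, ∀ t, ∑' i, ‖bergmanSpace.rep (A t (b i)) z‖ₑ ^ 2 = ‖l t z‖ₑ ^ 2 := by
    intro z hz t
    rw [← b.tsum_enorm_inner_sq]
    refine tsum_congr fun i => ?_
    rw [hl t z hz, ← inner_conj_symm (b i) (l t z), RCLike.enorm_conj]
  refine ⟨?_, ?_⟩
  · simp_rw [h1]
    exact AEMeasurable.tsum hmi
  · simp_rw [h1]
    rw [lintegral_tsum hmi]
    have h3 : ∀ i, ∫⁻ t, ∫⁻ z, ‖bergmanSpace.rep (A t (b i)) z‖ₑ ^ 2 ∂ν ∂μ =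
        ∫⁻ z, ∫⁻ t, ‖bergmanSpace.rep (A t (b i)) z‖ₑ ^ 2 ∂μ ∂ν := fun i =>
      lintegral_lintegral_swap (hmeas (b i))
    simp_rw [h3]
    rw [← lintegral_tsum]
    · refine setLIntegral_congr_fun hΩ.measurableSet fun z hz => ?_
      rw [← lintegral_tsum]
      · exact lintegral_congr fun t => h2 z hz t
      · intro i
        have h4 : ContinuousOn (fun t : ℝ => bergmanSpace.rep (A t (b i)) z) Set.univ :=
          (hc (b i)).comp (f := fun t : ℝ => (t, z)) (by fun_prop) (fun t _ => ⟨trivial, hz⟩)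
        rw [continuousOn_univ] at h4
        exact h4.measurable.enorm.pow_const 2 |>.aemeasurable
    · intro i
      exact (hmeas (b i)).prod_swap.lintegral_prod_right'

/-! ### Oscillatory integrals -/

/-- The decay in `Re θ` comes from the explicit primitive. The imaginary part of `θ` is so small
that it changes absolute values by a bounded factor only. -/
theorem norm_integral_exp_le {T B : ℝ} (hT : 0 < T) (hB : 0 ≤ B) {θ : ℂ} (hθ : |θ.im| * T ≤ B) :
    ‖∫ t in (0 : ℝ)..T, Complex.exp (t * Complex.I * θ)‖ ≤
      3 * Real.exp B * T * (1 + T * |θ.re|)⁻¹ := by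
  have hn : ∀ t ∈ Set.Icc 0 T, ‖Complex.exp (t * Complex.I * θ)‖ ≤ Real.exp B := by
    intro t ht
    rw [Complex.norm_exp]
    refine Real.exp_le_exp.mpr ?_
    have : (t * Complex.I * θ).re = -(t * θ.im) := by simp
    rw [this]
    have h1 := neg_abs_le θ.im
    have h2 : t * |θ.im| ≤ B := by
      calc t * |θ.im| ≤ T * |θ.im| := by gcongr; exact ht.2
        _ ≤ B := by linarith
    nlinarith [ht.1]
  have hE : 1 ≤ Real.exp B := Real.one_le_exp hB
  set N := ‖∫ t in (0 : ℝ)..T, Complex.exp (t * Complex.I * θ)‖ with hN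
  have h1 : N ≤ Real.exp B * T := by
    have := intervalIntegral.norm_integral_le_of_norm_le_const (a := 0) (b := T)
      (f := fun t : ℝ => Complex.exp (t * Complex.I * θ)) (C := Real.exp B) (by
        intro t ht
        rw [Set.uIoc_of_le hT.le] at ht
        exact hn t ⟨ht.1.le, ht.2⟩)
    rwa [sub_zero, abs_of_pos hT] at this
  have h2 : |θ.re| * N ≤ 2 * Real.exp B := by
    by_cases h0 : θ = 0
    · simp only [h0, Complex.zero_re, abs_zero, zero_mul]; positivity
    have h3 : (∫ t in (0 : ℝ)..T, Complex.exp (t * Complex.I * θ)) =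
        (Complex.exp (T * Complex.I * θ) - 1) / (Complex.I * θ) := by
      have := integral_exp_mul_complex (a := 0) (b := T) (c := Complex.I * θ)
        (mul_ne_zero Complex.I_ne_zero h0)
      simp only [Complex.ofReal_zero, mul_zero, Complex.exp_zero] at this
      rw [mul_assoc, mul_comm (T : ℂ), ← this]
      refine intervalIntegral.integral_congr fun t _ => ?_
      congr 1; ring
    have h4 : N * ‖θ‖ ≤ 2 * Real.exp B := by
      rw [hN, h3, norm_div, norm_mul, Complex.norm_I, one_mul,
        div_mul_cancel₀ _ (norm_ne_zero_iff.mpr h0)]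
      refine (norm_sub_le _ _).trans ?_
      have := hn T ⟨hT.le, le_rfl⟩
      rw [norm_one]
      linarith
    calc |θ.re| * N ≤ ‖θ‖ * N := by gcongr; exact Complex.abs_re_le_norm θ
      _ ≤ _ := by linarith
  have h5 : 0 < 1 + T * |θ.re| := by positivity
  rw [← div_eq_mul_inv, le_div_iff₀ h5]
  nlinarith

/-- The mean square over `t` of a combination of vectors with oscillating coefficients is bounded
by a sum over pairs of vectors, in which pairs of different phases contribute little. -/
theorem lintegral_norm_sum_exp_le {H ι : Type*} [NormedAddCommGroup H] [InnerProductSpace ℂ H]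
    (W : Finset ι) (k : ι → H) (L : ι → ℂ) (s : ℂ) {T B : ℝ} (hT : 0 < T) (hB : 0 ≤ B)
    (hL : ∀ i ∈ W, |(L i).im| * T ≤ B) :
    ∫⁻ t in Set.Ioc 0 T,
        ‖∑ i ∈ W, (starRingEnd ℂ) (Complex.exp ((s + t * Complex.I) * L i)) • k i‖ₑ ^ 2 ≤
      ENNReal.ofReal (∑ i ∈ W, ∑ j ∈ W, ‖inner ℂ (k i) (k j)‖ *
        (‖Complex.exp (s * L i)‖ * ‖Complex.exp (s * L j)‖ *
          (3 * Real.exp (2 * B) * T * (1 + T * |(L i).re - (L j).re|)⁻¹))) := by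
  set a : ι → ℝ → ℂ := fun i t => Complex.exp ((s + t * Complex.I) * L i) with ha
  set v : ℝ → H := fun t => ∑ i ∈ W, (starRingEnd ℂ) (a i t) • k i with hv
  have hexp : ∀ i j (t : ℝ), a i t * (starRingEnd ℂ) (a j t) =
      Complex.exp (s * L i) * (starRingEnd ℂ) (Complex.exp (s * L j)) *
        Complex.exp (t * Complex.I * (L i - (starRingEnd ℂ) (L j))) := by
    intro i j t
    simp only [ha, ← Complex.exp_conj, ← Complex.exp_add, map_mul, map_add, Complex.conj_I,
      Complex.conj_ofReal]
    congr 1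
    ring
  have hnorm : ∀ t, ((‖v t‖ ^ 2 : ℝ) : ℂ) = ∑ i ∈ W, ∑ j ∈ W,
      (inner ℂ (k i) (k j) * (Complex.exp (s * L i) * (starRingEnd ℂ) (Complex.exp (s * L j)))) *
        Complex.exp (t * Complex.I * (L i - (starRingEnd ℂ) (L j))) := by
    intro t
    have h1 := inner_self_eq_norm_sq_to_K (𝕜 := ℂ) (v t)
    push_cast
    rw [show ((‖v t‖ : ℂ)) ^ 2 = inner ℂ (v t) (v t) from h1.symm, hv]
    simp only [sum_inner, inner_sum, inner_smul_left, inner_smul_right, Complex.conj_conj]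
    rw [Finset.sum_comm]
    refine Finset.sum_congr rfl fun j _ => ?_
    rw [Finset.mul_sum]
    refine Finset.sum_congr rfl fun i _ => ?_
    have := hexp i j t
    linear_combination (inner ℂ (k i) (k j)) * this
  have hcont : Continuous v := by
    refine continuous_finsetSum _ fun i _ => ?_
    refine Continuous.smul ?_ continuous_const
    refine Complex.continuous_conj.comp ?_
    simp only [ha]
    fun_prop
  have hint : IntervalIntegrable (fun t => ‖v t‖ ^ 2) volume 0 T :=
    (hcont.norm.pow 2).intervalIntegrable 0 T
  have h1 : ∫⁻ t in Set.Ioc 0 T, ‖v t‖ₑ ^ 2 = ENNReal.ofReal (∫ t in (0 : ℝ)..T, ‖v t‖ ^ 2) := by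
    rw [intervalIntegral.integral_of_le hT.le, ofReal_integral_eq_lintegral_ofReal]
    · refine lintegral_congr fun t => ?_
      rw [ENNReal.ofReal_pow (norm_nonneg _), ofReal_norm]
    · rw [intervalIntegrable_iff_integrableOn_Ioc_of_le hT.le] at hint
      exact hint
    · exact Filter.Eventually.of_forall fun t => sq_nonneg _
  change ∫⁻ t in Set.Ioc 0 T, ‖v t‖ₑ ^ 2 ≤ _
  rw [h1]
  refine ENNReal.ofReal_le_ofReal ?_
  have h2 : ((∫ t in (0 : ℝ)..T, ‖v t‖ ^ 2 : ℝ) : ℂ) = ∑ i ∈ W, ∑ j ∈ W,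
      (inner ℂ (k i) (k j) * (Complex.exp (s * L i) * (starRingEnd ℂ) (Complex.exp (s * L j)))) *
        ∫ t in (0 : ℝ)..T, Complex.exp (t * Complex.I * (L i - (starRingEnd ℂ) (L j))) := by
    rw [← intervalIntegral.integral_ofReal]
    simp_rw [hnorm]
    have hci : ∀ i j, IntervalIntegrable (fun t : ℝ =>
      (inner ℂ (k i) (k j) * (Complex.exp (s * L i) * (starRingEnd ℂ) (Complex.exp (s * L j)))) *
        Complex.exp (t * Complex.I * (L i - (starRingEnd ℂ) (L j)))) volume 0 T := by
      intro i j
      refine Continuous.intervalIntegrable ?_ 0 T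
      fun_prop
    rw [intervalIntegral.integral_finsetSum]
    · refine Finset.sum_congr rfl fun i _ => ?_
      rw [intervalIntegral.integral_finsetSum fun j _ => hci i j]
      refine Finset.sum_congr rfl fun j _ => ?_
      rw [intervalIntegral.integral_const_mul]
    · intro i _
      refine Continuous.intervalIntegrable ?_ 0 T
      fun_prop
  have h3 : ∫ t in (0 : ℝ)..T, ‖v t‖ ^ 2 ≤ ‖((∫ t in (0 : ℝ)..T, ‖v t‖ ^ 2 : ℝ) : ℂ)‖ := by
    rw [Complex.norm_real]; exact Real.le_norm_self _
  refine h3.trans ?_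
  rw [h2]
  refine (norm_sum_le _ _).trans (Finset.sum_le_sum fun i hi => ?_)
  refine (norm_sum_le _ _).trans (Finset.sum_le_sum fun j hj => ?_)
  rw [norm_mul, norm_mul, norm_mul, RCLike.norm_conj, mul_assoc]
  have h4 := norm_integral_exp_le hT (B := 2 * B) (by positivity)
    (θ := L i - (starRingEnd ℂ) (L j)) (by
      have h5 := hL i hi
      have h6 := hL j hj
      have h7 := abs_add_le (L i).im (L j).im
      simp only [Complex.sub_im, Complex.conj_im, sub_neg_eq_add]
      nlinarith)
  simp only [Complex.sub_re, Complex.conj_re] at h4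
  gcongr

namespace SchottkyData

variable {m : ℕ} (X : SchottkyData m)

/-! ### The neighbourhoods `Ω(h)` -/

theorem isOpen_Omega (h : ℝ) : IsOpen (X.Omega h) := Metric.isOpen_thickening

theorem mem_Omega_iff {h : ℝ} {z : ℂ} : z ∈ X.Omega h ↔ ∃ p ∈ X.limitSet, ‖z - (p : ℂ)‖ < h := by
  rw [Omega, Metric.mem_thickening_iff]
  simp [dist_eq_norm]

theorem volume_Omega_ne_top (h : ℝ) : volume (X.Omega h) ≠ ∞ := by
  have h1 : Bornology.IsBounded ((fun x : ℝ => (x : ℂ)) '' X.limitSet) :=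
    (X.isCompact_limitSet.image Complex.continuous_ofReal).isBounded
  exact (h1.thickening).measure_lt_top.ne

/-- A point of `Λ` lies in some `γ_a(D_b)`, hence at distance at least `M⁻¹` from the boundary of
`D_a`. -/
theorem exists_ball_subset_disk {p : ℝ} (hp : p ∈ X.limitSet) :
    ∃ d, (p : ℂ) ∈ X.disk d ∧ Metric.ball (p : ℂ) X.bd⁻¹ ⊆ X.disk d := by
  obtain ⟨w, h1, h2, h3⟩ := X.exists_word_of_mem_limitSet hp (n := 2) (by norm_num)
  obtain ⟨a, b, rfl⟩ := List.length_eq_two.mp h2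
  have h4 : (p : ℂ) ∈ X.wordDisk ([a] ++ [b]) := h3
  obtain ⟨y, hy, e⟩ := X.mem_wordDisk_concat.mp h4
  have := X.bd_spec.margin a b h1 y (X.disk_subset_closedDisk _ hy)
  rw [e] at this
  exact ⟨a, this (Metric.mem_ball_self (inv_pos.mpr X.bd_pos)), this⟩

theorem exists_near_of_mem_Omega {h : ℝ} (hh : h ≤ X.bd⁻¹) {z : ℂ} (hz : z ∈ X.Omega h) :
    ∃ d, z ∈ X.disk d ∧ ∃ p ∈ X.limitSet, (p : ℂ) ∈ X.disk d ∧ ‖z - (p : ℂ)‖ < h := by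
  obtain ⟨p, hp, hzp⟩ := X.mem_Omega_iff.mp hz
  obtain ⟨d, h1, h2⟩ := X.exists_ball_subset_disk hp
  exact ⟨d, h2 (by rw [Metric.mem_ball, dist_eq_norm]; linarith), p, hp, h1, hzp⟩

theorem eq_of_mem_disk {a b : Fin m ⊕ Fin m} {z : ℂ} (ha : z ∈ X.disk a) (hb : z ∈ X.disk b) :
    a = b :=
  X.eq_of_mem_closedDisk (X.disk_subset_closedDisk _ ha) (X.disk_subset_closedDisk _ hb)

theorem exists_near_of_mem_Omega_disk {h : ℝ} (hh : h ≤ X.bd⁻¹) {z : ℂ} {d : Fin m ⊕ Fin m}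
    (hz : z ∈ X.Omega h ∩ X.disk d) :
    ∃ p ∈ X.limitSet, (p : ℂ) ∈ X.disk d ∧ ‖z - (p : ℂ)‖ < h := by
  obtain ⟨e, h1, h2⟩ := X.exists_near_of_mem_Omega hh hz.1
  rwa [← X.eq_of_mem_disk h1 hz.2]

theorem abs_im_lt_of_mem_Omega {h : ℝ} {z : ℂ} (hz : z ∈ X.Omega h) : |z.im| < h := by
  obtain ⟨p, -, hp⟩ := X.mem_Omega_iff.mp hz
  have := Complex.abs_im_le_norm (z - (p : ℂ))
  simp only [Complex.sub_im, Complex.ofReal_im, sub_zero] at this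
  linarith

/-- A word of small size maps `Ω(h) ∩ D_d` into the points of `Ω(h)` at distance at least `h / 2`
from the boundary. -/
theorem ball_wordMap_subset_Omega {h : ℝ} (hh : h ≤ X.bd⁻¹) {w : List (Fin m ⊕ Fin m)}
    {d : Fin m ⊕ Fin m} (hw : IsReduced (w ++ [d])) (hs : X.bd ^ 2 * X.size w ≤ 1 / 2) {z : ℂ}
    (hz : z ∈ X.Omega h ∩ X.disk d) : Metric.ball (X.wordMap w z) (h / 2) ⊆ X.Omega h := by
  obtain ⟨p, hp, hpd, hzp⟩ := X.exists_near_of_mem_Omega_disk hh hz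
  obtain ⟨y, hy, hyp⟩ := X.limitSet_invariant hw hp hpd
  have h1 := (X.norm_wordMap_sub_bounds hw hw (X.disk_subset_closedDisk _ hz.2)
    (X.disk_subset_closedDisk _ hpd)).2
  have h2 : ‖X.wordMap w z - (y : ℂ)‖ ≤ h / 2 := by
    rw [hyp]
    have := X.size_pos (isReduced_append.mp hw).1
    have := X.bd_pos
    calc _ ≤ _ := h1
      _ = X.bd ^ 2 * X.size w * ‖z - p‖ := by ring
      _ ≤ 1 / 2 * h := by gcongr
      _ = _ := by ring
  intro u hu
  rw [Metric.mem_ball, dist_eq_norm] at hu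
  refine X.mem_Omega_iff.mpr ⟨y, hy, ?_⟩
  have := norm_sub_le_norm_sub_add_norm_sub u (X.wordMap w z) (y : ℂ)
  linarith

theorem wordMap_mem_Omega {h : ℝ} (h0 : 0 < h) (hh : h ≤ X.bd⁻¹) {w : List (Fin m ⊕ Fin m)}
    {d : Fin m ⊕ Fin m} (hw : IsReduced (w ++ [d])) (hs : X.bd ^ 2 * X.size w ≤ 1 / 2) {z : ℂ}
    (hz : z ∈ X.Omega h ∩ X.disk d) : X.wordMap w z ∈ X.Omega h :=
  X.ball_wordMap_subset_Omega hh hw hs hz (Metric.mem_ball_self (by linarith))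

/-! ### Derivatives near the limit set -/

/-- If `u` is closer to the real than to the imaginary axis, the argument of `u⁻²` is at most a
constant times the angle of `u` with the real axis. -/
theorem abs_arg_inv_sq_le {u : ℂ} (hu : u.im ^ 2 < u.re ^ 2) :
    0 < (1 / u ^ 2).re ∧ |(1 / u ^ 2).arg| ≤ Real.pi * (|u.im| / ‖u‖) := by
  have hu0 : u ≠ 0 := by rintro rfl; simp at hu
  have hn : 0 < ‖u‖ := norm_pos_iff.mpr hu0
  have hre : 0 < (u ^ 2).re := by
    rw [sq, Complex.mul_re]; nlinarith
  have harg := Complex.abs_arg_lt_pi_div_two_iff.mpr (Or.inl hre)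
  have hpi := Real.pi_pos
  have hinv : (u ^ 2)⁻¹.arg = -(u ^ 2).arg := by
    rw [Complex.arg_inv, if_neg]
    intro h
    rw [h, abs_of_pos hpi] at harg
    linarith
  constructor
  · rw [one_div, Complex.inv_re]
    exact div_pos hre (Complex.normSq_pos.mpr (pow_ne_zero 2 hu0))
  · rw [one_div, hinv, abs_neg]
    have h1 := Real.mul_abs_le_abs_sin harg.le
    rw [Complex.sin_arg, abs_div, abs_of_nonneg (norm_nonneg (u ^ 2)), norm_pow] at h1
    have h2 : |(u ^ 2).im| ≤ 2 * ‖u‖ * |u.im| := by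
      have : (u ^ 2).im = 2 * u.re * u.im := by rw [sq, Complex.mul_im]; ring
      rw [this, abs_mul, abs_mul, abs_two]
      gcongr
      exact Complex.abs_re_le_norm u
    have h3 : 2 / Real.pi * |(u ^ 2).arg| ≤ 2 * (|u.im| / ‖u‖) := by
      refine h1.trans ?_
      rw [div_le_iff₀ (by positivity)]
      calc _ ≤ _ := h2
        _ = _ := by field_simp
    calc |(u ^ 2).arg| = Real.pi / 2 * (2 / Real.pi * |(u ^ 2).arg|) := by field_simp
      _ ≤ Real.pi / 2 * (2 * (|u.im| / ‖u‖)) := by gcongr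
      _ = _ := by ring

/-- The derivative is `(c (z - Q))⁻²` with real `c` and `Q`, and `z` has imaginary part less than
`h` while `|z - Q|` is bounded below. So on `Ω(h)` the derivative has small argument, and
the principal branch of its power is holomorphic. -/
theorem deriv_wordMap_re_pos_and_arg {h : ℝ} (hh : h ≤ X.bd⁻¹ / 2) {w : List (Fin m ⊕ Fin m)}
    {d : Fin m ⊕ Fin m} (hw : IsReduced (w ++ [d])) (hw0 : w ≠ []) {z : ℂ}
    (hz : z ∈ X.Omega h ∩ X.disk d) :
    0 < (deriv (X.wordMap w) z).re ∧ |(deriv (X.wordMap w) z).arg| ≤ Real.pi * X.bd * h := by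
  have hM := X.bd_pos
  have hr := (isReduced_append.mp hw).1
  have him := X.abs_im_lt_of_mem_Omega hz.1
  have hzc := X.disk_subset_closedDisk _ hz.2
  have hd := X.dist_pole hw hw0 hzc
  have hc := X.lower_ne_zero hr hw0
  have h0 : 0 < h := (abs_nonneg _).trans_lt him
  set u := (X.lower w : ℂ) * (z - X.pole w) with hu
  have hure : u.re = X.lower w * (z.re - X.pole w) := by simp [hu]
  have huim : u.im = X.lower w * z.im := by simp [hu]
  have hun : ‖u‖ = |X.lower w| * ‖z - X.pole w‖ := by
    rw [hu, norm_mul, Complex.norm_real, Real.norm_eq_abs]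
  -- The real part of `z - Q` dominates its imaginary part, because `h ≤ M⁻¹ / 2 ≤ |z - Q| / 2`.
  have hsq : z.im ^ 2 < (z.re - X.pole w) ^ 2 := by
    have h1 : ‖z - X.pole w‖ ^ 2 = (z.re - X.pole w) ^ 2 + z.im ^ 2 := by
      rw [← Complex.normSq_eq_norm_sq, Complex.normSq_apply]
      simp; ring
    have h2 : X.bd⁻¹ ^ 2 ≤ ‖z - X.pole w‖ ^ 2 := pow_le_pow_left₀ (by positivity) hd.1 2
    have h3 : z.im ^ 2 < h ^ 2 := by
      rw [← sq_abs z.im]; exact pow_lt_pow_left₀ him (abs_nonneg _) two_ne_zero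
    have h4 : h ^ 2 ≤ (X.bd⁻¹ / 2) ^ 2 := pow_le_pow_left₀ h0.le hh 2
    have h5 : 0 < X.bd⁻¹ ^ 2 := by positivity
    nlinarith
  have key := abs_arg_inv_sq_le (u := u) (by
    rw [hure, huim, mul_pow, mul_pow]
    have : 0 < X.lower w ^ 2 := by positivity
    exact mul_lt_mul_of_pos_left hsq this)
  rw [X.deriv_wordMap hw hzc, X.moebiusDenom_eq hr hw0]
  refine ⟨key.1, key.2.trans ?_⟩
  rw [mul_assoc]
  have h6 : |u.im| / ‖u‖ = |z.im| / ‖z - X.pole w‖ := by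
    rw [hun, huim, abs_mul, mul_div_mul_left _ _ (abs_ne_zero.mpr hc)]
  rw [h6]
  have hpos : 0 < ‖z - X.pole w‖ := (inv_pos.mpr hM).trans_le hd.1
  gcongr
  rw [div_le_iff₀ hpos]
  calc |z.im| ≤ h := him.le
    _ = X.bd * h * X.bd⁻¹ := by field_simp
    _ ≤ _ := by gcongr; exact hd.1

theorem deriv_wordMap_mem_slitPlane {h : ℝ} (hh : h ≤ X.bd⁻¹ / 2) {w : List (Fin m ⊕ Fin m)}
    {d : Fin m ⊕ Fin m} (hw : IsReduced (w ++ [d])) (hw0 : w ≠ []) {z : ℂ}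
    (hz : z ∈ X.Omega h ∩ X.disk d) : deriv (X.wordMap w) z ∈ Complex.slitPlane :=
  Complex.mem_slitPlane_iff.mpr (Or.inl (X.deriv_wordMap_re_pos_and_arg hh hw hw0 hz).1)

theorem differentiableOn_deriv_wordMap {w : List (Fin m ⊕ Fin m)}
    {d : Fin m ⊕ Fin m} (hw : IsReduced (w ++ [d])) :
    DifferentiableOn ℂ (deriv (X.wordMap w)) (X.disk d) := by
  have h1 : DifferentiableOn ℂ (X.wordMap w) (X.disk d) := fun z hz =>
    (hasDerivAt_moebius _ (X.moebiusDenom_ne_zero hw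
      (X.disk_subset_closedDisk _ hz))).differentiableAt.differentiableWithinAt
  exact h1.deriv Metric.isOpen_ball

theorem differentiableOn_wordMap {w : List (Fin m ⊕ Fin m)}
    {d : Fin m ⊕ Fin m} (hw : IsReduced (w ++ [d])) :
    DifferentiableOn ℂ (X.wordMap w) (X.disk d) := fun _ hz =>
  (hasDerivAt_moebius _ (X.moebiusDenom_ne_zero hw
    (X.disk_subset_closedDisk _ hz))).differentiableAt.differentiableWithinAt

theorem norm_log_deriv_le {w : List (Fin m ⊕ Fin m)} {d : Fin m ⊕ Fin m}
    (hw : IsReduced (w ++ [d])) {z : ℂ} (hz : z ∈ X.closedDisk d) :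
    ‖Complex.log (deriv (X.wordMap w) z)‖ ≤
      max |Real.log (X.bd⁻¹ ^ 2 * X.size w)| |Real.log (X.bd ^ 2 * X.size w)| + Real.pi := by
  have hb := X.norm_deriv_wordMap_bounds hw hz
  have hM := X.bd_pos
  have hs := X.size_pos (isReduced_append.mp hw).1
  have h0 : 0 < X.bd⁻¹ ^ 2 * X.size w := by positivity
  refine (Complex.norm_le_abs_re_add_abs_im _).trans ?_
  rw [Complex.log_re, Complex.log_im]
  refine add_le_add ?_ (Complex.abs_arg_le_pi _)
  exact abs_le_max_abs_abs (Real.log_le_log h0 hb.1)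
    (Real.log_le_log (h0.trans_le hb.1) hb.2)

/-! ### The sets `Y(τ)` and the transfer operators -/

/-- The words in `Y(τ)` have size comparable to `τ`: so have the words in `Z(τ)`, and both the
passage to the mirror word and the deletion of one letter change the size by a bounded factor. -/
theorem exists_mirrorResolutionSet_bounds : ∃ B τ₀ : ℝ, 1 ≤ B ∧ 0 < τ₀ ∧
    ∀ τ, 0 < τ → τ ≤ τ₀ → ∀ b ∈ X.mirrorResolutionSet τ,
      IsReduced b ∧ b ≠ [] ∧ B⁻¹ * τ ≤ X.size b ∧ X.size b ≤ B * τ := by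
  have hM := X.bd_pos
  have hM1 := X.one_le_bd
  refine ⟨2 * X.bd ^ 12, X.bd⁻¹ ^ 3 / 4, ?_, by positivity, ?_⟩
  · have := one_le_pow₀ hM1 (n := 12); linarith
  rintro τ hτ hτ' _ ⟨c, ⟨hr, hne, hdiam, hdrop⟩, rfl⟩
  obtain ⟨u, a, rfl⟩ := List.eq_nil_or_concat' c |>.resolve_left hne
  rw [List.dropLast_concat] at hdrop
  have hur := (isReduced_append.mp hr).1
  have hd1 := (X.diam_wordInterval_bounds hr).1
  have hu0 : u ≠ [] := by
    rintro rfl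
    rw [size_nil, mul_one] at hd1
    have : 0 < X.bd⁻¹ ^ 3 := by positivity
    linarith
  have hdrop' := hdrop.resolve_left hu0
  have hu1 : X.size u ≤ 2 * X.bd ^ 3 * τ := by
    calc X.size u = 2 * X.bd ^ 3 * (X.bd⁻¹ ^ 3 / 2 * X.size u) := by field_simp
      _ ≤ _ := by gcongr; linarith
  have hu2 : τ ≤ 2 * X.bd ^ 6 * X.size u := by
    obtain ⟨v, b, rfl⟩ := List.eq_nil_or_concat' u |>.resolve_left hu0
    have h1 := (X.diam_wordInterval_bounds hur).2
    have h2 := X.size_concat_ge hur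
    calc τ ≤ 2 * X.bd ^ 3 * X.size v := by linarith
      _ = 2 * X.bd ^ 6 * (X.bd⁻¹ ^ 3 * X.size v) := by field_simp
      _ ≤ _ := by gcongr
  have h3 := X.size_concat_ge hr
  have h4 := X.size_concat_le hr
  obtain ⟨c₁, c', hc⟩ := List.exists_cons_of_ne_nil (show u ++ [a] ≠ [] by simp)
  have hc0 : c' ≠ [] := by
    rintro rfl
    have := congrArg List.length hc
    simp at this
    exact hu0 this
  rw [hc] at hr h3 h4
  beta_reduce
  rw [hc, mirror_cons, List.dropLast_concat]
  have hc'r : IsReduced c' := (isReduced_cons.mp hr).2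
  have h5 := X.size_append (u := [c₁]) (v := c') hr
  have h6 := X.size_singleton c₁
  have hp := X.size_pos hc'r
  have h7 : X.bd⁻¹ ^ 3 * X.size c' ≤ X.size (c₁ :: c') := by
    refine le_trans ?_ h5.1
    calc _ = X.bd⁻¹ ^ 2 * (X.bd⁻¹ * X.size c') := by ring
      _ ≤ _ := by gcongr; exact h6.1
  have h8 : X.size (c₁ :: c') ≤ X.bd ^ 3 * X.size c' := by
    refine h5.2.trans ?_
    calc _ ≤ X.bd ^ 2 * (X.bd * X.size c') := by gcongr; exact h6.2
      _ = _ := by ring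
  refine ⟨isReduced_mirror hc'r, by simpa [mirror_eq_nil] using hc0, ?_, ?_⟩
  · rw [size_mirror, inv_mul_le_iff₀ (by positivity)]
    calc τ ≤ 2 * X.bd ^ 6 * X.size u := hu2
      _ = 2 * X.bd ^ 6 * (X.bd ^ 3 * (X.bd⁻¹ ^ 3 * X.size u)) := by field_simp
      _ ≤ 2 * X.bd ^ 6 * (X.bd ^ 3 * (X.bd ^ 3 * X.size c')) := by
          exact mul_le_mul_of_nonneg_left (mul_le_mul_of_nonneg_left (h3.trans h8) (by positivity))
            (by positivity)
      _ = _ := by ring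
  · rw [size_mirror]
    calc X.size c' = X.bd ^ 3 * (X.bd⁻¹ ^ 3 * X.size c') := by field_simp
      _ ≤ X.bd ^ 3 * (X.bd ^ 3 * (2 * X.bd ^ 3 * τ)) := by
          exact mul_le_mul_of_nonneg_left
            (h7.trans (h4.trans (mul_le_mul_of_nonneg_left hu1 (by positivity)))) (by positivity)
      _ = 2 * X.bd ^ 9 * τ := by ring
      _ ≤ _ := by gcongr; norm_num

/-- The properties of the words in `Y(τ)` on which the existence of the transfer operator and the
estimates rest, with a constant `B`. By the condition `small` the maps `γ_b` contract by a factor of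
at least `2`. -/
structure IsFineResolution (B τ : ℝ) : Prop where
  finite : (X.mirrorResolutionSet τ).Finite
  reduced : ∀ b ∈ X.mirrorResolutionSet τ, IsReduced b
  ne_nil : ∀ b ∈ X.mirrorResolutionSet τ, b ≠ []
  size_ge : ∀ b ∈ X.mirrorResolutionSet τ, B⁻¹ * τ ≤ X.size b
  size_le : ∀ b ∈ X.mirrorResolutionSet τ, X.size b ≤ B * τ
  small : ∀ b ∈ X.mirrorResolutionSet τ, X.bd ^ 2 * X.size b ≤ 1 / 2

theorem exists_isFineResolution (hm : 2 ≤ m) : ∃ B τ₀ : ℝ, 1 ≤ B ∧ 0 < τ₀ ∧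
    ∀ τ, 0 < τ → τ ≤ τ₀ → X.IsFineResolution B τ := by
  obtain ⟨B, τ₀, hB, hτ₀, H⟩ := X.exists_mirrorResolutionSet_bounds
  have hM := X.bd_pos
  refine ⟨B, min τ₀ (1 / (2 * X.bd ^ 2 * B)), hB, by positivity, fun τ hτ hle => ?_⟩
  have H' := H τ hτ (hle.trans (min_le_left _ _))
  have hle' := hle.trans (min_le_right _ _)
  refine ⟨?_, fun b hb => (H' b hb).1, fun b hb => (H' b hb).2.1, fun b hb => (H' b hb).2.2.1,
    fun b hb => (H' b hb).2.2.2, fun b hb => ?_⟩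
  · exact (X.finite_size_ge hm (r := B⁻¹ * τ) (by positivity)).subset
      fun b hb => ⟨(H' b hb).1, (H' b hb).2.2.1⟩
  · have hB0 : 0 < B := by linarith
    calc X.bd ^ 2 * X.size b ≤ X.bd ^ 2 * (B * (1 / (2 * X.bd ^ 2 * B))) := by
          gcongr
          exact (H' b hb).2.2.2.trans (by gcongr)
      _ = _ := by field_simp

variable {X}

/-- The defining sum is holomorphic on `Ω(h)` and bounded by the norm of `f`, as the points `γ_w(z)`
are at distance at least `h / 2` from the boundary of `Ω(h)`. -/
theorem IsFineResolution.isRefinedTransferOperator {B τ h : ℝ} (H : X.IsFineResolution B τ)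
    (h0 : 0 < h) (hh : h ≤ X.bd⁻¹ / 2) (s : ℂ) :
    X.IsRefinedTransferOperator τ h s (X.refinedTransferOperator τ h s) := by
  classical
  have hM := X.bd_pos
  have hi : 0 < X.bd⁻¹ := inv_pos.mpr hM
  have hh' : h ≤ X.bd⁻¹ := by linarith
  have hΩ := X.isOpen_Omega h
  suffices hex : ∃ L, X.IsRefinedTransferOperator τ h s L by
    rw [refinedTransferOperator, dif_pos hex]
    exact hex.choose_spec
  have hred : ∀ w ∈ X.mirrorResolutionSet τ, ∀ d, Precedes w d → IsReduced (w ++ [d]) :=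
    fun w hw d hd => isReduced_concat.mpr ⟨H.reduced w hw, hd⟩
  set Y := H.finite.toFinset with hY
  have memY : ∀ w, w ∈ Y ↔ w ∈ X.mirrorResolutionSet τ := fun w => H.finite.mem_toFinset
  set A : X.H2 h → ℂ → ℂ := fun f z => ∑ w ∈ Y, if ∃ d, z ∈ X.disk d ∧ Precedes w d then
    deriv (X.wordMap w) z ^ s * bergmanSpace.rep f (X.wordMap w z) else 0 with hA
  have hiff : ∀ (w : List (Fin m ⊕ Fin m)) (d) (z : ℂ), z ∈ X.disk d →
      ((∃ e, z ∈ X.disk e ∧ Precedes w e) ↔ Precedes w d) := by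
    intro w d z hz
    constructor
    · rintro ⟨e, h1, h2⟩
      rwa [X.eq_of_mem_disk hz h1]
    · exact fun h1 => ⟨d, hz, h1⟩
  have hAd : ∀ f d z, z ∈ X.disk d → A f z = ∑ w ∈ Y, if Precedes w d then
      deriv (X.wordMap w) z ^ s * bergmanSpace.rep f (X.wordMap w z) else 0 := by
    intro f d z hz
    refine Finset.sum_congr rfl fun w _ => ?_
    simp only [hiff w d z hz]
  have hmem : ∀ w ∈ Y, ∀ d, Precedes w d → ∀ z ∈ X.Omega h ∩ X.disk d,
      Metric.ball (X.wordMap w z) (h / 2) ⊆ X.Omega h := fun w hw d hd z hz =>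
    X.ball_wordMap_subset_Omega hh' (hred w ((memY w).mp hw) d hd) (H.small w ((memY w).mp hw)) hz
  have hmem' : ∀ w ∈ Y, ∀ d, Precedes w d → ∀ z ∈ X.Omega h ∩ X.disk d,
      X.wordMap w z ∈ X.Omega h := fun w hw d hd z hz =>
    hmem w hw d hd z hz (Metric.mem_ball_self (by linarith))
  have hdiff : ∀ f, DifferentiableOn ℂ (A f) (X.Omega h) := by
    intro f z hz
    obtain ⟨d, hzd, -⟩ := X.exists_near_of_mem_Omega hh' hz
    have hopen : IsOpen (X.Omega h ∩ X.disk d) := hΩ.inter Metric.isOpen_ball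
    have h1 : DifferentiableOn ℂ (fun z => ∑ w ∈ Y, if Precedes w d then
        deriv (X.wordMap w) z ^ s * bergmanSpace.rep f (X.wordMap w z) else 0)
        (X.Omega h ∩ X.disk d) := by
      refine DifferentiableOn.fun_sum fun w hw => ?_
      by_cases hp : Precedes w d
      · simp only [hp, if_true]
        have hr := hred w ((memY w).mp hw) d hp
        refine DifferentiableOn.mul ?_ ?_
        · refine DifferentiableOn.cpow
            ((X.differentiableOn_deriv_wordMap hr).mono Set.inter_subset_right)
            (differentiableOn_const s) fun z hz => ?_
          exact X.deriv_wordMap_mem_slitPlane hh hr (H.ne_nil w ((memY w).mp hw)) hz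
        · exact (bergmanSpace.differentiableOn_rep f).comp
            ((X.differentiableOn_wordMap hr).mono Set.inter_subset_right)
            (hmem' w hw d hp)
      · simp only [hp, if_false]
        exact differentiableOn_const 0
    have h2 := h1.differentiableAt (hopen.mem_nhds ⟨hz, hzd⟩)
    refine (h2.congr_of_eventuallyEq ?_).differentiableWithinAt
    filter_upwards [hopen.mem_nhds ⟨hz, hzd⟩] with y hy
    exact hAd f d y hy.2
  set K : List (Fin m ⊕ Fin m) → ℝ := fun w => Real.exp (‖s‖ *
    (max |Real.log (X.bd⁻¹ ^ 2 * X.size w)| |Real.log (X.bd ^ 2 * X.size w)| + Real.pi)) with hK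
  have hbound : ∀ f, ∀ z ∈ X.Omega h, ‖A f z‖ ≤ (∑ w ∈ Y, K w * (h / 2)⁻¹) * ‖f‖ := by
    intro f z hz
    obtain ⟨d, hzd, -⟩ := X.exists_near_of_mem_Omega hh' hz
    rw [hAd f d z hzd, Finset.sum_mul]
    refine (norm_sum_le _ _).trans (Finset.sum_le_sum fun w hw => ?_)
    by_cases hp : Precedes w d
    · simp only [hp, if_true]
      have hr := hred w ((memY w).mp hw) d hp
      have hne : deriv (X.wordMap w) z ≠ 0 := Complex.slitPlane_ne_zero
        (X.deriv_wordMap_mem_slitPlane hh hr (H.ne_nil w ((memY w).mp hw)) ⟨hz, hzd⟩)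
      rw [norm_mul, mul_assoc]
      gcongr
      · rw [Complex.cpow_def_of_ne_zero hne, Complex.norm_exp]
        refine Real.exp_le_exp.mpr ((Complex.re_le_norm _).trans ?_)
        rw [norm_mul, mul_comm]
        gcongr
        exact X.norm_log_deriv_le hr (X.disk_subset_closedDisk _ hzd)
      · exact bergmanSpace.norm_rep_le f (by linarith) (hmem w hw d hp z ⟨hz, hzd⟩)
    · simp only [hp, if_false, norm_zero]
      have : 0 < K w := Real.exp_pos _
      positivity
  obtain ⟨L, hL⟩ := bergmanSpace.exists_operator hΩ (X.volume_Omega_ne_top h) A hdiff hbound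
    (by
      intro f g z hz
      obtain ⟨d, hzd, -⟩ := X.exists_near_of_mem_Omega hh' hz
      rw [Pi.add_apply, hAd _ d z hzd, hAd _ d z hzd, hAd _ d z hzd, ← Finset.sum_add_distrib]
      refine Finset.sum_congr rfl fun w hw => ?_
      by_cases hp : Precedes w d
      · simp only [hp, if_true]
        rw [bergmanSpace.rep_add hΩ f g (hmem' w hw d hp z ⟨hz, hzd⟩), Pi.add_apply, mul_add]
      · simp [hp])
    (by
      intro c f z hz
      obtain ⟨d, hzd, -⟩ := X.exists_near_of_mem_Omega hh' hz
      rw [Pi.smul_apply, hAd _ d z hzd, hAd _ d z hzd, Finset.smul_sum]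
      refine Finset.sum_congr rfl fun w hw => ?_
      by_cases hp : Precedes w d
      · simp only [hp, if_true]
        rw [bergmanSpace.rep_smul hΩ c f (hmem' w hw d hp z ⟨hz, hzd⟩), Pi.smul_apply,
          smul_eq_mul, smul_eq_mul]
        ring
      · simp [hp])
  refine ⟨L, H.finite, fun hc => H.ne_nil _ hc rfl, ?_, ?_, ?_⟩
  · intro z hz
    obtain ⟨d, hzd, -⟩ := X.exists_near_of_mem_Omega hh' hz
    exact Set.mem_iUnion.mpr ⟨d, hzd⟩
  · exact fun b w hw hp z hz => hmem' w ((memY w).mpr hw) b hp z hz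
  · intro f b z hz
    rw [hL f hz.1, hAd f b z hz.2, ← Finset.sum_filter, ← finsum_mem_coe_finset]
    exact finsum_mem_congr (by ext w; simp [memY]) fun _ _ => rfl

variable (X)

/-- The pairs of words `(a, b)` with `a ∈ Y(τ₁)`, `b ∈ Y(τ₀)` that contribute to the composed
operator on `D_d`. -/
def wordPairs (τ₀ τ₁ : ℝ) (d : Fin m ⊕ Fin m) :
    Set (List (Fin m ⊕ Fin m) × List (Fin m ⊕ Fin m)) :=
  {q | q.1 ∈ X.mirrorResolutionSet τ₁ ∧ q.2 ∈ X.mirrorResolutionSet τ₀ ∧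
    IsReduced (q.1 ++ q.2) ∧ Precedes q.2 d}

/-- A branch of the logarithm of the derivative of `γ_a γ_b`, for a pair `(a, b)`. It is the sum of
two principal logarithms, as the two factors `γ_b'(z) ^ s` and `γ_a'(γ_b(z)) ^ s` of a term of the
composed operator are principal powers. -/
noncomputable def logDeriv (q : List (Fin m ⊕ Fin m) × List (Fin m ⊕ Fin m)) (z : ℂ) : ℂ :=
  Complex.log (deriv (X.wordMap q.2) z) +
    Complex.log (deriv (X.wordMap q.1) (X.wordMap q.2 z))

variable {X}

theorem IsFineResolution.finite_wordPairs {B τ₀ τ₁ : ℝ} (H₀ : X.IsFineResolution B τ₀)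
    (H₁ : X.IsFineResolution B τ₁) (d : Fin m ⊕ Fin m) : (X.wordPairs τ₀ τ₁ d).Finite :=
  (H₁.finite.prod H₀.finite).subset fun _ hq => ⟨hq.1, hq.2.1⟩

theorem isReduced_of_mem_wordPairs {τ₀ τ₁ : ℝ} {d : Fin m ⊕ Fin m}
    {q : List (Fin m ⊕ Fin m) × List (Fin m ⊕ Fin m)} (hq : q ∈ X.wordPairs τ₀ τ₁ d)
    (hne : q.2 ≠ []) : IsReduced (q.1 ++ q.2 ++ [d]) := by
  obtain ⟨b, e, hbe⟩ := List.eq_nil_or_concat' q.2 |>.resolve_left hne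
  have h := hq.2.2
  refine isReduced_concat.mpr ⟨h.1, ?_⟩
  rw [Precedes, List.getLast?_append_of_ne_nil _ hne]
  exact h.2

theorem precedes_of_isReduced_append {a b : List (Fin m ⊕ Fin m)} {e : Fin m ⊕ Fin m}
    (hb : b.head? = some e) (ha : IsReduced a) (hbr : IsReduced b) :
    IsReduced (a ++ b) ↔ Precedes a e := by
  rw [isReduced_append, hb]
  simp [ha, hbr, Precedes]

/-- The composed operator is a sum over pairs of words `(a, b)`: if `b` starts with the letter `e`,
then `γ_b(z)` lies in `D_e`, and the condition `a → e` says that `a b` is reduced. -/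
theorem IsFineResolution.composed_apply {B τ₀ τ₁ h : ℝ} (H₀ : X.IsFineResolution B τ₀)
    (H₁ : X.IsFineResolution B τ₁) (h0 : 0 < h) (hh : h ≤ X.bd⁻¹ / 2) (s : ℂ) (f : X.H2 h)
    {d : Fin m ⊕ Fin m} {z : ℂ} (hz : z ∈ X.Omega h ∩ X.disk d) :
    bergmanSpace.rep (X.composedTransferOperator τ₀ τ₁ h s f) z =
      ∑ q ∈ (H₀.finite_wordPairs H₁ d).toFinset,
        Complex.exp (s * X.logDeriv q z) * bergmanSpace.rep f (X.wordMap (q.1 ++ q.2) z) := by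
  classical
  have hi : 0 < X.bd⁻¹ := inv_pos.mpr X.bd_pos
  have hh' : h ≤ X.bd⁻¹ := by linarith
  have L₀ := H₀.isRefinedTransferOperator h0 hh s
  have L₁ := H₁.isRefinedTransferOperator h0 hh s
  have hzc := X.disk_subset_closedDisk _ hz.2
  have hfin : ∀ {τ} (H : X.IsFineResolution B τ) (e : Fin m ⊕ Fin m)
      (g : List (Fin m ⊕ Fin m) → ℂ),
      ∑ᶠ w ∈ {w | w ∈ X.mirrorResolutionSet τ ∧ Precedes w e}, g w =
        ∑ w ∈ H.finite.toFinset, if Precedes w e then g w else 0 := by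
    intro τ H e g
    rw [← Finset.sum_filter, ← finsum_mem_coe_finset]
    exact finsum_mem_congr (by ext w; simp) fun _ _ => rfl
  rw [composedTransferOperator, ContinuousLinearMap.comp_apply, L₀.apply_eq _ d z hz, hfin H₀]
  have hset : (H₀.finite_wordPairs H₁ d).toFinset =
      (H₁.finite.toFinset ×ˢ H₀.finite.toFinset).filter
        (fun q => IsReduced (q.1 ++ q.2) ∧ Precedes q.2 d) := by
    ext q
    simp [wordPairs, and_assoc]
  rw [hset, Finset.sum_filter, Finset.sum_product_right]
  refine Finset.sum_congr rfl fun b hb => ?_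
  have hbY : b ∈ X.mirrorResolutionSet τ₀ := H₀.finite.mem_toFinset.mp hb
  by_cases hp : Precedes b d
  swap
  · simp [hp]
  have hbr := H₀.reduced b hbY
  have hbd : IsReduced (b ++ [d]) := isReduced_concat.mpr ⟨hbr, hp⟩
  have hb0 := H₀.ne_nil b hbY
  obtain ⟨e, b', hbe⟩ := List.exists_cons_of_ne_nil hb0
  have hyd : X.wordMap b z ∈ X.disk e := by
    rw [hbe]; exact X.wordMap_mem_disk (hbe ▸ hbd) hzc
  have hyΩ : X.wordMap b z ∈ X.Omega h := X.wordMap_mem_Omega h0 hh' hbd (H₀.small b hbY) hz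
  have hne : deriv (X.wordMap b) z ≠ 0 :=
    Complex.slitPlane_ne_zero (X.deriv_wordMap_mem_slitPlane hh hbd hb0 hz)
  simp only [hp, and_true, if_true]
  rw [L₁.apply_eq f e _ ⟨hyΩ, hyd⟩, hfin H₁, Finset.mul_sum]
  refine Finset.sum_congr rfl fun a ha => ?_
  have haY : a ∈ X.mirrorResolutionSet τ₁ := H₁.finite.mem_toFinset.mp ha
  have hiff := precedes_of_isReduced_append (a := a) (b := b) (e := e) (by simp [hbe])
    (H₁.reduced a haY) hbr
  by_cases hae : Precedes a e
  swap
  · simp [hae, hiff]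
  have har : IsReduced (a ++ [e]) := isReduced_concat.mpr ⟨H₁.reduced a haY, hae⟩
  have hne' : deriv (X.wordMap a) (X.wordMap b z) ≠ 0 :=
    Complex.slitPlane_ne_zero
      (X.deriv_wordMap_mem_slitPlane hh har (H₁.ne_nil a haY) ⟨hyΩ, hyd⟩)
  simp only [hae, hiff, if_true]
  rw [X.wordMap_append hbd hzc, Complex.cpow_def_of_ne_zero hne, Complex.cpow_def_of_ne_zero hne',
    ← mul_assoc, ← Complex.exp_add, logDeriv]
  congr 2
  ring

/-- For a pair with concatenation `w` and `z ∈ Ω(h) ∩ D_d`: the point `γ_w(z)` is deep inside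
`Ω(h)`, and the logarithm of the derivative has imaginary part of order `h` and the real part given
by the size and the pole of `w`. -/
theorem IsFineResolution.wordPairs_facts {B τ₀ τ₁ h : ℝ} (H₀ : X.IsFineResolution B τ₀)
    (H₁ : X.IsFineResolution B τ₁) (h0 : 0 < h) (hh : h ≤ X.bd⁻¹ / 2)
    {d : Fin m ⊕ Fin m} {q : List (Fin m ⊕ Fin m) × List (Fin m ⊕ Fin m)}
    (hq : q ∈ X.wordPairs τ₀ τ₁ d) {z : ℂ} (hz : z ∈ X.Omega h ∩ X.disk d) :
    Metric.ball (X.wordMap (q.1 ++ q.2) z) (h / 2) ⊆ X.Omega h ∧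
      |(X.logDeriv q z).im| ≤ 2 * Real.pi * X.bd * h ∧
      (X.logDeriv q z).re =
        Real.log (X.size (q.1 ++ q.2)) - 2 * Real.log ‖z - X.pole (q.1 ++ q.2)‖ ∧
      ContinuousAt (X.logDeriv q) z := by
  obtain ⟨a, b⟩ := q
  obtain ⟨haY, hbY, hab, hp⟩ := hq
  have hi : 0 < X.bd⁻¹ := inv_pos.mpr X.bd_pos
  have hh' : h ≤ X.bd⁻¹ := by linarith
  have hzc := X.disk_subset_closedDisk _ hz.2
  simp only at haY hbY hab hp
  have hbr := H₀.reduced b hbY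
  have hbd : IsReduced (b ++ [d]) := isReduced_concat.mpr ⟨hbr, hp⟩
  have hb0 := H₀.ne_nil b hbY
  have ha0 := H₁.ne_nil a haY
  have habd : IsReduced (a ++ b ++ [d]) :=
    isReduced_of_mem_wordPairs (q := (a, b)) ⟨haY, hbY, hab, hp⟩ hb0
  obtain ⟨e, b', hbe⟩ := List.exists_cons_of_ne_nil hb0
  have hyd : X.wordMap b z ∈ X.disk e := by
    rw [hbe]; exact X.wordMap_mem_disk (hbe ▸ hbd) hzc
  have hyΩ : X.wordMap b z ∈ X.Omega h := X.wordMap_mem_Omega h0 hh' hbd (H₀.small b hbY) hz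
  have har : IsReduced (a ++ [e]) := isReduced_concat.mpr ⟨H₁.reduced a haY,
    (precedes_of_isReduced_append (by simp [hbe]) (H₁.reduced a haY) hbr).mp hab⟩
  have sb := X.deriv_wordMap_mem_slitPlane hh hbd hb0 hz
  have sa := X.deriv_wordMap_mem_slitPlane hh har ha0 ⟨hyΩ, hyd⟩
  have nb := X.moebiusDenom_ne_zero hbd hzc
  have na := X.moebiusDenom_ne_zero har (X.disk_subset_closedDisk _ hyd)
  refine ⟨?_, ?_, ?_, ?_⟩
  · rw [X.wordMap_append hbd hzc]
    exact X.ball_wordMap_subset_Omega hh' har (H₁.small a haY) ⟨hyΩ, hyd⟩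
  · rw [logDeriv, Complex.add_im, Complex.log_im, Complex.log_im]
    refine (abs_add_le _ _).trans ?_
    have h1 := (X.deriv_wordMap_re_pos_and_arg hh hbd hb0 hz).2
    have h2 := (X.deriv_wordMap_re_pos_and_arg hh har ha0 ⟨hyΩ, hyd⟩).2
    simp only
    linarith
  · have h1 := X.norm_moebiusDenom_sq (isReduced_append.mp habd).1 (by simp [ha0]) z
    rw [wordElement_append, moebiusDenom_mul _ _ nb, norm_mul, mul_pow] at h1
    have h2 : moebius (X.wordElement b) z = X.wordMap b z := rfl
    rw [h2] at h1
    have hs := X.size_pos (isReduced_append.mp habd).1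
    have hdp := X.dist_pole habd (by simp [ha0]) hzc
    have hdp0 : 0 < ‖z - X.pole (a ++ b)‖ := hi.trans_le hdp.1
    rw [logDeriv, Complex.add_re, Complex.log_re, Complex.log_re]
    simp only
    rw [X.deriv_wordMap hbd hzc, X.deriv_wordMap har (X.disk_subset_closedDisk _ hyd), norm_div,
      norm_div, norm_one, norm_pow, norm_pow, one_div, one_div, Real.log_inv, Real.log_inv,
      ← neg_add, ← Real.log_mul (by positivity) (by positivity), mul_comm, h1,
      Real.log_mul (by positivity) (by positivity), Real.log_inv, Real.log_pow]
    push_cast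
    ring
  · have c1 : ContinuousAt (deriv (X.wordMap b)) z :=
      ((X.differentiableOn_deriv_wordMap hbd).differentiableAt
        (Metric.isOpen_ball.mem_nhds hz.2)).continuousAt
    have c2 : ContinuousAt (X.wordMap b) z :=
      ((X.differentiableOn_wordMap hbd).differentiableAt
        (Metric.isOpen_ball.mem_nhds hz.2)).continuousAt
    have c3 : ContinuousAt (deriv (X.wordMap a)) (X.wordMap b z) :=
      ((X.differentiableOn_deriv_wordMap har).differentiableAt
        (Metric.isOpen_ball.mem_nhds hyd)).continuousAt
    have c4 : ContinuousAt (fun y => deriv (X.wordMap a) (X.wordMap b y)) z :=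
      ContinuousAt.comp (f := X.wordMap b) (g := deriv (X.wordMap a)) c3 c2
    exact (c1.clog sb).add (c4.clog sa)

end SchottkyData

namespace SchottkyData

variable {m : ℕ} {X : SchottkyData m}

/-! ### Pieces of `Ω(h)` and the words that send a point to the same piece -/

theorem IsStop.abs_sub_le_of_mem {r : ℝ} {p : List (Fin m ⊕ Fin m)} (hp : X.IsStop r p)
    (hr : r < 1) {x y : ℝ} (hx : x ∈ X.wordInterval p) (hy : y ∈ X.wordInterval p) :
    |x - y| ≤ 2 * X.bd ^ 6 * r := by
  obtain ⟨u, a, rfl⟩ := List.eq_nil_or_concat' p |>.resolve_left (hp.ne_nil hr)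
  have hM := X.bd_pos
  calc |x - y| ≤ 2 * X.bd ^ 3 * X.size u := X.abs_sub_le_of_mem_wordInterval hp.1 hx hy
    _ = 2 * X.bd ^ 6 * (X.bd⁻¹ ^ 3 * X.size u) := by field_simp
    _ ≤ 2 * X.bd ^ 6 * r := by
        gcongr
        exact (X.size_concat_ge hp.1).trans hp.2.1

variable (X)

/-- Points of `Ω(h)` whose distance is a large multiple of `h` lie in different clopen pieces of
`Ω(h)`: the points of `Λ` in `I_p`, for a word `p` of size about `h`, are at distance at least
`2 h` from the rest of `Λ`. -/
theorem exists_separation_Omega (hm : 2 ≤ m) {h : ℝ} (h0 : 0 < h)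
    (hh : X.bd ^ 3 * (2 * h) < 1) {y y' : ℂ} (hy : y ∈ X.Omega h) (hy' : y' ∈ X.Omega h)
    (hyy : (4 * X.bd ^ 9 + 2) * h < ‖y - y'‖) :
    ∃ U V : Set ℂ, IsOpen U ∧ IsOpen V ∧ Disjoint U V ∧ X.Omega h = U ∪ V ∧ y ∈ U ∧ y' ∈ V := by
  have hM := X.bd_pos
  obtain ⟨x, hx, hyx⟩ := X.mem_Omega_iff.mp hy
  obtain ⟨x', hx', hyx'⟩ := X.mem_Omega_iff.mp hy'
  obtain ⟨p, hp, hxp⟩ := X.exists_stop_of_mem_limitSet hm hx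
    (r := X.bd ^ 3 * (2 * h)) (by positivity) hh
  have hmem : ∀ (S : Set ℝ) (z : ℂ), z ∈ Metric.thickening h ((fun x : ℝ => (x : ℂ)) '' S) ↔
      ∃ x ∈ S, ‖z - (x : ℂ)‖ < h := by
    intro S z
    rw [Metric.mem_thickening_iff]
    simp [dist_eq_norm]
  refine ⟨Metric.thickening h ((fun x : ℝ => (x : ℂ)) '' (X.limitSet ∩ X.wordInterval p)),
    Metric.thickening h ((fun x : ℝ => (x : ℂ)) '' (X.limitSet \ X.wordInterval p)),
    Metric.isOpen_thickening, Metric.isOpen_thickening, ?_, ?_, ?_, ?_⟩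
  · refine Set.disjoint_left.mpr fun z hz hz' => ?_
    obtain ⟨u, hu, hzu⟩ := (hmem _ _).mp hz
    obtain ⟨v, hv, hzv⟩ := (hmem _ _).mp hz'
    refine hv.2 (X.mem_wordInterval_of_near hv.1 hh hp hu.2 ?_)
    have h1 : ‖(u : ℂ) - v‖ ≤ ‖(u : ℂ) - z‖ + ‖z - v‖ := norm_sub_le_norm_sub_add_norm_sub _ _ _
    rw [norm_sub_rev (u : ℂ) z, ← Complex.ofReal_sub, Complex.norm_real, Real.norm_eq_abs] at h1
    linarith
  · rw [Omega, ← Metric.thickening_union, ← Set.image_union, Set.inter_union_sdiff]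
  · exact (hmem _ _).mpr ⟨x, ⟨hx, hxp⟩, hyx⟩
  · refine (hmem _ _).mpr ⟨x', ⟨hx', fun hc => ?_⟩, hyx'⟩
    have h1 := hp.abs_sub_le_of_mem hh hxp hc
    have h2 : ‖y - y'‖ ≤ ‖y - x‖ + (‖(x : ℂ) - x'‖ + ‖(x' : ℂ) - y'‖) :=
      (norm_sub_le_norm_sub_add_norm_sub y x y').trans
        (by gcongr; exact norm_sub_le_norm_sub_add_norm_sub _ _ _)
    rw [norm_sub_rev (x' : ℂ) y', ← Complex.ofReal_sub, Complex.norm_real,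
      Real.norm_eq_abs] at h2
    have h3 : 2 * X.bd ^ 6 * (X.bd ^ 3 * (2 * h)) = 4 * X.bd ^ 9 * h := by ring
    linarith

/-- If two words send a point to almost the same point, they share a long prefix. -/
theorem prefix_of_wordMap_near {w w' p : List (Fin m ⊕ Fin m)} {d : Fin m ⊕ Fin m}
    (hw : IsReduced (w ++ [d])) (hw' : IsReduced (w' ++ [d])) {z : ℂ} (hz : z ∈ X.disk d) {r : ℝ}
    (hp : X.IsStop (X.bd ^ 3 * r) p) (hpw : p <+: w)
    (hr : ‖X.wordMap w z - X.wordMap w' z‖ ≤ r) (hs : X.size w' ≤ X.bd ^ 3 * r) : p <+: w' := by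
  have key : ∀ q, q <+: p → q ≠ p → q ≠ w' := by
    rintro q hq hne rfl
    exact absurd (hp.2.2 q hq hne) (not_lt.mpr hs)
  have h1 := X.prefix_or_of_near hw hw' (X.mem_wordDisk_concat.mpr ⟨z, hz, rfl⟩)
    (X.mem_wordDisk_concat.mpr ⟨z, hz, rfl⟩) hr (hpw.trans (List.prefix_append _ _)) hp.2.2
  have h2 : w' ++ [d] <+: p → False := fun h =>
    key w' ((List.prefix_append _ _).trans h) (by
      rintro rfl
      have := h.length_le
      simp at this) rfl
  rcases h1 with h1 | h1
  · rcases List.prefix_concat_iff.mp h1 with h3 | h3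
    · exact (h2 (by rw [h3])).elim
    · exact h3
  · exact (h2 h1).elim

/-- The part of `Ω(h)` in `D_d` is covered by disks of radius comparable to `h` with centres in
the intervals `I_p`, one for each word `p` of size about `h`. -/
theorem exists_cover_Omega (hm : 2 ≤ m) {h : ℝ} (h0 : 0 < h) (h1 : h < 1) (hh : h ≤ X.bd⁻¹)
    (d : Fin m ⊕ Fin m) :
    ∃ (F : Finset (List (Fin m ⊕ Fin m))) (x : List (Fin m ⊕ Fin m) → ℝ),
      (∀ p ∈ F, X.IsStop h p ∧ x p ∈ X.wordInterval p ∧ (x p : ℂ) ∈ X.disk d) ∧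
      ∀ z ∈ X.Omega h ∩ X.disk d, ∃ p ∈ F, ‖z - x p‖ ≤ (2 * X.bd ^ 6 + 1) * h := by
  classical
  have hch : ∀ p, ∃ x : ℝ, (∃ y, y ∈ X.wordInterval p ∧ (y : ℂ) ∈ X.disk d) →
      x ∈ X.wordInterval p ∧ (x : ℂ) ∈ X.disk d := by
    intro p
    by_cases hp : ∃ y, y ∈ X.wordInterval p ∧ (y : ℂ) ∈ X.disk d
    · exact ⟨hp.choose, fun _ => hp.choose_spec⟩
    · exact ⟨0, fun hc => (hp hc).elim⟩
  choose x hx using hch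
  refine ⟨(X.finite_isStop hm h0 h1).toFinset.filter
    (fun p => ∃ y, y ∈ X.wordInterval p ∧ (y : ℂ) ∈ X.disk d), x, fun p hp => ?_,
    fun z hz => ?_⟩
  · rw [Finset.mem_filter, Set.Finite.mem_toFinset] at hp
    exact ⟨hp.1, hx p hp.2⟩
  · obtain ⟨y, hy, hyd, hzy⟩ := X.exists_near_of_mem_Omega_disk hh hz
    obtain ⟨p, hp, hyp⟩ := X.exists_stop_of_mem_limitSet hm hy h0 h1
    refine ⟨p, Finset.mem_filter.mpr ⟨(Set.Finite.mem_toFinset _).mpr hp, y, hyp, hyd⟩, ?_⟩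
    have h2 := hp.abs_sub_le_of_mem h1 hyp (hx p ⟨y, hyp, hyd⟩).1
    have h3 := norm_sub_le_norm_sub_add_norm_sub z (y : ℂ) (x p : ℂ)
    rw [← Complex.ofReal_sub, Complex.norm_real, Real.norm_eq_abs] at h3
    linarith

/-! ### The phase -/

/-- The difference of the values of `log |γ_w'|` and `log |γ_w''|` at `z`, in terms of the poles
and the sizes of the words. -/
noncomputable def phase (w w' : List (Fin m ⊕ Fin m)) (z : ℂ) : ℝ :=
  2 * (Real.log ‖z - X.pole w'‖ - Real.log ‖z - X.pole w‖) +
    (Real.log (X.size w) - Real.log (X.size w'))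

theorem abs_log_sub_log_le {M a b : ℝ} (hM : 0 < M) (ha : M⁻¹ ≤ a) (hb : M⁻¹ ≤ b) :
    |Real.log a - Real.log b| ≤ M * |a - b| := by
  have hi : 0 < M⁻¹ := inv_pos.mpr hM
  have key : ∀ {a b : ℝ}, M⁻¹ ≤ a → M⁻¹ ≤ b → Real.log a - Real.log b ≤ M * |a - b| := by
    intro a b ha hb
    have ha0 := hi.trans_le ha
    have hb0 := hi.trans_le hb
    rw [← Real.log_div ha0.ne' hb0.ne']
    calc Real.log (a / b) ≤ a / b - 1 := Real.log_le_sub_one_of_pos (by positivity)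
      _ = b⁻¹ * (a - b) := by field_simp
      _ ≤ b⁻¹ * |a - b| := by gcongr; exact le_abs_self _
      _ ≤ M * |a - b| := by gcongr; exact inv_le_of_inv_le₀ hM hb
  exact abs_sub_le_iff.mpr ⟨key ha hb, by rw [abs_sub_comm]; exact key hb ha⟩

/-- The phase is Lipschitz, since `z` and `x` stay away from the poles. -/
theorem abs_phase_sub_le {w w' : List (Fin m ⊕ Fin m)} {d : Fin m ⊕ Fin m}
    (hw : IsReduced (w ++ [d])) (hw' : IsReduced (w' ++ [d])) (hne : w ≠ []) (hne' : w' ≠ [])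
    {z x : ℂ} (hz : z ∈ X.closedDisk d) (hx : x ∈ X.closedDisk d) :
    |X.phase w w' z - X.phase w w' x| ≤ 4 * X.bd * ‖z - x‖ := by
  have hM := X.bd_pos
  have key : ∀ {v : List (Fin m ⊕ Fin m)}, IsReduced (v ++ [d]) → v ≠ [] →
      |Real.log ‖z - X.pole v‖ - Real.log ‖x - X.pole v‖| ≤ X.bd * ‖z - x‖ := by
    intro v hv hv0
    refine (abs_log_sub_log_le hM (X.dist_pole hv hv0 hz).1 (X.dist_pole hv hv0 hx).1).trans ?_
    gcongr
    refine (abs_norm_sub_norm_le _ _).trans (le_of_eq ?_)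
    congr 1
    ring
  have h1 := abs_le.mp (key hw hne)
  have h2 := abs_le.mp (key hw' hne')
  rw [phase, phase, abs_le]
  constructor <;> linarith [h1.1, h1.2, h2.1, h2.2]

/-- The decay factor is comparable at points at distance of order `T⁻¹`. -/
theorem inv_one_add_phase_le {w w' : List (Fin m ⊕ Fin m)} {d : Fin m ⊕ Fin m}
    (hw : IsReduced (w ++ [d])) (hw' : IsReduced (w' ++ [d])) (hne : w ≠ []) (hne' : w' ≠ [])
    {z x : ℂ} (hz : z ∈ X.closedDisk d) (hx : x ∈ X.closedDisk d) {T c : ℝ} (hT : 0 < T)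
    (hzx : ‖z - x‖ ≤ c * T⁻¹) :
    (1 + T * |X.phase w w' z|)⁻¹ ≤ (1 + 4 * X.bd * c) * (1 + T * |X.phase w w' x|)⁻¹ := by
  have hM := X.bd_pos
  have h1 := X.abs_phase_sub_le hw hw' hne hne' hz hx
  have hc : 0 ≤ c := by
    have := (norm_nonneg _).trans hzx
    exact nonneg_of_mul_nonneg_left this (inv_pos.mpr hT)
  have h2 : |X.phase w w' x| ≤ |X.phase w w' z| + 4 * X.bd * (c * T⁻¹) := by
    have h3 : 4 * X.bd * ‖z - x‖ ≤ 4 * X.bd * (c * T⁻¹) := by gcongr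
    have h4 := abs_sub_abs_le_abs_sub (X.phase w w' x) (X.phase w w' z)
    rw [abs_sub_comm (X.phase w w' x)] at h4
    linarith
  have h5 : T * |X.phase w w' x| ≤ T * |X.phase w w' z| + 4 * X.bd * c := by
    calc _ ≤ T * (|X.phase w w' z| + 4 * X.bd * (c * T⁻¹)) := by gcongr
      _ = _ := by field_simp
  have h6 : 0 ≤ T * |X.phase w w' z| := by positivity
  have h7 : 0 ≤ 4 * X.bd * c := by positivity
  rw [inv_le_iff_one_le_mul₀ (by positivity), mul_comm, ← mul_assoc, ← div_eq_mul_inv,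
    le_div_iff₀ (by positivity)]
  nlinarith

/-! ### The Hilbert-Schmidt norm of the composed operator -/

/-- As `a ≤ 0`, the real part of `s` may be replaced by a lower bound `σ`. -/
theorem norm_exp_mul_le {s l : ℂ} {σ a : ℝ} (hσ : σ ≤ s.re) (h0 : 0 ≤ σ) (hl : l.re ≤ a)
    (ha : a ≤ 0) : ‖Complex.exp (s * l)‖ ≤ Real.exp (σ * a + |s.im| * |l.im|) := by
  rw [Complex.norm_exp, Complex.mul_re]
  refine Real.exp_le_exp.mpr ?_
  have h1 : s.re * l.re ≤ σ * l.re := mul_le_mul_of_nonpos_right hσ (hl.trans ha)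
  have h2 : σ * l.re ≤ σ * a := mul_le_mul_of_nonneg_left hl h0
  have h3 : -(s.im * l.im) ≤ |s.im| * |l.im| := by
    rw [← abs_mul]; exact neg_le_abs _
  linarith

variable {X}

/-- The Hilbert-Schmidt norm of the composed operators, in terms of the evaluation functionals at
the images of the points of `Ω(h)`. -/
theorem IsFineResolution.lintegral_hsNormSq_le {B τ₀ τ₁ h : ℝ} (H₀ : X.IsFineResolution B τ₀)
    (H₁ : X.IsFineResolution B τ₁) (h0 : 0 < h) (hh : h ≤ X.bd⁻¹ / 2) :
    ∃ k : ℂ → List (Fin m ⊕ Fin m) × List (Fin m ⊕ Fin m) → X.H2 h,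
      (∀ d, ∀ q ∈ X.wordPairs τ₀ τ₁ d, ∀ z ∈ X.Omega h ∩ X.disk d, ‖k z q‖ ≤ (h / 2)⁻¹ ∧
        ∀ f, inner ℂ (k z q) f = bergmanSpace.rep f (X.wordMap (q.1 ++ q.2) z)) ∧
      ∀ s : ℝ → ℂ, Continuous s → ∀ I : Set ℝ,
        AEMeasurable (fun t => hsNormSq (X.composedTransferOperator τ₀ τ₁ h (s t)))
          (volume.restrict I) ∧
        ∫⁻ t in I, hsNormSq (X.composedTransferOperator τ₀ τ₁ h (s t)) ≤
          ∑ d, ∫⁻ z in X.Omega h ∩ X.disk d, ∫⁻ t in I,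
            ‖∑ q ∈ (H₀.finite_wordPairs H₁ d).toFinset,
              (starRingEnd ℂ) (Complex.exp (s t * X.logDeriv q z)) • k z q‖ₑ ^ 2 := by
  classical
  have hi : 0 < X.bd⁻¹ := inv_pos.mpr X.bd_pos
  have hh' : h ≤ X.bd⁻¹ := by linarith
  have hΩ := X.isOpen_Omega h
  have hch : ∀ (z : ℂ) (q : List (Fin m ⊕ Fin m) × List (Fin m ⊕ Fin m)), ∃ k : X.H2 h,
      Metric.ball (X.wordMap (q.1 ++ q.2) z) (h / 2) ⊆ X.Omega h → ‖k‖ ≤ (h / 2)⁻¹ ∧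
        ∀ f, inner ℂ k f = bergmanSpace.rep f (X.wordMap (q.1 ++ q.2) z) := by
    intro z q
    by_cases hb : Metric.ball (X.wordMap (q.1 ++ q.2) z) (h / 2) ⊆ X.Omega h
    · obtain ⟨k, hk⟩ := bergmanSpace.exists_kernel hΩ (by linarith) hb
      exact ⟨k, fun _ => hk⟩
    · exact ⟨0, fun hc => (hb hc).elim⟩
  choose k hk using hch
  have hk' : ∀ d, ∀ q ∈ X.wordPairs τ₀ τ₁ d, ∀ z ∈ X.Omega h ∩ X.disk d, ‖k z q‖ ≤ (h / 2)⁻¹ ∧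
      ∀ f, inner ℂ (k z q) f = bergmanSpace.rep f (X.wordMap (q.1 ++ q.2) z) :=
    fun d q hq z hz => hk z q (H₀.wordPairs_facts H₁ h0 hh hq hz).1
  refine ⟨k, hk', fun s hs I => ?_⟩
  set l : ℝ → ℂ → X.H2 h := fun t z => ∑ d, if z ∈ X.disk d then
    ∑ q ∈ (H₀.finite_wordPairs H₁ d).toFinset,
      (starRingEnd ℂ) (Complex.exp (s t * X.logDeriv q z)) • k z q else 0 with hl
  have hld : ∀ t d, ∀ z ∈ X.disk d, l t z = ∑ q ∈ (H₀.finite_wordPairs H₁ d).toFinset,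
      (starRingEnd ℂ) (Complex.exp (s t * X.logDeriv q z)) • k z q := by
    intro t d z hz
    rw [hl]
    simp only
    rw [Finset.sum_eq_single d, if_pos hz]
    · intro e _ he
      exact if_neg fun hze => he (X.eq_of_mem_disk hze hz)
    · simp
  have hcover : X.Omega h ⊆ ⋃ d, X.Omega h ∩ X.disk d := by
    intro z hz
    obtain ⟨d, hd, -⟩ := X.exists_near_of_mem_Omega hh' hz
    exact Set.mem_iUnion.mpr ⟨d, hz, hd⟩
  have hrep : ∀ (t : ℝ) d, ∀ z ∈ X.Omega h ∩ X.disk d, ∀ f,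
      bergmanSpace.rep (X.composedTransferOperator τ₀ τ₁ h (s t) f) z =
        ∑ q ∈ (H₀.finite_wordPairs H₁ d).toFinset,
        Complex.exp (s t * X.logDeriv q z) * bergmanSpace.rep f (X.wordMap (q.1 ++ q.2) z) :=
    fun t d z hz f => H₀.composed_apply H₁ h0 hh (s t) f hz
  obtain ⟨h1, h2⟩ := bergmanSpace.lintegral_hsNormSq hΩ
    (fun t => X.composedTransferOperator τ₀ τ₁ h (s t)) l
    (by
      intro t z hz f
      obtain ⟨d, hd⟩ := Set.mem_iUnion.mp (hcover hz)
      rw [hrep t d z hd, hld t d z hd.2, sum_inner]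
      refine Finset.sum_congr rfl fun q hq => ?_
      refine Eq.trans ?_ (inner_smul_left (k z q) f _).symm
      rw [Complex.conj_conj, (hk' d q ((Set.Finite.mem_toFinset _).mp hq) z hd).2])
    (by
      rintro f ⟨t, z⟩ ⟨-, hz⟩
      obtain ⟨d, hd⟩ := Set.mem_iUnion.mp (hcover hz)
      have hopen : IsOpen (X.Omega h ∩ X.disk d) := hΩ.inter Metric.isOpen_ball
      refine ContinuousAt.continuousWithinAt ?_
      have hev : (fun p : ℝ × ℂ => ∑ q ∈ (H₀.finite_wordPairs H₁ d).toFinset,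
          Complex.exp (s p.1 * X.logDeriv q p.2) *
            bergmanSpace.rep f (X.wordMap (q.1 ++ q.2) p.2)) =ᶠ[𝓝 (t, z)]
          fun p => bergmanSpace.rep (X.composedTransferOperator τ₀ τ₁ h (s p.1) f) p.2 := by
        filter_upwards [(hopen.preimage continuous_snd).mem_nhds hd] with p hp
        exact (hrep p.1 d p.2 hp f).symm
      refine ContinuousAt.congr ?_ hev
      refine tendsto_finsetSum _ fun q hq => ?_
      have hqm := (Set.Finite.mem_toFinset _).mp hq
      obtain ⟨hb, -, -, hc⟩ := H₀.wordPairs_facts H₁ h0 hh hqm hd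
      have hqr := isReduced_of_mem_wordPairs hqm (H₀.ne_nil _ hqm.2.1)
      have c1 : ContinuousAt (fun p : ℝ × ℂ => X.logDeriv q p.2) (t, z) :=
        ContinuousAt.comp (f := Prod.snd) (g := X.logDeriv q) hc continuousAt_snd
      have c2 : ContinuousAt (X.wordMap (q.1 ++ q.2)) z :=
        ((X.differentiableOn_wordMap hqr).differentiableAt
          (Metric.isOpen_ball.mem_nhds hd.2)).continuousAt
      have c3 : ContinuousAt (bergmanSpace.rep f) (X.wordMap (q.1 ++ q.2) z) :=
        ((bergmanSpace.differentiableOn_rep f).differentiableAt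
          (hΩ.mem_nhds (hb (Metric.mem_ball_self (by linarith))))).continuousAt
      have c4 : ContinuousAt (fun y => bergmanSpace.rep f (X.wordMap (q.1 ++ q.2) y)) z :=
        ContinuousAt.comp (f := X.wordMap (q.1 ++ q.2)) (g := bergmanSpace.rep f) c3 c2
      have c5 : ContinuousAt
          (fun p : ℝ × ℂ => bergmanSpace.rep f (X.wordMap (q.1 ++ q.2) p.2)) (t, z) :=
        ContinuousAt.comp (f := Prod.snd)
          (g := fun y => bergmanSpace.rep f (X.wordMap (q.1 ++ q.2) y)) c4 continuousAt_snd
      exact (((hs.continuousAt.comp continuousAt_fst).mul c1).cexp).mul c5) I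
  refine ⟨h1, h2.le.trans ((lintegral_mono_set hcover).trans
    ((lintegral_iUnion_le _ _).trans ?_))⟩
  rw [tsum_fintype]
  refine Finset.sum_le_sum fun d _ => le_of_eq ?_
  refine setLIntegral_congr_fun (hΩ.inter Metric.isOpen_ball).measurableSet fun z hz => ?_
  simp only [hld _ d z hz.2]

end SchottkyData

namespace SchottkyData

variable {m : ℕ} {X : SchottkyData m}

/-! ### Pairs of words that share a prefix -/

variable (X) in
/-- The words `w` and `w'` have the same prefix of size about `r`. -/
def SharePrefix (r : ℝ) (w w' : List (Fin m ⊕ Fin m)) : Prop :=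
  ∃ p, X.IsStop r p ∧ p <+: w ∧ p <+: w'

/-- Words that share no prefix of size about `ρ ≥ (4 M⁹ + 2) h` send `z` to points at distance a
large multiple of `h`, which lie in different clopen pieces of `Ω(h)`; so the kernels at these
points are orthogonal. -/
theorem IsFineResolution.inner_kernel_eq_zero (hm : 2 ≤ m) {B τ₀ τ₁ h ρ : ℝ}
    (H₀ : X.IsFineResolution B τ₀) (H₁ : X.IsFineResolution B τ₁) (h0 : 0 < h)
    (hh : h ≤ X.bd⁻¹ / 2) (hh2 : X.bd ^ 3 * (2 * h) < 1) (hρ : (4 * X.bd ^ 9 + 2) * h ≤ ρ)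
    (hρ' : B * τ₀ ≤ X.bd ^ 3 * ρ) {d : Fin m ⊕ Fin m}
    {q q' : List (Fin m ⊕ Fin m) × List (Fin m ⊕ Fin m)} (hq : q ∈ X.wordPairs τ₀ τ₁ d)
    (hq' : q' ∈ X.wordPairs τ₀ τ₁ d)
    (hqq : ¬ X.SharePrefix (X.bd ^ 3 * ρ) (q.1 ++ q.2) (q'.1 ++ q'.2)) {z : ℂ}
    (hz : z ∈ X.Omega h ∩ X.disk d) {k k' : X.H2 h}
    (hk : ∀ f, inner ℂ k f = bergmanSpace.rep f (X.wordMap (q.1 ++ q.2) z))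
    (hk' : ∀ f, inner ℂ k' f = bergmanSpace.rep f (X.wordMap (q'.1 ++ q'.2) z)) :
    inner ℂ k k' = 0 := by
  have hsize : ∀ q ∈ X.wordPairs τ₀ τ₁ d, X.size (q.1 ++ q.2) ≤ X.bd ^ 3 * ρ := by
    intro q hq
    have h1 := (X.size_append hq.2.2.1).2
    have h2 := H₁.small _ hq.1
    have h3 := X.size_pos (H₀.reduced _ hq.2.1)
    have h4 := H₀.size_le _ hq.2.1
    nlinarith
  have hr := isReduced_of_mem_wordPairs hq (H₀.ne_nil _ hq.2.1)
  have hr' := isReduced_of_mem_wordPairs hq' (H₀.ne_nil _ hq'.2.1)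
  have hmem : ∀ q ∈ X.wordPairs τ₀ τ₁ d, X.wordMap (q.1 ++ q.2) z ∈ X.Omega h := fun q hq =>
    (H₀.wordPairs_facts H₁ h0 hh hq hz).1 (Metric.mem_ball_self (by linarith))
  have hfar : (4 * X.bd ^ 9 + 2) * h <
      ‖X.wordMap (q.1 ++ q.2) z - X.wordMap (q'.1 ++ q'.2) z‖ := by
    by_contra hc
    obtain ⟨p, hpw, hp⟩ := X.exists_stop_prefix (isReduced_append.mp hr).1 (hsize q hq)
    exact hqq ⟨p, hp, hpw, X.prefix_of_wordMap_near hr hr' hz.2 hp hpw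
      ((not_lt.mp hc).trans hρ) (hsize q' hq')⟩
  obtain ⟨U, V, hU, hV, hUV, hΩ, hyU, hyV⟩ :=
    X.exists_separation_Omega hm h0 hh2 (hmem q hq) (hmem q' hq') hfar
  exact bergmanSpace.inner_kernel_eq_zero hU hV hUV hΩ hyU hyV hk hk'

variable (X)

open Classical in
/-- The sum over pairs of words sharing a prefix of size about `T⁻¹`, and over the words of size
about `T⁻¹`, that bounds the mean square of the Hilbert-Schmidt norm. -/
theorem exists_phase_sum_bound (hm : 2 ≤ m) {η : ℝ} (hη : 0 < η) {B : ℝ} (hB : 1 ≤ B) :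
    ∃ C : ℝ, 1 ≤ C ∧ ∀ (T τ₀ τ₁ r : ℝ) (d : Fin m ⊕ Fin m)
      (W : Finset (List (Fin m ⊕ Fin m) × List (Fin m ⊕ Fin m)))
      (F : Finset (List (Fin m ⊕ Fin m))) (x : List (Fin m ⊕ Fin m) → ℝ), 1 < T →
      0 < τ₀ → 0 < τ₁ → B⁻¹ * T⁻¹ ≤ τ₀ → τ₀ ≤ B * T⁻¹ → B⁻¹ * T⁻¹ ≤ τ₁ → r ≤ B * T⁻¹ →
      (∀ q ∈ W, IsReduced (q.1 ++ q.2 ++ [d]) ∧ q.1 ++ q.2 ≠ [] ∧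
        B⁻¹ * (τ₀ * τ₁) ≤ X.size (q.1 ++ q.2) ∧ X.size (q.1 ++ q.2) ≤ B * (τ₀ * τ₁)) →
      (∀ p ∈ F, X.IsStop T⁻¹ p ∧ x p ∈ X.wordInterval p ∧ (x p : ℂ) ∈ X.disk d) →
      ∑ q ∈ W, ∑ q' ∈ W with X.SharePrefix r (q.1 ++ q.2) (q'.1 ++ q'.2),
        ∑ p ∈ F, (1 + T * |X.phase (q.1 ++ q.2) (q'.1 ++ q'.2) (x p)|)⁻¹ ≤
        C * ((τ₀ * τ₁) ^ (-(X.delta + 3 * η)) * T ^ (X.delta + 3 * η)) := by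
  have hδ0 := X.delta_nonneg
  have hδ1 := X.delta_le_one
  have hM := X.bd_pos
  have hM1 := X.one_le_bd
  have hB0 : 0 < B := by linarith
  have hs : X.delta < X.delta + η := by linarith
  obtain ⟨C₁, hC₁, H₁⟩ := X.exists_phase_bound hm hs
  obtain ⟨C₂, hC₂, H₂⟩ := X.exists_pair_sum_bound hm hs hB
  obtain ⟨C₃, hC₃, H₃⟩ := X.exists_length_bound hm hη
  obtain ⟨C₄, hC₄, H₄⟩ := X.exists_card_bound hm hs
  have hBp : 1 ≤ B ^ (X.delta + 3 * η) := Real.one_le_rpow hB (by linarith)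
  refine ⟨C₁ * X.bd ^ 3 * C₂ * C₃ * C₃ * C₄ * B ^ (X.delta + 3 * η), ?_, ?_⟩
  · have h1 : 1 ≤ X.bd ^ 3 := one_le_pow₀ hM1
    exact one_le_mul_of_one_le_of_one_le (one_le_mul_of_one_le_of_one_le
      (one_le_mul_of_one_le_of_one_le (one_le_mul_of_one_le_of_one_le
      (one_le_mul_of_one_le_of_one_le (one_le_mul_of_one_le_of_one_le hC₁ h1) hC₂) hC₃) hC₃) hC₄)
      hBp
  intro T τ₀ τ₁ r d W F x hT hτ₀ hτ₁ h1 h2 h3 hr hW hF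
  have hT0 : 0 < T := by linarith
  have hc : 0 < B⁻¹ * (τ₀ * τ₁) := by positivity
  set g : List (Fin m ⊕ Fin m) × List (Fin m ⊕ Fin m) → List (Fin m ⊕ Fin m) :=
    fun q => q.1 ++ q.2 with hg
  set J : List (Fin m ⊕ Fin m) → List (Fin m ⊕ Fin m) → ℝ :=
    fun w w' => ∑ p ∈ F, (1 + T * |X.phase w w' (x p)|)⁻¹ with hJ
  have hJ0 : ∀ w w', 0 ≤ J w w' := fun w w' => Finset.sum_nonneg fun p _ => by positivity
  set N : ℝ := C₃ * (B⁻¹ * (τ₀ * τ₁)) ^ (-η) with hN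
  have hN0 : 0 ≤ N := by positivity
  have hI : ∀ w ∈ W.image g, IsReduced (w ++ [d]) ∧ w ≠ [] ∧ B⁻¹ * (τ₀ * τ₁) ≤ X.size w ∧
      X.size w ≤ B * (τ₀ * τ₁) := by
    intro w hw
    obtain ⟨q, hq, rfl⟩ := Finset.mem_image.mp hw
    exact hW q hq
  -- A word is the concatenation of at most `length + 1` pairs.
  have hfib : ∀ S ⊆ W, ∀ w ∈ W.image g, ((S.filter fun q => g q = w).card : ℝ) ≤ N := by
    intro S hS w hw
    obtain ⟨hw1, -, hw3, -⟩ := hI w hw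
    have hwr := (isReduced_append.mp hw1).1
    have h4 : (S.filter fun q => g q = w).card ≤ w.length + 1 := by
      rw [← Finset.card_range (w.length + 1)]
      refine Finset.card_le_card_of_injOn (fun q => q.1.length) ?_ ?_
      · intro q hq
        have h5 : q.1 ++ q.2 = w := (Finset.mem_filter.mp hq).2
        have h6 := congrArg List.length h5
        rw [List.length_append] at h6
        simp only [Finset.coe_range, Set.mem_Iio]
        omega
      · intro q hq q' hq' hl
        have h5 : q.1 ++ q.2 = w := (Finset.mem_filter.mp hq).2
        have h6 : q'.1 ++ q'.2 = w := (Finset.mem_filter.mp hq').2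
        have h7 := List.append_inj (h5.trans h6.symm) hl
        exact Prod.ext h7.1 h7.2
    calc ((S.filter fun q => g q = w).card : ℝ) ≤ w.length + 1 := by exact_mod_cast h4
      _ ≤ C₃ * X.size w ^ (-η) := H₃ w hwr
      _ ≤ N := by
        rw [hN]
        refine mul_le_mul_of_nonneg_left ?_ (by linarith)
        exact Real.rpow_le_rpow_of_nonpos hc hw3 (by linarith)
  have hsumle : ∀ S ⊆ W, ∀ f : List (Fin m ⊕ Fin m) → ℝ, (∀ w, 0 ≤ f w) →
      ∑ q ∈ S, f (g q) ≤ N * ∑ w ∈ S.image g, f w := by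
    intro S hS f hf
    rw [Finset.sum_comp, Finset.mul_sum]
    refine Finset.sum_le_sum fun w hw => ?_
    rw [nsmul_eq_mul]
    exact mul_le_mul_of_nonneg_right (hfib S hS w (Finset.image_subset_image hS hw)) (hf w)
  have hrow : ∀ w ∈ W.image g, ∑ w' ∈ (W.image g) with X.SharePrefix r w w', J w w' ≤
      C₁ * X.bd ^ 3 * (C₂ * T ^ (X.delta + 3 * η)) := by
    intro w hw
    obtain ⟨hw1, hw2, hw3, hw4⟩ := hI w hw
    have hwr := (isReduced_append.mp hw1).1
    by_cases hne : ∃ w' ∈ W.image g, X.SharePrefix r w w'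
    swap
    · rw [Finset.sum_eq_zero]
      · positivity
      · intro w' hw'
        exact (hne ⟨w', (Finset.mem_filter.mp hw').1, (Finset.mem_filter.mp hw').2⟩).elim
    obtain ⟨-, -, p, hp, hpw, -⟩ := hne
    have hrw : ∑ w' ∈ (W.image g) with X.SharePrefix r w w', J w w' = C₁ * X.bd ^ 3 *
        ∑ w' ∈ (W.image g) with X.SharePrefix r w w', (C₁ * X.bd ^ 3)⁻¹ * J w w' := by
      rw [← Finset.mul_sum, mul_inv_cancel_left₀ (by positivity)]
    rw [hrw]
    refine mul_le_mul_of_nonneg_left ?_ (by positivity)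
    have h5 := H₂ T τ₀ τ₁ p w
      ((W.image g).filter (fun w' => X.SharePrefix r w w')) (fun w' => (C₁ * X.bd ^ 3)⁻¹ * J w w') hT.le hτ₀ hτ₁ h1
      h2 h3 hwr hw3 hw4 hp.1 (hp.2.1.trans hr)
      (by
        intro w' hw'
        obtain ⟨hw'I, p', hp', hpw', hpw''⟩ := Finset.mem_filter.mp hw'
        obtain ⟨hv1, hv2, hv3, hv4⟩ := hI w' hw'I
        have hvr := (isReduced_append.mp hv1).1
        -- The prefix shared with `w'` is the stopping word `p` of `w`, the same for all `w'`.
        have hpp : p = p' := by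
          rcases List.prefix_or_prefix_of_prefix hpw hpw' with h | h
          · exact hp.eq_of_prefix hp' h
          · exact (hp'.eq_of_prefix hp h).symm
        have hb := H₁ T d (X.pole w) (X.pole w') (Real.log (X.size w) - Real.log (X.size w')) F x
          hT (fun z hz => X.dist_pole hw1 hw2 hz) (fun z hz => X.dist_pole hv1 hv2 hz) hF
        have hJe : J w w' = ∑ p ∈ F, (1 + T * |2 * (Real.log |x p - X.pole w'| -
            Real.log |x p - X.pole w|) + (Real.log (X.size w) - Real.log (X.size w'))|)⁻¹ := by
          refine Finset.sum_congr rfl fun p _ => ?_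
          rw [phase, ← Complex.ofReal_sub, ← Complex.ofReal_sub, Complex.norm_real,
            Complex.norm_real, Real.norm_eq_abs, Real.norm_eq_abs]
        rw [← hJe] at hb
        have hMp : 1 ≤ X.bd ^ 3 := one_le_pow₀ hM1
        refine ⟨hvr, hpp ▸ hpw'', hv3, by have := hJ0 w w'; positivity, ?_, ?_⟩
        · rw [inv_mul_le_iff₀ (by positivity)]
          refine hb.1.trans ?_
          gcongr
          nlinarith
        · intro v a b t t' hab ht ht'
          have hred : IsReduced (v ++ a :: t) := ht ▸ isReduced_mirror hvr
          have hred' : IsReduced (v ++ b :: t') := ht' ▸ isReduced_mirror hwr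
          -- The poles are the points `γ(∞)` of the mirror words, so they are separated by the size
          -- of the common prefix `v` of these.
          have hgap := X.gap_imageInfty hab hred hred'
          rw [← ht, ← ht'] at hgap
          have hv0 := X.size_pos (isReduced_append.mp hred).1
          have hgap' : X.bd⁻¹ ^ 3 * X.size v ≤ |X.pole w - X.pole w'| := by
            rw [abs_sub_comm]; exact hgap
          have hpos : 0 < X.bd⁻¹ ^ 3 * X.size v := by positivity
          have h6 := hb.2 (fun hc => by
            rw [hc, sub_self, abs_zero] at hgap'
            linarith)
          rw [inv_mul_le_iff₀ (by positivity)]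
          refine h6.trans ?_
          have h7 : |X.pole w - X.pole w'| ^ (-X.delta) ≤ X.bd ^ 3 * X.size v ^ (-X.delta) := by
            calc _ ≤ (X.bd⁻¹ ^ 3 * X.size v) ^ (-X.delta) :=
                  Real.rpow_le_rpow_of_nonpos hpos hgap' (by linarith)
              _ = (X.bd ^ 3) ^ X.delta * X.size v ^ (-X.delta) := by
                  rw [Real.mul_rpow (by positivity) hv0.le, inv_pow, Real.inv_rpow (by positivity),
                    Real.rpow_neg (by positivity), inv_inv]
              _ ≤ _ := by
                  gcongr
                  exact (Real.rpow_le_rpow_of_exponent_le hMp hδ1).trans (by rw [Real.rpow_one])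
          calc C₁ * (T ^ (X.delta + η - X.delta) * |X.pole w - X.pole w'| ^ (-X.delta))
              ≤ C₁ * (T ^ (X.delta + η - X.delta) * (X.bd ^ 3 * X.size v ^ (-X.delta))) := by
                gcongr
            _ = _ := by ring)
    have h6 : X.delta + 3 * (X.delta + η - X.delta) = X.delta + 3 * η := by ring
    rwa [h6] at h5
  have hcard : ((W.image g).card : ℝ) ≤ C₄ * (B⁻¹ * (τ₀ * τ₁)) ^ (-(X.delta + η)) := by
    have h5 := H₄ [] (W.image g) (B⁻¹ * (τ₀ * τ₁)) (by simp [IsReduced]) hc fun w hw =>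
      ⟨(isReduced_append.mp (hI w hw).1).1, List.nil_prefix, (hI w hw).2.2.1⟩
    rwa [size_nil, one_div, Real.inv_rpow hc.le, ← Real.rpow_neg hc.le] at h5
  calc ∑ q ∈ W, ∑ q' ∈ W with X.SharePrefix r (q.1 ++ q.2) (q'.1 ++ q'.2), J (g q) (g q')
      ≤ ∑ q ∈ W, N * ∑ w' ∈ (W.image g) with X.SharePrefix r (g q) w', J (g q) w' := by
        refine Finset.sum_le_sum fun q _ => ?_
        refine (hsumle _ (Finset.filter_subset _ _) (J (g q)) (hJ0 _)).trans ?_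
        refine mul_le_mul_of_nonneg_left ?_ hN0
        refine Finset.sum_le_sum_of_subset_of_nonneg ?_ fun w' _ _ => hJ0 _ _
        intro w' hw'
        obtain ⟨q', hq', rfl⟩ := Finset.mem_image.mp hw'
        obtain ⟨h5, h6⟩ := Finset.mem_filter.mp hq'
        exact Finset.mem_filter.mpr ⟨Finset.mem_image_of_mem _ h5, h6⟩
    _ ≤ N * ∑ w ∈ W.image g, N * ∑ w' ∈ (W.image g) with X.SharePrefix r w w', J w w' :=
        hsumle W subset_rfl
          (fun w => N * ∑ w' ∈ (W.image g) with X.SharePrefix r w w', J w w')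
          fun w => mul_nonneg hN0 (Finset.sum_nonneg fun w' _ => hJ0 _ _)
    _ ≤ N * ∑ _w ∈ W.image g, N * (C₁ * X.bd ^ 3 * (C₂ * T ^ (X.delta + 3 * η))) := by
        refine mul_le_mul_of_nonneg_left (Finset.sum_le_sum fun w hw => ?_) hN0
        exact mul_le_mul_of_nonneg_left (hrow w hw) hN0
    _ = N * ((W.image g).card * (N * (C₁ * X.bd ^ 3 * (C₂ * T ^ (X.delta + 3 * η))))) := by
        rw [Finset.sum_const, nsmul_eq_mul]
    _ ≤ N * (C₄ * (B⁻¹ * (τ₀ * τ₁)) ^ (-(X.delta + η)) *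
          (N * (C₁ * X.bd ^ 3 * (C₂ * T ^ (X.delta + 3 * η))))) := by
        gcongr
    _ = C₁ * X.bd ^ 3 * C₂ * C₃ * C₃ * C₄ * ((B⁻¹ * (τ₀ * τ₁)) ^ (-η) *
          (B⁻¹ * (τ₀ * τ₁)) ^ (-η) * (B⁻¹ * (τ₀ * τ₁)) ^ (-(X.delta + η))) *
          T ^ (X.delta + 3 * η) := by rw [hN]; ring
    _ = _ := by
        rw [← Real.rpow_add hc, ← Real.rpow_add hc,
          show -η + -η + -(X.delta + η) = -(X.delta + 3 * η) by ring,
          Real.mul_rpow (by positivity) (by positivity), Real.inv_rpow hB0.le,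
          Real.rpow_neg hB0.le, inv_inv]
        ring

end SchottkyData

namespace SchottkyData

variable {m : ℕ} {X : SchottkyData m}

/-! ### Mean values of the Hilbert-Schmidt norm -/

theorem IsFineResolution.logDeriv_bounds {B τ₀ τ₁ h : ℝ} (H₀ : X.IsFineResolution B τ₀)
    (H₁ : X.IsFineResolution B τ₁) (h0 : 0 < h) (hh : h ≤ X.bd⁻¹ / 2)
    {d : Fin m ⊕ Fin m} {q : List (Fin m ⊕ Fin m) × List (Fin m ⊕ Fin m)}
    (hq : q ∈ X.wordPairs τ₀ τ₁ d) {z : ℂ} (hz : z ∈ X.Omega h ∩ X.disk d) :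
    (X.logDeriv q z).re ≤ Real.log (X.bd ^ 2 * X.size (q.1 ++ q.2)) ∧
      -(|Real.log (X.size (q.1 ++ q.2))| + 2 * Real.log X.bd) ≤ (X.logDeriv q z).re := by
  have hr := isReduced_of_mem_wordPairs hq (H₀.ne_nil _ hq.2.1)
  have hd := X.dist_pole hr (by simp [H₀.ne_nil _ hq.2.1]) (X.disk_subset_closedDisk _ hz.2)
  have hM := X.bd_pos
  have hi : 0 < X.bd⁻¹ := inv_pos.mpr hM
  have hs := X.size_pos (isReduced_append.mp hr).1
  have h1 := Real.log_le_log hi hd.1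
  have h2 := Real.log_le_log (hi.trans_le hd.1) hd.2
  rw [Real.log_inv] at h1
  rw [(H₀.wordPairs_facts H₁ h0 hh hq hz).2.2.1, Real.log_mul (by positivity) hs.ne',
    Real.log_pow]
  have h3 := neg_abs_le (Real.log (X.size (q.1 ++ q.2)))
  push_cast
  constructor <;> linarith

theorem IsFineResolution.size_bounds {B τ₀ τ₁ : ℝ} (hB : 0 < B) (h0 : 0 < τ₀) (h1 : 0 < τ₁)
    (H₀ : X.IsFineResolution B τ₀) (H₁ : X.IsFineResolution B τ₁) {d : Fin m ⊕ Fin m}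
    {q : List (Fin m ⊕ Fin m) × List (Fin m ⊕ Fin m)} (hq : q ∈ X.wordPairs τ₀ τ₁ d) :
    (X.bd ^ 2 * B ^ 2)⁻¹ * (τ₀ * τ₁) ≤ X.size (q.1 ++ q.2) ∧
      X.size (q.1 ++ q.2) ≤ X.bd ^ 2 * B ^ 2 * (τ₀ * τ₁) ∧
      X.bd ^ 2 * X.size (q.1 ++ q.2) ≤ 1 := by
  have hM := X.bd_pos
  have hs := X.size_append hq.2.2.1
  have p1 := X.size_pos (H₁.reduced _ hq.1)
  have p2 := X.size_pos (H₀.reduced _ hq.2.1)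
  have l1 := H₁.size_ge _ hq.1
  have l2 := H₀.size_ge _ hq.2.1
  have u1 := H₁.size_le _ hq.1
  have u2 := H₀.size_le _ hq.2.1
  have s1 := H₁.small _ hq.1
  have s2 := H₀.small _ hq.2.1
  refine ⟨?_, ?_, ?_⟩
  · calc _ = X.bd⁻¹ ^ 2 * (B⁻¹ * τ₁ * (B⁻¹ * τ₀)) := by field_simp
      _ ≤ X.bd⁻¹ ^ 2 * (X.size q.1 * X.size q.2) := by gcongr
      _ ≤ _ := hs.1
  · calc _ ≤ X.bd ^ 2 * (X.size q.1 * X.size q.2) := hs.2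
      _ ≤ X.bd ^ 2 * (B * τ₁ * (B * τ₀)) := by gcongr
      _ = _ := by ring
  · calc _ ≤ X.bd ^ 2 * (X.bd ^ 2 * (X.size q.1 * X.size q.2)) := by gcongr; exact hs.2
      _ = (X.bd ^ 2 * X.size q.1) * (X.bd ^ 2 * X.size q.2) := by ring
      _ ≤ 1 / 2 * (1 / 2) := by gcongr
      _ ≤ 1 := by norm_num

/-- The integral formula, applied to the constant family over the unit interval, bounds the norm by
an integral of a bounded function over the set `Ω(h)` of finite area. -/
theorem IsFineResolution.hsNormSq_lt_top {B τ₀ τ₁ h : ℝ} (H₀ : X.IsFineResolution B τ₀)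
    (H₁ : X.IsFineResolution B τ₁) (h0 : 0 < h) (hh : h ≤ X.bd⁻¹ / 2) (s : ℂ) :
    hsNormSq (X.composedTransferOperator τ₀ τ₁ h s) < ⊤ := by
  obtain ⟨k, hk, H⟩ := H₀.lintegral_hsNormSq_le H₁ h0 hh
  have h1 := (H (fun _ => s) continuous_const (Set.Ioc 0 1)).2
  simp only [lintegral_const, Measure.restrict_apply_univ, Real.volume_Ioc, sub_zero,
    ENNReal.ofReal_one, mul_one] at h1
  refine h1.trans_lt (ENNReal.sum_lt_top.mpr fun d _ => ?_)
  set K : ℝ := ∑ q ∈ (H₀.finite_wordPairs H₁ d).toFinset,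
    Real.exp (‖s‖ * (|Real.log (X.bd ^ 2 * X.size (q.1 ++ q.2))| +
      (|Real.log (X.size (q.1 ++ q.2))| + 2 * Real.log X.bd) + 2 * Real.pi * X.bd * h)) *
      (h / 2)⁻¹ with hK
  have hb : ∀ z ∈ X.Omega h ∩ X.disk d, ‖∑ q ∈ (H₀.finite_wordPairs H₁ d).toFinset,
      (starRingEnd ℂ) (Complex.exp (s * X.logDeriv q z)) • k z q‖ₑ ^ 2 ≤
      ENNReal.ofReal K ^ 2 := by
    intro z hz
    gcongr
    rw [← ofReal_norm]
    refine ENNReal.ofReal_le_ofReal ((norm_sum_le _ _).trans (Finset.sum_le_sum fun q hq => ?_))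
    have hq' := (Set.Finite.mem_toFinset _).mp hq
    obtain ⟨hre, hre'⟩ := H₀.logDeriv_bounds H₁ h0 hh hq' hz
    have him := (H₀.wordPairs_facts H₁ h0 hh hq' hz).2.1
    rw [norm_smul, RCLike.norm_conj, Complex.norm_exp]
    gcongr
    · refine (Complex.re_le_norm _).trans ?_
      rw [norm_mul]
      gcongr
      refine (Complex.norm_le_abs_re_add_abs_im _).trans (add_le_add ?_ him)
      have hl := Real.log_nonneg X.one_le_bd
      have a1 := le_abs_self (Real.log (X.bd ^ 2 * X.size (q.1 ++ q.2)))
      have a2 := abs_nonneg (Real.log (X.size (q.1 ++ q.2)))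
      have a3 := abs_nonneg (Real.log (X.bd ^ 2 * X.size (q.1 ++ q.2)))
      exact abs_le.mpr ⟨by linarith, by linarith⟩
    · exact (hk d q hq' z hz).1
  calc _ ≤ ∫⁻ _ in X.Omega h ∩ X.disk d, ENNReal.ofReal K ^ 2 :=
        setLIntegral_mono' ((X.isOpen_Omega h).inter Metric.isOpen_ball).measurableSet hb
    _ = ENNReal.ofReal K ^ 2 * volume (X.Omega h ∩ X.disk d) := setLIntegral_const _ _
    _ < ⊤ := by
        refine ENNReal.mul_lt_top (by simp) ?_
        exact (measure_mono Set.inter_subset_left).trans_lt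
          (lt_top_iff_ne_top.mpr (X.volume_Omega_ne_top h))

open Classical in
/-- The part of the mean square that comes from `Ω(h) ∩ D_d`. Only the pairs of words that share a
prefix contribute, and the integral over `Ω(h) ∩ D_d` is replaced by a sum over the disks of a
cover. -/
theorem IsFineResolution.lintegral_mean_le (hm : 2 ≤ m) {B τ₀ τ₁ T ρ : ℝ} (hB : 0 < B)
    (hτ₀ : 0 < τ₀) (hτ₁ : 0 < τ₁)
    (H₀ : X.IsFineResolution B τ₀) (H₁ : X.IsFineResolution B τ₁) (hT : 1 < T)
    (hh : T⁻¹ ≤ X.bd⁻¹ / 2) (hh2 : X.bd ^ 3 * (2 * T⁻¹) < 1) (hρ : (4 * X.bd ^ 9 + 2) * T⁻¹ ≤ ρ)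
    (hρ' : B * τ₀ ≤ X.bd ^ 3 * ρ) {d : Fin m ⊕ Fin m}
    {k : ℂ → List (Fin m ⊕ Fin m) × List (Fin m ⊕ Fin m) → X.H2 T⁻¹}
    (hk : ∀ q ∈ X.wordPairs τ₀ τ₁ d, ∀ z ∈ X.Omega T⁻¹ ∩ X.disk d, ‖k z q‖ ≤ (T⁻¹ / 2)⁻¹ ∧
      ∀ f, inner ℂ (k z q) f = bergmanSpace.rep f (X.wordMap (q.1 ++ q.2) z))
    {F : Finset (List (Fin m ⊕ Fin m))} {x : List (Fin m ⊕ Fin m) → ℝ} {c : ℝ} (hc : 0 ≤ c)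
    (hx : ∀ p ∈ F, (x p : ℂ) ∈ X.disk d)
    (hF : ∀ z ∈ X.Omega T⁻¹ ∩ X.disk d, ∃ p ∈ F, ‖z - x p‖ ≤ c * T⁻¹)
    {s : ℂ} {σ : ℝ} (hσ : 0 ≤ σ) (hs : σ ≤ s.re) (hst : |s.im| ≤ T) :
    ∫⁻ z in X.Omega T⁻¹ ∩ X.disk d, ∫⁻ t in Set.Ioc 0 T,
        ‖∑ q ∈ (H₀.finite_wordPairs H₁ d).toFinset,
          (starRingEnd ℂ) (Complex.exp ((s + t * Complex.I) * X.logDeriv q z)) • k z q‖ₑ ^ 2 ≤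
      ENNReal.ofReal (12 * Real.pi * c ^ 2 * Real.exp (8 * Real.pi * X.bd) *
        (1 + 4 * X.bd * c) * T * ((X.bd ^ 4 * B ^ 2 * (τ₀ * τ₁)) ^ σ) ^ 2 *
        ∑ q ∈ (H₀.finite_wordPairs H₁ d).toFinset,
          ∑ q' ∈ (H₀.finite_wordPairs H₁ d).toFinset with
            X.SharePrefix (X.bd ^ 3 * ρ) (q.1 ++ q.2) (q'.1 ++ q'.2),
            ∑ p ∈ F, (1 + T * |X.phase (q.1 ++ q.2) (q'.1 ++ q'.2) (x p)|)⁻¹) := by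
  have hT0 : 0 < T := by linarith
  have h0 : 0 < T⁻¹ := inv_pos.mpr hT0
  have hM := X.bd_pos
  set W := (H₀.finite_wordPairs H₁ d).toFinset with hW
  have hWm : ∀ q ∈ W, q ∈ X.wordPairs τ₀ τ₁ d := fun q hq => (Set.Finite.mem_toFinset _).mp hq
  set E : ℝ := Real.exp (2 * Real.pi * X.bd) * (X.bd ^ 4 * B ^ 2 * (τ₀ * τ₁)) ^ σ with hE
  have hE0 : 0 < E := by positivity
  set S : List (Fin m ⊕ Fin m) → ℝ := fun p => ∑ q ∈ W, ∑ q' ∈ W with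
    X.SharePrefix (X.bd ^ 3 * ρ) (q.1 ++ q.2) (q'.1 ++ q'.2),
      (1 + T * |X.phase (q.1 ++ q.2) (q'.1 ++ q'.2) (x p)|)⁻¹ with hS
  have hS0 : ∀ p, 0 ≤ S p := fun p => Finset.sum_nonneg fun q _ => Finset.sum_nonneg fun q' _ => by
    positivity
  set K : ℝ := (T⁻¹ / 2)⁻¹ * (T⁻¹ / 2)⁻¹ *
    (E * E * (3 * Real.exp (2 * (2 * Real.pi * X.bd)) * T * (1 + 4 * X.bd * c))) with hK
  have hK0 : 0 ≤ K := by positivity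
  -- `E` bounds the factors `exp (s L)`: the derivative has absolute value at most `1` and is at
  -- most a constant times `τ₀ τ₁`, and `|Im s| |Im L|` is bounded since `|Im s| ≤ T` and `|Im L|`
  -- is of order `T⁻¹`.
  have hexp : ∀ q ∈ W, ∀ z ∈ X.Omega T⁻¹ ∩ X.disk d,
      ‖Complex.exp (s * X.logDeriv q z)‖ ≤ E := by
    intro q hq z hz
    obtain ⟨-, b2, b3⟩ := H₀.size_bounds hB hτ₀ hτ₁ H₁ (hWm q hq)
    have hsz := X.size_pos ((hWm q hq).2.2.1)
    have him := (H₀.wordPairs_facts H₁ h0 hh (hWm q hq) hz).2.1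
    refine (norm_exp_mul_le hs hσ (H₀.logDeriv_bounds H₁ h0 hh (hWm q hq) hz).1
      (Real.log_nonpos (by positivity) b3)).trans ?_
    rw [Real.exp_add, mul_comm, hE]
    refine mul_le_mul (Real.exp_le_exp.mpr ?_) ?_ (Real.exp_pos _).le (Real.exp_pos _).le
    · calc |s.im| * |(X.logDeriv q z).im| ≤ T * (2 * Real.pi * X.bd * T⁻¹) := by gcongr
        _ = _ := by field_simp
    · rw [mul_comm σ, ← Real.rpow_def_of_pos (by positivity)]
      refine Real.rpow_le_rpow (by positivity) ?_ hσ
      calc _ ≤ X.bd ^ 2 * (X.bd ^ 2 * B ^ 2 * (τ₀ * τ₁)) := by gcongr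
        _ = _ := by ring
  have hpt : ∀ z ∈ X.Omega T⁻¹ ∩ X.disk d, ∀ p ∈ F, ‖z - x p‖ ≤ c * T⁻¹ →
      ∫⁻ t in Set.Ioc 0 T, ‖∑ q ∈ W, (starRingEnd ℂ)
        (Complex.exp ((s + t * Complex.I) * X.logDeriv q z)) • k z q‖ₑ ^ 2 ≤
      ENNReal.ofReal (K * S p) := by
    intro z hz p hp hzp
    refine (lintegral_norm_sum_exp_le W (k z) (fun q => X.logDeriv q z) s hT0
      (B := 2 * Real.pi * X.bd) (by positivity) fun q hq => ?_).trans
      (ENNReal.ofReal_le_ofReal ?_)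
    · have him := (H₀.wordPairs_facts H₁ h0 hh (hWm q hq) hz).2.1
      calc _ ≤ 2 * Real.pi * X.bd * T⁻¹ * T := by gcongr
        _ = 2 * Real.pi * X.bd := by field_simp
    · rw [hS, Finset.mul_sum]
      refine Finset.sum_le_sum fun q hq => ?_
      rw [Finset.mul_sum, Finset.sum_filter]
      refine Finset.sum_le_sum fun q' hq' => ?_
      have hqr := isReduced_of_mem_wordPairs (hWm q hq) (H₀.ne_nil _ (hWm q hq).2.1)
      have hqr' := isReduced_of_mem_wordPairs (hWm q' hq') (H₀.ne_nil _ (hWm q' hq').2.1)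
      split_ifs with hsh
      · have hph : (X.logDeriv q z).re - (X.logDeriv q' z).re =
            X.phase (q.1 ++ q.2) (q'.1 ++ q'.2) z := by
          rw [(H₀.wordPairs_facts H₁ h0 hh (hWm q hq) hz).2.2.1,
            (H₀.wordPairs_facts H₁ h0 hh (hWm q' hq') hz).2.2.1, phase]
          ring
        rw [hph]
        have h1 : ‖inner ℂ (k z q) (k z q')‖ ≤ (T⁻¹ / 2)⁻¹ * (T⁻¹ / 2)⁻¹ :=
          (norm_inner_le_norm _ _).trans (mul_le_mul (hk q (hWm q hq) z hz).1
            (hk q' (hWm q' hq') z hz).1 (norm_nonneg _) (by positivity))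
        have h2 := X.inv_one_add_phase_le hqr hqr' (by simp [H₀.ne_nil _ (hWm q hq).2.1])
          (by simp [H₀.ne_nil _ (hWm q' hq').2.1]) (X.disk_subset_closedDisk _ hz.2)
          (X.disk_subset_closedDisk _ (hx p hp)) hT0 hzp
        have h3 := hexp q hq z hz
        have h4 := hexp q' hq' z hz
        calc _ ≤ (T⁻¹ / 2)⁻¹ * (T⁻¹ / 2)⁻¹ * (E * E *
              (3 * Real.exp (2 * (2 * Real.pi * X.bd)) * T * ((1 + 4 * X.bd * c) *
                (1 + T * |X.phase (q.1 ++ q.2) (q'.1 ++ q'.2) (x p)|)⁻¹))) := by gcongr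
          _ = _ := by rw [hK]; ring
      · rw [H₀.inner_kernel_eq_zero hm H₁ h0 hh hh2 hρ hρ' (hWm q hq) (hWm q' hq') hsh hz
          (hk q (hWm q hq) z hz).2 (hk q' (hWm q' hq') z hz).2, norm_zero, zero_mul]
  have hmeas : MeasurableSet (X.Omega T⁻¹ ∩ X.disk d) :=
    ((X.isOpen_Omega _).inter Metric.isOpen_ball).measurableSet
  calc _ ≤ ∫⁻ z in X.Omega T⁻¹ ∩ X.disk d, ∑ p ∈ F,
        (Metric.closedBall (x p : ℂ) (c * T⁻¹)).indicator
          (fun _ => ENNReal.ofReal (K * S p)) z := by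
        refine setLIntegral_mono' hmeas fun z hz => ?_
        obtain ⟨p, hp, hzp⟩ := hF z hz
        refine (hpt z hz p hp hzp).trans ?_
        refine le_trans (le_of_eq ?_) (Finset.single_le_sum
          (f := fun p => (Metric.closedBall (x p : ℂ) (c * T⁻¹)).indicator
            (fun _ => ENNReal.ofReal (K * S p)) z) (fun _ _ => zero_le) hp)
        exact (Set.indicator_of_mem (by rwa [Metric.mem_closedBall, dist_eq_norm])
          (fun _ => ENNReal.ofReal (K * S p))).symm
    _ ≤ ∫⁻ z, ∑ p ∈ F, (Metric.closedBall (x p : ℂ) (c * T⁻¹)).indicator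
          (fun _ => ENNReal.ofReal (K * S p)) z := setLIntegral_le_lintegral _ _
    _ = ∑ p ∈ F, ENNReal.ofReal (K * S p * ((c * T⁻¹) ^ 2 * Real.pi)) := by
        rw [lintegral_finsetSum _ fun p _ => measurable_const.indicator
          Metric.isClosed_closedBall.measurableSet]
        refine Finset.sum_congr rfl fun p _ => ?_
        rw [lintegral_indicator Metric.isClosed_closedBall.measurableSet, setLIntegral_const,
          Complex.volume_closedBall, ENNReal.ofReal_mul (mul_nonneg hK0 (hS0 p)),
          ENNReal.ofReal_mul (p := (c * T⁻¹) ^ 2) (by positivity),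
          ENNReal.ofReal_pow (by positivity), ← NNReal.coe_real_pi, ENNReal.ofReal_coe_nnreal]
    _ = ENNReal.ofReal (∑ p ∈ F, K * S p * ((c * T⁻¹) ^ 2 * Real.pi)) :=
        (ENNReal.ofReal_sum_of_nonneg fun p _ =>
          mul_nonneg (mul_nonneg hK0 (hS0 p)) (by positivity)).symm
    _ = _ := by
        congr 1
        have e1 : ∑ p ∈ F, S p = ∑ q ∈ W, ∑ q' ∈ W with
            X.SharePrefix (X.bd ^ 3 * ρ) (q.1 ++ q.2) (q'.1 ++ q'.2),
            ∑ p ∈ F, (1 + T * |X.phase (q.1 ++ q.2) (q'.1 ++ q'.2) (x p)|)⁻¹ := by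
          rw [hS, Finset.sum_comm]
          exact Finset.sum_congr rfl fun q _ => Finset.sum_comm
        rw [← e1, ← Finset.sum_mul, ← Finset.mul_sum, hK, hE]
        have e2 : Real.exp (8 * Real.pi * X.bd) = Real.exp (2 * Real.pi * X.bd) *
            Real.exp (2 * Real.pi * X.bd) * Real.exp (2 * (2 * Real.pi * X.bd)) := by
          rw [← Real.exp_add, ← Real.exp_add]
          congr 1
          ring
        rw [e2]
        field_simp
        ring

end SchottkyData

/-! ### The mean square estimate -/

namespace SchottkyData

variable {m : ℕ} {X : SchottkyData m}

theorem IsFineResolution.mono {B B' τ : ℝ} (H : X.IsFineResolution B τ) (hB : 0 < B)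
    (hBB : B ≤ B') (hτ : 0 ≤ τ) : X.IsFineResolution B' τ where
  finite := H.finite
  reduced := H.reduced
  ne_nil := H.ne_nil
  size_ge b hb := le_trans (by gcongr) (H.size_ge b hb)
  size_le b hb := (H.size_le b hb).trans (by gcongr)
  small := H.small

variable (X)

/-- The mean square of the Hilbert-Schmidt norm, before the sizes of `τ₀` and `τ₁` are inserted. -/
theorem exists_mean_square_bound (hm : 2 ≤ m) {B : ℝ} (hB : 1 ≤ B) {η : ℝ} (hη : 0 < η) :
    ∃ C : ℝ, 1 ≤ C ∧ ∀ T τ₀ τ₁ : ℝ, 1 < T → T⁻¹ ≤ X.bd⁻¹ / 2 → X.bd ^ 3 * (2 * T⁻¹) < 1 →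
      0 < τ₀ → 0 < τ₁ → B⁻¹ * T⁻¹ ≤ τ₀ → τ₀ ≤ B * T⁻¹ → B⁻¹ * T⁻¹ ≤ τ₁ →
      X.IsFineResolution B τ₀ → X.IsFineResolution B τ₁ →
      ∀ σ ∈ Set.Icc (0 : ℝ) 1, ∀ s : ℂ, σ ≤ s.re → |s.im| ≤ T →
        AEMeasurable (fun t : ℝ =>
          hsNormSq (X.composedTransferOperator τ₀ τ₁ T⁻¹ (s + t * Complex.I)))
          (volume.restrict (Set.Ioc 0 T)) ∧
        ∫⁻ t in Set.Ioc 0 T,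
            hsNormSq (X.composedTransferOperator τ₀ τ₁ T⁻¹ (s + t * Complex.I)) ≤
          ENNReal.ofReal (C * T * ((τ₀ * τ₁) ^ (2 * σ) *
            ((τ₀ * τ₁) ^ (-(X.delta + 3 * η)) * T ^ (X.delta + 3 * η)))) := by
  classical
  have hM := X.bd_pos
  have hM1 := X.one_le_bd
  have hB0 : 0 < B := by linarith
  -- `B'` bounds `T` times the size of the shared prefixes: two words without a shared stopping word
  -- at scale `M³ ρ`, where `ρ = (4 M⁹ + 2 + B²) T⁻¹`, send `z` to different pieces of `Ω(T⁻¹)`, and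
  -- `B²` makes `M³ ρ` larger than the sizes of all the words.
  set B' : ℝ := X.bd ^ 3 * (4 * X.bd ^ 9 + 2 + B ^ 2) with hB'
  have hM3 : 1 ≤ X.bd ^ 3 := one_le_pow₀ hM1
  have hB1 : X.bd ^ 2 * B ^ 2 ≤ B' := by
    have h1 : X.bd ^ 2 ≤ X.bd ^ 3 := pow_le_pow_right₀ hM1 (by norm_num)
    calc X.bd ^ 2 * B ^ 2 ≤ X.bd ^ 3 * B ^ 2 := by gcongr
      _ ≤ _ := by
        rw [hB']
        gcongr
        have : 0 < X.bd ^ 9 := by positivity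
        linarith
  have hBB : B ≤ B' := by
    have h1 : 1 ≤ X.bd ^ 2 := one_le_pow₀ hM1
    nlinarith
  have hB'1 : 1 ≤ B' := hB.trans hBB
  have hB'0 : 0 < B' := by linarith
  obtain ⟨C, hC, H⟩ := X.exists_phase_sum_bound hm hη hB'1
  set c : ℝ := 2 * X.bd ^ 6 + 1 with hc
  have hc0 : 0 ≤ c := by positivity
  set K : ℝ := 12 * Real.pi * c ^ 2 * Real.exp (8 * Real.pi * X.bd) * (1 + 4 * X.bd * c) with hK
  have hK0 : 0 ≤ K := by positivity
  set D : ℝ := X.bd ^ 4 * B ^ 2 with hD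
  have hD1 : 1 ≤ D := one_le_mul_of_one_le_of_one_le (one_le_pow₀ hM1) (one_le_pow₀ hB)
  refine ⟨Fintype.card (Fin m ⊕ Fin m) * (K * D ^ 2 * C) + 1, ?_, ?_⟩
  · have : 0 ≤ (Fintype.card (Fin m ⊕ Fin m) : ℝ) * (K * D ^ 2 * C) := by positivity
    linarith
  intro T τ₀ τ₁ hT hh hh2 hτ₀ hτ₁ h1 h2 h3 H₀ H₁ σ hσ s hs hst
  have hT0 : 0 < T := by linarith
  have hTi : 0 < T⁻¹ := inv_pos.mpr hT0
  obtain ⟨k, hk, Hk⟩ := H₀.lintegral_hsNormSq_le H₁ hTi hh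
  have h4 := Hk (fun t => s + t * Complex.I) (by fun_prop) (Set.Ioc 0 T)
  refine ⟨h4.1, h4.2.trans ?_⟩
  set R : ℝ := K * T * ((D * (τ₀ * τ₁)) ^ σ) ^ 2 *
    (C * ((τ₀ * τ₁) ^ (-(X.delta + 3 * η)) * T ^ (X.delta + 3 * η))) with hR
  have hR0 : 0 ≤ R := by positivity
  have key : ∀ d : Fin m ⊕ Fin m, ∫⁻ z in X.Omega T⁻¹ ∩ X.disk d, ∫⁻ t in Set.Ioc 0 T,
      ‖∑ q ∈ (H₀.finite_wordPairs H₁ d).toFinset,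
        (starRingEnd ℂ) (Complex.exp ((s + t * Complex.I) * X.logDeriv q z)) • k z q‖ₑ ^ 2 ≤
      ENNReal.ofReal R := by
    intro d
    obtain ⟨F, x, hF, hcov⟩ := X.exists_cover_Omega hm hTi (inv_lt_one_of_one_lt₀ hT)
      (by have : 0 < X.bd⁻¹ := inv_pos.mpr hM
          linarith) d
    have hρ : (4 * X.bd ^ 9 + 2) * T⁻¹ ≤ (4 * X.bd ^ 9 + 2 + B ^ 2) * T⁻¹ :=
      mul_le_mul_of_nonneg_right (by linarith [sq_nonneg B]) hTi.le
    have hρ' : B * τ₀ ≤ X.bd ^ 3 * ((4 * X.bd ^ 9 + 2 + B ^ 2) * T⁻¹) := by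
      calc B * τ₀ ≤ B * (B * T⁻¹) := by gcongr
        _ = 1 * (B ^ 2 * T⁻¹) := by ring
        _ ≤ X.bd ^ 3 * ((4 * X.bd ^ 9 + 2 + B ^ 2) * T⁻¹) := by
          gcongr
          have : 0 < X.bd ^ 9 := by positivity
          linarith
    refine (H₀.lintegral_mean_le hm hB0 hτ₀ hτ₁ H₁ hT hh hh2 hρ hρ'
      (fun q hq z hz => hk d q hq z hz) hc0 (fun p hp => (hF p hp).2.2) hcov hσ.1 hs hst).trans
      (ENNReal.ofReal_le_ofReal ?_)
    have h5 := H T τ₀ τ₁ (X.bd ^ 3 * ((4 * X.bd ^ 9 + 2 + B ^ 2) * T⁻¹)) d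
      (H₀.finite_wordPairs H₁ d).toFinset F x hT hτ₀ hτ₁ (le_trans (by gcongr) h1)
      (h2.trans (by gcongr)) (le_trans (by gcongr) h3) (by rw [hB', mul_assoc])
      (by
        intro q hq
        have hq' := (Set.Finite.mem_toFinset _).mp hq
        obtain ⟨b1, b2, -⟩ := H₀.size_bounds hB0 hτ₀ hτ₁ H₁ hq'
        have hP : 0 < τ₀ * τ₁ := by positivity
        exact ⟨isReduced_of_mem_wordPairs hq' (H₀.ne_nil _ hq'.2.1),
          by simp [H₀.ne_nil _ hq'.2.1], le_trans (by gcongr) b1, b2.trans (by gcongr)⟩) hF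
    rw [hR]
    refine mul_le_mul_of_nonneg_left ?_ (by positivity)
    convert h5
  refine (Finset.sum_le_sum fun d _ => key d).trans ?_
  rw [Finset.sum_const, Finset.card_univ, nsmul_eq_mul, ← ENNReal.ofReal_natCast,
    ← ENNReal.ofReal_mul (by positivity)]
  refine ENNReal.ofReal_le_ofReal ?_
  have hP : 0 < τ₀ * τ₁ := by positivity
  have h6 : ((D * (τ₀ * τ₁)) ^ σ) ^ 2 ≤ D ^ 2 * (τ₀ * τ₁) ^ (2 * σ) := by
    rw [Real.mul_rpow (by positivity) hP.le, mul_pow, mul_comm 2 σ, Real.rpow_mul hP.le,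
      Real.rpow_two]
    gcongr
    calc D ^ σ ≤ D ^ (1 : ℝ) := Real.rpow_le_rpow_of_exponent_le hD1 hσ.2
      _ = D := Real.rpow_one D
  set Y := (τ₀ * τ₁) ^ (-(X.delta + 3 * η)) * T ^ (X.delta + 3 * η) with hY
  have hY0 : 0 ≤ Y := by positivity
  calc (Fintype.card (Fin m ⊕ Fin m) : ℝ) * R
      ≤ Fintype.card (Fin m ⊕ Fin m) *
        (K * T * (D ^ 2 * (τ₀ * τ₁) ^ (2 * σ)) * (C * Y)) := by rw [hR]; gcongr
    _ = Fintype.card (Fin m ⊕ Fin m) * (K * D ^ 2 * C) * T * ((τ₀ * τ₁) ^ (2 * σ) * Y) := by ring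
    _ ≤ _ := by gcongr; linarith

/-- The exponents: `τ₀ τ₁` is comparable to `T ^ (-κ)`, where `κ = (3 δ + 2) / (2 δ + 2) ≤ 2`. With
`η = ε / 9` the loss in the exponent of `T` is `3 η κ + 3 η ≤ ε`. -/
theorem rpow_resolution_le {A T τ₀ τ₁ : ℝ} (hA : 1 ≤ A) (hT : 1 ≤ T)
    (h : X.AdmissibleResolution A T τ₀ τ₁) {σ ε : ℝ} (hσ : σ ∈ Set.Icc (0 : ℝ) 1) (hε : 0 < ε) :
    (τ₀ * τ₁) ^ (2 * σ) * ((τ₀ * τ₁) ^ (-(X.delta + 3 * (ε / 9))) *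
      T ^ (X.delta + 3 * (ε / 9))) ≤ A ^ (2 * (3 + ε)) * T ^ (X.delta -
        (3 * X.delta + 2) / (2 * X.delta + 2) * (2 * σ - X.delta) + ε) := by
  obtain ⟨⟨a1, a2⟩, b1, b2⟩ := h
  have hδ0 := X.delta_nonneg
  have hδ1 := X.delta_le_one
  have hT0 : 0 < T := by linarith
  have hA0 : 0 < A := by linarith
  set κ : ℝ := (3 * X.delta + 2) / (2 * X.delta + 2) with hκ
  have hκ2 : κ ≤ 2 := by
    rw [hκ, div_le_iff₀ (by linarith)]
    linarith
  have hpow : T⁻¹ * T ^ (-(X.delta / (2 * X.delta + 2))) = T ^ (-κ) := by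
    rw [← Real.rpow_neg_one, ← Real.rpow_add hT0, hκ]
    congr 1
    field_simp
    ring
  set P : ℝ := T ^ (-κ) with hP
  have hP0 : 0 < P := Real.rpow_pos_of_pos hT0 _
  have hτ₀ : 0 < τ₀ := lt_of_lt_of_le (by positivity) a1
  have hτ₁ : 0 < τ₁ := lt_of_lt_of_le (by positivity) b1
  have hlow : (A ^ 2)⁻¹ * P ≤ τ₀ * τ₁ := by
    rw [← hpow]
    calc _ = A⁻¹ * T⁻¹ * (A⁻¹ * T ^ (-(X.delta / (2 * X.delta + 2)))) := by field_simp
      _ ≤ _ := by gcongr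
  have hup : τ₀ * τ₁ ≤ A ^ 2 * P := by
    rw [← hpow]
    calc _ ≤ A * T⁻¹ * (A * T ^ (-(X.delta / (2 * X.delta + 2)))) := by gcongr
      _ = _ := by ring
  have h1 : (τ₀ * τ₁) ^ (2 * σ) ≤ (A ^ 2) ^ (2 * σ) * P ^ (2 * σ) := by
    rw [← Real.mul_rpow (by positivity) hP0.le]
    exact Real.rpow_le_rpow (by positivity) hup (by linarith [hσ.1])
  have h2 : (τ₀ * τ₁) ^ (-(X.delta + 3 * (ε / 9))) ≤
      (A ^ 2) ^ (X.delta + 3 * (ε / 9)) * P ^ (-(X.delta + 3 * (ε / 9))) := by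
    calc _ ≤ ((A ^ 2)⁻¹ * P) ^ (-(X.delta + 3 * (ε / 9))) :=
          Real.rpow_le_rpow_of_nonpos (by positivity) hlow (by linarith)
      _ = _ := by
          rw [Real.mul_rpow (by positivity) hP0.le, Real.inv_rpow (by positivity),
            Real.rpow_neg (x := A ^ 2) (by positivity), inv_inv]
  have h3 : (A ^ 2) ^ (2 * σ) * (A ^ 2) ^ (X.delta + 3 * (ε / 9)) ≤ A ^ (2 * (3 + ε)) := by
    rw [← Real.rpow_add (by positivity), ← Real.rpow_natCast A 2, ← Real.rpow_mul hA0.le]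
    refine Real.rpow_le_rpow_of_exponent_le hA ?_
    push_cast
    linarith [hσ.2]
  have h4 : P ^ (2 * σ) * P ^ (-(X.delta + 3 * (ε / 9))) * T ^ (X.delta + 3 * (ε / 9)) ≤
      T ^ (X.delta - κ * (2 * σ - X.delta) + ε) := by
    rw [hP, ← Real.rpow_mul hT0.le, ← Real.rpow_mul hT0.le, ← Real.rpow_add hT0,
      ← Real.rpow_add hT0]
    refine Real.rpow_le_rpow_of_exponent_le hT ?_
    have h5 : κ * ε ≤ 2 * ε := by gcongr
    linarith
  calc _ ≤ (A ^ 2) ^ (2 * σ) * P ^ (2 * σ) *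
        ((A ^ 2) ^ (X.delta + 3 * (ε / 9)) * P ^ (-(X.delta + 3 * (ε / 9))) *
          T ^ (X.delta + 3 * (ε / 9))) := by gcongr
    _ = (A ^ 2) ^ (2 * σ) * (A ^ 2) ^ (X.delta + 3 * (ε / 9)) *
        (P ^ (2 * σ) * P ^ (-(X.delta + 3 * (ε / 9))) * T ^ (X.delta + 3 * (ε / 9))) := by ring
    _ ≤ _ := by gcongr

end SchottkyData

theorem mainTheorem4 {m : ℕ} (hm : 2 ≤ m) (X : SchottkyData m) (A : ℝ) (hA : 1 ≤ A) :
    ∃ T₀ : ℝ, 0 < T₀ ∧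
      (∀ T : ℝ, T₀ ≤ T → ∀ τ₀ τ₁ : ℝ, X.AdmissibleResolution A T τ₀ τ₁ → ∀ s : ℂ,
        X.IsRefinedTransferOperator τ₀ T⁻¹ s (X.refinedTransferOperator τ₀ T⁻¹ s) ∧
        X.IsRefinedTransferOperator τ₁ T⁻¹ s (X.refinedTransferOperator τ₁ T⁻¹ s) ∧
        hsNormSq (X.composedTransferOperator τ₀ τ₁ T⁻¹ s) < ⊤) ∧
      ∀ ε : ℝ, 0 < ε → ∃ C : ℝ, 0 < C ∧
        ∀ T : ℝ, T₀ ≤ T → ∀ τ₀ τ₁ : ℝ, X.AdmissibleResolution A T τ₀ τ₁ →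
          ∀ σ ∈ Set.Icc (0 : ℝ) X.delta, ∀ s : ℂ, σ ≤ s.re → |s.im| ≤ T →
            IntervalIntegrable
              (fun t : ℝ =>
                (hsNormSq (X.composedTransferOperator τ₀ τ₁ T⁻¹ (s + t * Complex.I))).toReal)
              MeasureTheory.volume 0 T ∧
            1 / T * ∫ t in (0 : ℝ)..T,
                (hsNormSq (X.composedTransferOperator τ₀ τ₁ T⁻¹ (s + t * Complex.I))).toReal ≤
              C * T ^ (X.delta -
                (3 * X.delta + 2) / (2 * X.delta + 2) * (2 * σ - X.delta) + ε) := by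
  obtain ⟨B₀, τ', hB₀, hτ', HY⟩ := X.exists_isFineResolution hm
  have hM := X.bd_pos
  have hM1 := X.one_le_bd
  have hA0 : 0 < A := by linarith
  have hδ := X.delta_pos hm
  have hδ1 := X.delta_le_one
  set β : ℝ := X.delta / (2 * X.delta + 2) with hβ
  have hβ0 : 0 < β := by positivity
  have hβ1 : β ≤ 1 := by
    rw [hβ, div_le_one (by linarith)]
    linarith
  -- From `T₀` on both resolutions are below `τ'` and `h` is small compared with the disks.
  have hev : ∀ᶠ T in Filter.atTop, A * T ^ (-β) ≤ τ' ∧ X.bd ^ 3 * (2 * T⁻¹) < 1 ∧ 1 < T := by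
    have h1 : Filter.Tendsto (fun T : ℝ => A * T ^ (-β)) Filter.atTop (𝓝 (A * 0)) :=
      (tendsto_rpow_neg_atTop hβ0).const_mul A
    have h2 : Filter.Tendsto (fun T : ℝ => X.bd ^ 3 * (2 * T⁻¹)) Filter.atTop
        (𝓝 (X.bd ^ 3 * (2 * 0))) := (tendsto_inv_atTop_zero.const_mul 2).const_mul _
    rw [mul_zero] at h1
    rw [mul_zero, mul_zero] at h2
    exact (h1.eventually_le_const hτ').and
      ((h2.eventually_lt_const one_pos).and (Filter.eventually_gt_atTop 1))
  obtain ⟨T₀, hT₀⟩ := Filter.eventually_atTop.mp hev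
  have hgood : ∀ T, max T₀ 1 ≤ T → ∀ τ₀ τ₁, X.AdmissibleResolution A T τ₀ τ₁ →
      1 < T ∧ T⁻¹ ≤ X.bd⁻¹ / 2 ∧ X.bd ^ 3 * (2 * T⁻¹) < 1 ∧ 0 < τ₀ ∧ 0 < τ₁ ∧
        A⁻¹ * T⁻¹ ≤ τ₀ ∧ τ₀ ≤ A * T⁻¹ ∧ A⁻¹ * T⁻¹ ≤ τ₁ ∧
        X.IsFineResolution B₀ τ₀ ∧ X.IsFineResolution B₀ τ₁ := by
    rintro T hT τ₀ τ₁ ⟨⟨a1, a2⟩, b1, b2⟩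
    obtain ⟨h1, h2, h3⟩ := hT₀ T ((le_max_left _ _).trans hT)
    have hT0 : 0 < T := by linarith
    have h4 : T⁻¹ ≤ T ^ (-β) := by
      rw [← Real.rpow_neg_one]
      exact Real.rpow_le_rpow_of_exponent_le h3.le (by linarith)
    have h5 : 0 < τ₀ := lt_of_lt_of_le (by positivity) a1
    have h6 : 0 < τ₁ := lt_of_lt_of_le (by positivity) b1
    have h7 : T⁻¹ ≤ X.bd⁻¹ / 2 := by
      have h8 : X.bd ≤ X.bd ^ 3 := le_self_pow₀ hM1 (by norm_num)
      have h9 : X.bd * (2 * T⁻¹) ≤ 1 := (mul_le_mul_of_nonneg_right h8 (by positivity)).trans h2.le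
      calc T⁻¹ = X.bd⁻¹ / 2 * (X.bd * (2 * T⁻¹)) := by field_simp
        _ ≤ X.bd⁻¹ / 2 * 1 := by gcongr
        _ = _ := mul_one _
    refine ⟨h3, h7, h2, h5, h6, a1, a2, le_trans (by gcongr) b1, HY τ₀ h5 ?_, HY τ₁ h6 ?_⟩
    · exact a2.trans (le_trans (by gcongr) h1)
    · exact b2.trans h1
  refine ⟨max T₀ 1, by positivity, fun T hT τ₀ τ₁ hτ s => ?_, fun ε hε => ?_⟩
  · obtain ⟨h1, h2, -, -, -, -, -, -, H₀, H₁⟩ := hgood T hT τ₀ τ₁ hτ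
    have hTi : 0 < T⁻¹ := inv_pos.mpr (by linarith)
    exact ⟨H₀.isRefinedTransferOperator hTi h2 s, H₁.isRefinedTransferOperator hTi h2 s,
      H₀.hsNormSq_lt_top H₁ hTi h2 s⟩
  · set B := max A B₀ with hB
    have hB1 : 1 ≤ B := hA.trans (le_max_left _ _)
    obtain ⟨C, hC, H⟩ := X.exists_mean_square_bound hm hB1 (η := ε / 9) (by positivity)
    refine ⟨C * A ^ (2 * (3 + ε)), by positivity, fun T hT τ₀ τ₁ hτ σ hσ s hs hst => ?_⟩
    obtain ⟨h1, h2, h3, h4, h5, h6, h7, h8, H₀, H₁⟩ := hgood T hT τ₀ τ₁ hτ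
    have hT0 : 0 < T := by linarith
    have hAB : A ≤ B := le_max_left _ _
    have hσ1 : σ ∈ Set.Icc (0 : ℝ) 1 := ⟨hσ.1, hσ.2.trans hδ1⟩
    obtain ⟨hmeas, hint⟩ := H T τ₀ τ₁ h1 h2 h3 h4 h5 (le_trans (by gcongr) h6)
      (h7.trans (by gcongr)) (le_trans (by gcongr) h8)
      (H₀.mono (by linarith) (le_max_right _ _) h4.le)
      (H₁.mono (by linarith) (le_max_right _ _) h5.le) σ hσ1 s hs hst
    have hfin : ∫⁻ t in Set.Ioc 0 T,
        hsNormSq (X.composedTransferOperator τ₀ τ₁ T⁻¹ (s + t * Complex.I)) ≠ ⊤ :=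
      (hint.trans_lt ENNReal.ofReal_lt_top).ne
    refine ⟨?_, ?_⟩
    · rw [intervalIntegrable_iff_integrableOn_Ioc_of_le hT0.le]
      exact integrable_toReal_of_lintegral_ne_top hmeas hfin
    · rw [intervalIntegral.integral_of_le hT0.le, integral_toReal hmeas
        (ae_lt_top' hmeas hfin)]
      have h9 := ENNReal.toReal_le_of_le_ofReal (by positivity) hint
      have h10 := X.rpow_resolution_le hA h1.le hτ hσ1 hε
      calc _ ≤ 1 / T * (C * T * ((τ₀ * τ₁) ^ (2 * σ) *
            ((τ₀ * τ₁) ^ (-(X.delta + 3 * (ε / 9))) * T ^ (X.delta + 3 * (ε / 9))))) := by gcongr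
        _ = C * ((τ₀ * τ₁) ^ (2 * σ) *
            ((τ₀ * τ₁) ^ (-(X.delta + 3 * (ε / 9))) * T ^ (X.delta + 3 * (ε / 9)))) := by
          field_simp
        _ ≤ C * (A ^ (2 * (3 + ε)) * T ^ (X.delta -
            (3 * X.delta + 2) / (2 * X.delta + 2) * (2 * σ - X.delta) + ε)) := by gcongr
        _ = _ := by ring
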